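/- For $h>0$ let the thin torus of height $h$ be $[0,1)\times[0,h)$ with the Euclidean torus distance $d(x,y)=\big(\min\{|x^1-y^1|,1-|x^1-y^1|\}^2+\min\{|x^2-y^2|,h-|x^2-y^2|\}^2\big)^{1/2}$. In the 2-NN model on it, the vertices $x_1,x_2,\dots,x_n$ are i.i.d. uniform, and for $2\le i\le n$ the vertex $x_i$ is joined to a closest vertex among $x_1,\dots,x_{i-1}$ (ties broken arbitrarily); $x_1$ is the root. The embedded unlabeled tree $T_n^\circ$ consists of the set of positions and the set of edges between them, without arrival times. It is a valid tree if its $n$ vertices are distinct and it arises in this way from some order of arrival of its vertices. Write $s(\varepsilon)=\frac{\log(1/\varepsilon)}{\log\log(1/\varepsilon)}$. (a) Upper bound. There are a single deterministic real-RAM algorithm, taking as input $\varepsilon$ and an embedded unlabeled tree (a list of vertex coordinates and a list of edges, in any order), and constants $C_1,C_2$ such that, for all heights $h_\varepsilon>0$ with $h_\varepsilon=O(\varepsilon^5)$ as $\varepsilon\to0^+$, the following holds for all sufficiently small $\varepsilon>0$ and all $n\ge1$. On each valid tree with $n$ vertices on the thin torus of height $h_\varepsilon$, the algorithm halts after at most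 $C_2\,(n^2+\log^2(1/\varepsilon))$ steps and returns a set $H(\varepsilon,T_n^\circ)$ of vertices, depending only on $\varepsilon$ and the unlabeled tree, with $|H(\varepsilon,T_n^\circ)|\le C_1\,s(\varepsilon)$. For the 2-NN tree $T_n$ on this torus, $\mathbb P\{x_1\in H(\varepsilon,T_n^\circ)\}\ge1-\varepsilon$. (b) Information-theoretic lower bound. There is a constant $c>0$ such that, for all heights $h_\varepsilon>0$ with $h_\varepsilon=O(1/\log(1/\varepsilon))$ as $\varepsilon\to0^+$, for every sufficiently small $\varepsilon>0$ there is $\delta>0$ (not depending on $n$) with the following property. For every $n>c\,s(\varepsilon)$ and every procedure $H$, of any complexity and possibly using randomness independent of $T_n$, that assigns to each valid embedded unlabeled tree with $n$ vertices on the thin torus of height $h_\varepsilon$ a set of at most $c\,s(\varepsilon)$ positions, one has $\mathbb P\{x_1\notin H(T_n^\circ)\}\ge\varepsilon+\delta$. Thus no confidence set of size at most $c\,s(\varepsilon)$ contains the root with probability at least $1-\varepsilon$, for any such $n$ or in the limit inferior as $n\to\infty$. -/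

import Mathlib

open MeasureTheory ProbabilityTheory Filter Topology Asymptotics

noncomputable section

/-! ### The thin torus and the nearest neighbour tree -/

/-- A point of the strip, given by its two coordinates. -/
abbrev Pt : Type := ℝ × ℝ

/-- Distance on the circle `[0, L)` of circumference `L`, in coordinates. -/
def circDist (L a b : ℝ) : ℝ := min |a - b| (L - |a - b|)

/-- Euclidean torus distance on the thin torus `[0,1) × [0,h)`. -/
def stripDist (h : ℝ) (p q : Pt) : ℝ :=
  Real.sqrt (circDist 1 p.1 q.1 ^ 2 + circDist h p.2 q.2 ^ 2)

/-- The thin torus, as a fundamental domain. -/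
def strip (h : ℝ) : Set Pt := Set.Ico (0 : ℝ) 1 ×ˢ Set.Ico (0 : ℝ) h

/-- The law of `n` independent uniform points of the thin torus; coordinate `0` is the vertex that
arrives first (the root), coordinate `1` the second, and so on. -/
def stripLaw (h : ℝ) (n : ℕ) : Measure (Fin n → Pt) :=
  Measure.pi fun _ => (volume : Measure Pt)[|strip h]

/-- `i` is, among the vertices that arrived before `j`, one that is closest to `j`. -/
def IsNearest (h : ℝ) {n : ℕ} (x : Fin n → Pt) (j i : Fin n) : Prop :=
  i < j ∧ ∀ l, l < j → stripDist h (x j) (x i) ≤ stripDist h (x j) (x l)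

open Classical in
/-- The earlier vertex to which `j` connects: a nearest one, ties being broken arbitrarily
(the value at the first vertex is not used). -/
def nnParent (h : ℝ) {n : ℕ} (x : Fin n → Pt) (j : Fin n) : Fin n :=
  if hj : ∃ i, IsNearest h x j i then hj.choose else j

/-- An embedded unlabeled tree: a finite set of positions and a finite set of unordered
pairs of positions. Arrival times are not part of the data. -/
structure EmbeddedTree where
  verts : Finset Pt
  edges : Finset (Sym2 Pt)

/-- Forget the labels: the embedded unlabeled tree in which the vertex at `x j`, for every `j` but
the first, is joined to the vertex at `x (p j)`. -/
def unlabel {n : ℕ} (x : Fin n → Pt) (p : Fin n → Fin n) : EmbeddedTree where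
  verts := Finset.univ.image x
  edges := (Finset.univ.filter fun j : Fin n => 0 < j.val).image fun j => s(x j, x (p j))

/-- The embedded unlabeled nearest neighbour tree grown from the arrival sequence `x`. -/
def nnTree (h : ℝ) {n : ℕ} (x : Fin n → Pt) : EmbeddedTree := unlabel x (nnParent h x)

/-- `T` is a valid embedded unlabeled nearest neighbour tree with `n` vertices on the thin torus:
some order of arrival of its vertices generates it (with some way of breaking ties). -/
def IsNNTree (h : ℝ) (n : ℕ) (T : EmbeddedTree) : Prop :=
  ∃ (x : Fin n → Pt) (p : Fin n → Fin n), Function.Injective x ∧ (∀ i, x i ∈ strip h) ∧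
    (∀ j : Fin n, 0 < j.val → IsNearest h x j (p j)) ∧ T = unlabel x p

/-! ### A uniform real random access machine

A program is a fixed finite text. Memory consists of registers and arrays for natural numbers
(used as counters and indices) and for real numbers. Every executed assignment and every
evaluated test costs one step; since the expressions occur in the program text, each of these
steps is a number of elementary operations that is bounded by a constant of the program. -/

structure RamState where
  natReg : ℕ → ℕ
  realReg : ℕ → ℝ
  natArr : ℕ → ℕ → ℕ
  realArr : ℕ → ℕ → ℝ

/-- Natural number expressions; `arr a e` is the entry of array `a` at index `e`. -/
inductive NatExp where
  | const (m : ℕ)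
  | reg (i : ℕ)
  | arr (a : ℕ) (e : NatExp)
  | add (e f : NatExp)
  | sub (e f : NatExp)

/-- Real expressions: exact field arithmetic, no rounding to integers. -/
inductive RealExp where
  | const (q : ℚ)
  | reg (i : ℕ)
  | arr (a : ℕ) (e : NatExp)
  | ofNat (e : NatExp)
  | add (e f : RealExp)
  | sub (e f : RealExp)
  | mul (e f : RealExp)
  | div (e f : RealExp)

inductive TestExp where
  | ltNat (e f : NatExp)
  | ltReal (e f : RealExp)
  | neg (b : TestExp)
  | conj (b c : TestExp)

inductive RamProg where
  | skip
  | setNat (i : ℕ) (e : NatExp)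
  | setReal (i : ℕ) (e : RealExp)
  | setNatArr (a : ℕ) (e f : NatExp)
  | setRealArr (a : ℕ) (e : NatExp) (f : RealExp)
  | seq (P Q : RamProg)
  | branch (b : TestExp) (P Q : RamProg)
  | loop (b : TestExp) (P : RamProg)

def NatExp.eval (s : RamState) : NatExp → ℕ
  | .const m => m
  | .reg i => s.natReg i
  | .arr a e => s.natArr a (e.eval s)
  | .add e f => e.eval s + f.eval s
  | .sub e f => e.eval s - f.eval s

def RealExp.eval (s : RamState) : RealExp → ℝ
  | .const q => (q : ℝ)
  | .reg i => s.realReg i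
  | .arr a e => s.realArr a (e.eval s)
  | .ofNat e => (e.eval s : ℝ)
  | .add e f => e.eval s + f.eval s
  | .sub e f => e.eval s - f.eval s
  | .mul e f => e.eval s * f.eval s
  | .div e f => e.eval s / f.eval s

def TestExp.Holds (s : RamState) : TestExp → Prop
  | .ltNat e f => e.eval s < f.eval s
  | .ltReal e f => e.eval s < f.eval s
  | .neg b => ¬ b.Holds s
  | .conj b c => b.Holds s ∧ c.Holds s

/-- `Exec P s s' t`: started in memory state `s`, the program `P` halts in the memory state `s'`
after exactly `t` steps. -/
inductive Exec : RamProg → RamState → RamState → ℕ → Prop where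
  | skip (s : RamState) : Exec .skip s s 1
  | setNat (s : RamState) (i : ℕ) (e : NatExp) :
      Exec (.setNat i e) s { s with natReg := Function.update s.natReg i (e.eval s) } 1
  | setReal (s : RamState) (i : ℕ) (e : RealExp) :
      Exec (.setReal i e) s { s with realReg := Function.update s.realReg i (e.eval s) } 1
  | setNatArr (s : RamState) (a : ℕ) (e f : NatExp) :
      Exec (.setNatArr a e f) s (RamState.mk s.natReg s.realReg
        (Function.update s.natArr a (Function.update (s.natArr a) (e.eval s) (f.eval s)))
        s.realArr) 1
  | setRealArr (s : RamState) (a : ℕ) (e : NatExp) (f : RealExp) :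
      Exec (.setRealArr a e f) s (RamState.mk s.natReg s.realReg s.natArr
        (Function.update s.realArr a (Function.update (s.realArr a) (e.eval s) (f.eval s)))) 1
  | seq {P Q : RamProg} {s s' s'' : RamState} {t t' : ℕ} :
      Exec P s s' t → Exec Q s' s'' t' → Exec (.seq P Q) s s'' (t + t')
  | branchTrue {b : TestExp} {P Q : RamProg} {s s' : RamState} {t : ℕ} :
      b.Holds s → Exec P s s' t → Exec (.branch b P Q) s s' (t + 1)
  | branchFalse {b : TestExp} {P Q : RamProg} {s s' : RamState} {t : ℕ} :
      ¬ b.Holds s → Exec Q s s' t → Exec (.branch b P Q) s s' (t + 1)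
  | loopDone {b : TestExp} {P : RamProg} {s : RamState} :
      ¬ b.Holds s → Exec (.loop b P) s s 1
  | loopStep {b : TestExp} {P : RamProg} {s s' s'' : RamState} {t t' : ℕ} :
      b.Holds s → Exec P s s' t → Exec (.loop b P) s' s'' t' → Exec (.loop b P) s s'' (t + t' + 1)

/-! ### Root finding programs -/

/-- `v`, `e` present the embedded tree `T` with `n` vertices: `v` lists its vertices and `e` lists
its `n - 1` edges as pairs of indices into `v`, in any order and any orientation. -/
def IsPresentation {n : ℕ} (T : EmbeddedTree) (v : Fin n → Pt) (e : Fin (n - 1) → Fin n × Fin n) :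
    Prop :=
  Function.Injective v ∧ T.verts = Finset.univ.image v ∧
    T.edges = Finset.univ.image fun j => s(v (e j).1, v (e j).2)

/-- The initial memory: the number of vertices and `ε` in the registers `0`, the two coordinates of
the vertices in the real arrays `0` and `1`, the two endpoints of the edges in the natural number
arrays `0` and `1`, and zeros everywhere else. -/
def initState {n : ℕ} (ε : ℝ) (v : Fin n → Pt) (e : Fin (n - 1) → Fin n × Fin n) : RamState where
  natReg := fun i => if i = 0 then n else 0
  realReg := fun i => if i = 0 then ε else 0
  natArr := fun a j => if hj : j < n - 1 then
    (if a = 0 then ((e ⟨j, hj⟩).1 : ℕ) else if a = 1 then ((e ⟨j, hj⟩).2 : ℕ) else 0) else 0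
  realArr := fun a i => if hi : i < n then
    (if a = 0 then (v ⟨i, hi⟩).1 else if a = 1 then (v ⟨i, hi⟩).2 else 0) else 0

/-- The set returned: the listed vertices that are marked by a nonzero entry in the natural number
array `2`. -/
def returned {n : ℕ} (v : Fin n → Pt) (s : RamState) : Finset Pt :=
  (Finset.univ.filter fun i : Fin n => s.natArr 2 i ≠ 0).image v

/-- On input `ε` and any presentation of the unlabeled tree `T` with `n` vertices, the program `P`
halts after at most `B` steps and returns the set `S` of vertices. -/
def ReturnsWithin (P : RamProg) (ε : ℝ) (n : ℕ) (T : EmbeddedTree) (S : Finset Pt) (B : ℝ) : Prop :=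
  ∀ (v : Fin n → Pt) (e : Fin (n - 1) → Fin n × Fin n), IsPresentation T v e →
    ∃ (s : RamState) (t : ℕ), Exec P (initState ε v e) s t ∧ returned v s = S ∧ (t : ℝ) ≤ B

end

/-! Upper bound. At heights of order ε^5 the torus is a circle as far as the first vertices are
concerned. As long as their horizontal distances are at least the height, horizontal distances
decide who is nearest, and no edge passes over an earlier vertex (`nonCrossing_of_isNearest`). On
the universal cover of the circle the lifted tree then grows as an interval of length less than one.
Its ends move only at records, that is, at vertices to the right or to the left of all predecessors.
The parent of a record is the end that it extends, so a record has depth at most the number of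
records so far, and an edge of a vertex that is no record is shorter than that of some record
(`NonCrossing.exists_longer`). Hence the longest edge is a record edge, and it is close to the root
unless many records precede it.

Suppose that `R` records precede a longest edge of extent `e`. Let G be the length of the uncovered
arc after the `R`-th record. The covered part has length at most `R * e`, and the longest edge still
has to fit into the uncovered arc, so G > e and G ≥ 1/(1+R) (`NonCrossing.escapes`). But each record
cuts the uncovered arc at a uniform point and leaves one of the two pieces, so after `R` hits it
should be far shorter than that. Markov's inequality for the sum of the `l`-th powers of all
possible pieces, which shrinks in mean by the factor 2/(l+1) at each hit, bounds the exceptional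
event (`stripLaw_escapes_le`). With `R` eight times the inverse factorial K of 1/ε and `l` near √K,
the bound is at most ε/4 (`escape_bound`).

The set is computed without labels. Edges of extent at least ε/8 are called long. Outside small
events the first edge is long and no late edge is (`stripLaw_exists_long_le`), so the path between
the extreme endpoints of long edges, ordered by their lifts, contains the root and a longest record
edge; the vertices of the path within `R` of its longest edge are returned (`Selects.root_mem`). The
program `rootProg` carries this out by passes through the edge list, and `Selects.unique` shows that
the result does not depend on how the tree is listed. The remaining work is the union bound
`stripLaw_root_notMem_le` and the choice of scales in `eventually_exists_scales`.

Lower bound. If the first `k` points form an evenly spaced row, then starting at any row point,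
going up to the end and then down from the start produces the same tree (`IsRow.nnTree_comp`). Any
set with fewer than `k` elements misses one of these `k` possible roots. Permuting arrivals
preserves the law, so the probability of a row is at most `k` times the probability of missing the
root (`le_prob_notMem`). A row has probability at least (16k)^(-k), and this is at least 2εk for `k`
of order s(ε). -/

/-! ### Paths in a tree given by a parent function -/

/-- `w 0, …, w q` is a simple path from `u` to `v` for the adjacency relation `A`. -/
structure IsSimplePath {α : Type*} (A : α → α → Prop) (u v : α) (w : ℕ → α) (q : ℕ) : Prop where
  start : w 0 = u
  finish : w q = v
  adj : ∀ j < q, A (w j) (w (j + 1))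
  inj : Set.InjOn w {j | j ≤ q}

/-- The graph that joins every `j > 0` to its parent `p j`. -/
def parentGraph {n : ℕ} (p : Fin n → Fin n) : SimpleGraph (Fin n) :=
  SimpleGraph.fromRel fun i j => 0 < j.val ∧ i = p j

/-- Following parents leads to vertex 0, so the graph is connected; each other vertex contributes at
most one edge. A connected graph with at most n - 1 edges is a tree. -/
lemma parentGraph_isAcyclic {n : ℕ} (p : Fin n → Fin n) (hp : ∀ j : Fin n, 0 < j.val → p j < j) :
    (parentGraph p).IsAcyclic := by
  classical
  rcases Nat.eq_zero_or_pos n with rfl | hn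
  · intro v; exact v.elim0
  have hconn : (parentGraph p).Connected := by
    have key : ∀ m (j : Fin n), j.val = m → (parentGraph p).Reachable j ⟨0, hn⟩ := by
      intro m
      induction m using Nat.strong_induction_on with
      | _ m ih =>
        intro j hj
        rcases Nat.eq_zero_or_pos j.val with h0 | h0
        · have : j = ⟨0, hn⟩ := Fin.ext h0
          rw [this]
        · have hlt := hp j h0
          have hadj : (parentGraph p).Adj j (p j) := by
            rw [parentGraph, SimpleGraph.fromRel_adj]
            exact ⟨hlt.ne', Or.inr ⟨h0, rfl⟩⟩
          exact hadj.reachable.trans (ih (p j).val (by rw [← hj]; exact hlt) (p j) rfl)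
    have : Nonempty (Fin n) := ⟨⟨0, hn⟩⟩
    exact ⟨fun i j => (key _ i rfl).trans (key _ j rfl).symm⟩
  have hsub : (parentGraph p).edgeSet ⊆
      ((Finset.univ.filter fun j : Fin n => 0 < j.val).image fun j => s(p j, j) : Finset _) := by
    intro e
    induction e using Sym2.ind with
    | _ a b =>
      intro he
      rw [SimpleGraph.mem_edgeSet, parentGraph, SimpleGraph.fromRel_adj] at he
      simp only [Finset.coe_image, Set.mem_image, Finset.coe_filter, Finset.mem_univ, true_and]
      rcases he with ⟨-, ⟨h1, h2⟩ | ⟨h1, h2⟩⟩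
      · exact ⟨b, h1, by rw [h2]⟩
      · exact ⟨a, h1, by rw [h2, Sym2.eq_swap]⟩
  have hcard : Nat.card (parentGraph p).edgeSet + 1 ≤ Nat.card (Fin n) := by
    have h1 : Nat.card (parentGraph p).edgeSet ≤
        (Finset.univ.filter fun j : Fin n => 0 < j.val).card := by
      rw [Nat.card_coe_set_eq]
      refine (Set.ncard_le_ncard hsub (Finset.finite_toSet _)).trans ?_
      rw [Set.ncard_coe_finset]
      exact Finset.card_image_le
    have h2 : (Finset.univ.filter fun j : Fin n => 0 < j.val).card < n := by
      calc _ < (Finset.univ : Finset (Fin n)).card := by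
            apply Finset.card_lt_card
            rw [Finset.filter_ssubset]
            exact ⟨⟨0, hn⟩, Finset.mem_univ _, by simp⟩
        _ = n := by simp
    simp only [Nat.card_eq_fintype_card, Fintype.card_fin] at h1 ⊢
    omega
  exact (SimpleGraph.isTree_iff_connected_and_card.2
    ⟨hconn, le_antisymm hcard hconn.card_vert_le_card_edgeSet_add_one⟩).isAcyclic

/-- Paths are kept as functions on ℕ because the program produces them as iterates of a parent
array. The passage to `Walk` is made only to borrow uniqueness of paths in acyclic graphs. -/
lemma exists_walk_of_adj {V : Type*} (G : SimpleGraph V) (w : ℕ → V) (q : ℕ)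
    (h : ∀ j < q, G.Adj (w j) (w (j + 1))) :
    ∃ p : G.Walk (w 0) (w q), p.length = q ∧ ∀ j ≤ q, p.getVert j = w j := by
  induction q with
  | zero => exact ⟨.nil, rfl, fun j hj => by simp [Nat.le_zero.1 hj]⟩
  | succ q ih =>
    obtain ⟨p, hl, hp⟩ := ih fun j hj => h j (by omega)
    refine ⟨p.concat (h q (by omega)), by simp [hl], fun j hj => ?_⟩
    rw [SimpleGraph.Walk.concat_eq_append, SimpleGraph.Walk.getVert_append]
    split_ifs with hlt
    · exact hp j (by omega)
    · rw [hl] at hlt ⊢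
      rcases (by omega : j = q ∨ j = q + 1) with rfl | rfl <;> simp

lemma IsSimplePath.unique {V : Type*} {G : SimpleGraph V} (hG : G.IsAcyclic) {u v : V}
    {w w' : ℕ → V} {q q' : ℕ} (h : IsSimplePath G.Adj u v w q) (h' : IsSimplePath G.Adj u v w' q') :
    q = q' ∧ ∀ j ≤ q, w j = w' j := by
  obtain ⟨rfl, rfl, ha, hi⟩ := h
  obtain ⟨hs, hf, ha', hi'⟩ := h'
  obtain ⟨p, hl, hp⟩ := exists_walk_of_adj G w q ha
  obtain ⟨p', hl', hp'⟩ := exists_walk_of_adj G w' q' ha'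
  have h1 : p.IsPath := by
    rw [← SimpleGraph.Walk.IsPath.getVert_injOn_iff, hl]
    intro i hi1 j hj1 hij
    exact hi hi1 hj1 (by rwa [hp i hi1, hp j hj1] at hij)
  have h2 : (p'.copy hs hf).IsPath := by
    rw [SimpleGraph.Walk.isPath_copy, ← SimpleGraph.Walk.IsPath.getVert_injOn_iff, hl']
    intro i hi1 j hj1 hij
    exact hi' hi1 hj1 (by rwa [hp' i hi1, hp' j hj1] at hij)
  have h3 : p = p'.copy hs hf := by
    have := (hG.subsingleton_path (w 0) (w q)).elim ⟨p, h1⟩ ⟨_, h2⟩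
    exact congrArg Subtype.val this
  have hq : q = q' := by rw [← hl, h3, SimpleGraph.Walk.length_copy, hl']
  refine ⟨hq, fun j hj => ?_⟩
  rw [← hp j hj, h3, SimpleGraph.Walk.getVert_copy, hp' j (by omega)]

/-! ### Displacement on the circle, lifts, and the selection rule -/

/-- The signed horizontal displacement from `u` to `v` along the shorter arc. -/
noncomputable def shift (u v : Pt) : ℝ :=
  if 1 / 2 < v.1 - u.1 then v.1 - u.1 - 1
  else if v.1 - u.1 < -(1 / 2) then v.1 - u.1 + 1 else v.1 - u.1

lemma shift_symm (u v : Pt) : shift v u = -shift u v := by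
  unfold shift; split_ifs <;> linarith

lemma shift_int (u v : Pt) : ∃ m : ℤ, shift u v = v.1 - u.1 + m := by
  unfold shift
  split_ifs
  · exact ⟨-1, by push_cast; ring⟩
  · exact ⟨1, by push_cast; ring⟩
  · exact ⟨0, by simp⟩

lemma abs_shift_le {h : ℝ} {u v : Pt} (hu : u ∈ strip h) (hv : v ∈ strip h) :
    |shift u v| ≤ 1 / 2 := by
  obtain ⟨⟨h1, h2⟩, -⟩ := hu
  obtain ⟨⟨h3, h4⟩, -⟩ := hv
  unfold shift
  rw [abs_le]
  split_ifs <;> constructor <;> linarith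

lemma abs_shift_eq {h : ℝ} {u v : Pt} (hu : u ∈ strip h) (hv : v ∈ strip h) :
    |shift u v| = circDist 1 u.1 v.1 := by
  obtain ⟨⟨h1, h2⟩, -⟩ := hu
  obtain ⟨⟨h3, h4⟩, -⟩ := hv
  unfold shift circDist
  rcases abs_cases (u.1 - v.1) with ⟨e, _⟩ | ⟨e, _⟩ <;> rw [e] <;> split_ifs <;>
  first
  | (exfalso; linarith)
  | (rw [min_eq_left (by linarith), abs_of_nonneg (by linarith)]; linarith)
  | (rw [min_eq_left (by linarith), abs_of_nonpos (by linarith)]; linarith)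
  | (rw [min_eq_right (by linarith), abs_of_nonneg (by linarith)]; linarith)
  | (rw [min_eq_right (by linarith), abs_of_nonpos (by linarith)]; linarith)

namespace EmbeddedTree

variable (T : EmbeddedTree)

/-- Horizontal coordinates of the vertices on the universal cover, consistent along the edges. -/
structure IsLift (φ : Pt → ℝ) : Prop where
  edge : ∀ u v, s(u, v) ∈ T.edges → φ v = φ u + shift u v
  int : ∀ u ∈ T.verts, ∃ m : ℤ, φ u = u.1 + m

/-- `v` is an endpoint of an edge whose horizontal extent is at least `θ`. -/
def IsLong (θ : ℝ) (v : Pt) : Prop := ∃ w, s(v, w) ∈ T.edges ∧ θ ≤ |shift v w|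

/-- The lexicographic order of the lifts. -/
def Before (φ : Pt → ℝ) (u v : Pt) : Prop := φ u < φ v ∨ (φ u = φ v ∧ u.2 ≤ v.2)

/-- The edge between positions `i` and `i + 1` is the first one on the path `w` of maximal
horizontal extent. -/
structure IsFirstLongest (w : ℕ → Pt) (q i : ℕ) : Prop where
  lt : i < q
  le : ∀ j < q, |shift (w j) (w (j + 1))| ≤ |shift (w i) (w (i + 1))|
  lt_of_lt : ∀ j < i, |shift (w j) (w (j + 1))| < |shift (w i) (w (i + 1))|

open Classical in
/-- The vertices of the path `w` at distance at most `R` from position `i`. -/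
noncomputable def window (w : ℕ → Pt) (q i R : ℕ) : Finset Pt :=
  ((Finset.range (q + 1)).filter fun j => j ≤ i + R ∧ i ≤ j + R).image w

/-- The rule that selects the confidence set: on the path between the extreme endpoints of long
edges, the vertices at distance at most `R` from the longest edge. -/
def Selects (θ : ℝ) (R : ℕ) (S : Finset Pt) : Prop :=
  (T.verts.card = 1 ∧ S = T.verts) ∨
  (T.verts.card ≠ 1 ∧ (∀ v, ¬ T.IsLong θ v) ∧ S = ∅) ∨
  (T.verts.card ≠ 1 ∧ ∃ (φ : Pt → ℝ) (a b : Pt) (w : ℕ → Pt) (q i : ℕ), T.IsLift φ ∧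
    T.IsLong θ a ∧ T.IsLong θ b ∧ (∀ v, T.IsLong θ v → Before φ a v ∧ Before φ v b) ∧
    IsSimplePath (fun u v => s(u, v) ∈ T.edges) b a w q ∧ IsFirstLongest w q i ∧
    S = window w q i R)

end EmbeddedTree

open EmbeddedTree

lemma card_window_le (w : ℕ → Pt) (q i R : ℕ) : (window w q i R).card ≤ 2 * R + 1 := by
  classical
  refine Finset.card_image_le.trans ?_
  have : ((Finset.range (q + 1)).filter fun j => j ≤ i + R ∧ i ≤ j + R) ⊆
      Finset.Icc (i - R) (i + R) := by
    intro j hj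
    simp only [Finset.mem_filter, Finset.mem_Icc] at hj ⊢
    omega
  refine (Finset.card_le_card this).trans ?_
  rw [Nat.card_Icc]
  omega

/-! ### Uniqueness of the selected set -/

section Unlabel

variable {n : ℕ} {x : Fin n → Pt} {p : Fin n → Fin n}

lemma mem_verts_unlabel {u : Pt} : u ∈ (unlabel x p).verts ↔ ∃ i, x i = u := by
  simp [unlabel]

lemma mem_edges_unlabel {u v : Pt} : s(u, v) ∈ (unlabel x p).edges ↔
    ∃ j : Fin n, 0 < j.val ∧ ((x j = u ∧ x (p j) = v) ∨ (x j = v ∧ x (p j) = u)) := by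
  simp [unlabel]

lemma adj_unlabel (hx : Function.Injective x) (hp : ∀ j : Fin n, 0 < j.val → p j < j)
    {i j : Fin n} : s(x i, x j) ∈ (unlabel x p).edges ↔ (parentGraph p).Adj i j := by
  rw [mem_edges_unlabel, parentGraph, SimpleGraph.fromRel_adj]
  constructor
  · rintro ⟨l, hl, ⟨h1, h2⟩ | ⟨h1, h2⟩⟩
    · obtain rfl := hx h1
      obtain rfl := hx h2
      exact ⟨(hp l hl).ne', Or.inr ⟨hl, rfl⟩⟩
    · obtain rfl := hx h1
      obtain rfl := hx h2
      exact ⟨(hp l hl).ne, Or.inl ⟨hl, rfl⟩⟩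
  · rintro ⟨-, ⟨h1, h2⟩ | ⟨h1, h2⟩⟩
    · exact ⟨j, h1, Or.inr ⟨rfl, by rw [h2]⟩⟩
    · exact ⟨i, h1, Or.inl ⟨rfl, by rw [h2]⟩⟩

lemma left_mem_of_edge {u v : Pt} (h : s(u, v) ∈ (unlabel x p).edges) : ∃ i, x i = u := by
  obtain ⟨j, -, ⟨h, -⟩ | ⟨-, h⟩⟩ := mem_edges_unlabel.1 h
  · exact ⟨j, h⟩
  · exact ⟨p j, h⟩

lemma right_mem_of_edge {u v : Pt} (h : s(u, v) ∈ (unlabel x p).edges) : ∃ i, x i = v := by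
  rw [Sym2.eq_swap] at h
  exact left_mem_of_edge h

/-- A simple path of positions comes from a simple path of labels. -/
lemma exists_label_path (hx : Function.Injective x) (hp : ∀ j : Fin n, 0 < j.val → p j < j)
    {a b : Fin n} {w : ℕ → Pt} {q : ℕ}
    (hw : IsSimplePath (fun u v => s(u, v) ∈ (unlabel x p).edges) (x b) (x a) w q) :
    ∃ w' : ℕ → Fin n, IsSimplePath (parentGraph p).Adj b a w' q ∧ ∀ j ≤ q, w j = x (w' j) := by
  have hmem : ∀ j ≤ q, ∃ i, x i = w j := by
    intro j hj
    cases j with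
    | zero => exact ⟨b, hw.start.symm⟩
    | succ j => exact right_mem_of_edge (hw.adj j (by omega))
  have : Nonempty (Fin n) := ⟨a⟩
  choose! w' hw' using hmem
  refine ⟨w', ⟨hx ?_, hx ?_, fun j hj => ?_, ?_⟩, fun j hj => (hw' j hj).symm⟩
  · rw [hw' 0 (by omega), hw.start]
  · rw [hw' q le_rfl, hw.finish]
  · rw [← adj_unlabel hx hp, hw' j hj.le, hw' (j + 1) hj]
    exact hw.adj j hj
  · intro i hi j hj hij
    apply hw.inj hi hj
    rw [← hw' i hi, ← hw' j hj, hij]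

lemma simplePath_unique (hx : Function.Injective x) (hp : ∀ j : Fin n, 0 < j.val → p j < j)
    {a b : Pt} (ha : ∃ i, x i = a) (hb : ∃ i, x i = b) {w w' : ℕ → Pt} {q q' : ℕ}
    (hw : IsSimplePath (fun u v => s(u, v) ∈ (unlabel x p).edges) b a w q)
    (hw' : IsSimplePath (fun u v => s(u, v) ∈ (unlabel x p).edges) b a w' q') :
    q = q' ∧ ∀ j ≤ q, w j = w' j := by
  obtain ⟨a, rfl⟩ := ha
  obtain ⟨b, rfl⟩ := hb
  obtain ⟨y, hy, e⟩ := exists_label_path hx hp hw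
  obtain ⟨y', hy', e'⟩ := exists_label_path hx hp hw'
  obtain ⟨rfl, h⟩ := hy.unique (parentGraph_isAcyclic p hp) hy'
  exact ⟨rfl, fun j hj => by rw [e j hj, e' j hj, h j hj]⟩

/-- Two lifts differ by a constant. -/
lemma IsLift.sub_eq (hp : ∀ j : Fin n, 0 < j.val → p j < j) {φ ψ : Pt → ℝ}
    (hφ : (unlabel x p).IsLift φ) (hψ : (unlabel x p).IsLift ψ) (i j : Fin n) :
    φ (x i) - ψ (x i) = φ (x j) - ψ (x j) := by
  have hn : 0 < n := i.pos
  have key : ∀ m (j : Fin n), j.val = m →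
      φ (x j) - ψ (x j) = φ (x ⟨0, hn⟩) - ψ (x ⟨0, hn⟩) := by
    intro m
    induction m using Nat.strong_induction_on with
    | _ m ih =>
      intro j hj
      rcases Nat.eq_zero_or_pos j.val with h0 | h0
      · rw [show j = ⟨0, hn⟩ from Fin.ext h0]
      · have he : s(x (p j), x j) ∈ (unlabel x p).edges :=
          mem_edges_unlabel.2 ⟨j, h0, Or.inr ⟨rfl, rfl⟩⟩
        rw [hφ.edge _ _ he, hψ.edge _ _ he, ← ih (p j).val (by rw [← hj]; exact hp j h0) (p j) rfl]
        ring
  rw [key _ i rfl, key _ j rfl]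

lemma IsLong.exists_label {θ : ℝ} {v : Pt} (h : (unlabel x p).IsLong θ v) : ∃ i, x i = v := by
  obtain ⟨w, hw, -⟩ := h
  exact left_mem_of_edge hw

/-- Equal lifts make the first coordinates differ by an integer, and both lie in [0,1). Hence the
lexicographic order is antisymmetric on vertices, even when horizontal coordinates coincide. -/
lemma IsLift.eq_of_eq {h : ℝ} {T : EmbeddedTree} {φ : Pt → ℝ} (hφ : T.IsLift φ) {u v : Pt}
    (hu : u ∈ T.verts) (hv : v ∈ T.verts) (hu' : u ∈ strip h) (hv' : v ∈ strip h)
    (h1 : φ u = φ v) (h2 : u.2 = v.2) : u = v := by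
  obtain ⟨m, hm⟩ := hφ.int u hu
  obtain ⟨k, hk⟩ := hφ.int v hv
  obtain ⟨⟨h3, h4⟩, -⟩ := hu'
  obtain ⟨⟨h5, h6⟩, -⟩ := hv'
  have h7 : ((m - k : ℤ) : ℝ) = v.1 - u.1 := by push_cast; linarith
  have h8 : ((m - k : ℤ) : ℝ) < 1 := by linarith
  have h9 : (-1 : ℝ) < ((m - k : ℤ) : ℝ) := by linarith
  have h8' : m - k < 1 := by exact_mod_cast h8
  have h9' : -1 < m - k := by exact_mod_cast h9
  have h10 : m - k = 0 := by omega
  rw [h10] at h7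
  refine Prod.ext ?_ h2
  push_cast at h7
  linarith

lemma card_verts_unlabel (hx : Function.Injective x) : (unlabel x p).verts.card = n := by
  simp [unlabel, Finset.card_image_of_injective _ hx]

/-- Two lifts differ by a constant and so induce the same order. The extremes are then unique by
antisymmetry, the path by acyclicity, and the longest edge because the first one is taken. No
genericity is needed, so this covers every valid tree. -/
lemma Selects.unique {h : ℝ} (hx : Function.Injective x) (hs : ∀ i, x i ∈ strip h)
    (hp : ∀ j : Fin n, 0 < j.val → p j < j) {θ : ℝ} {R : ℕ} {S S' : Finset Pt}
    (h1 : (unlabel x p).Selects θ R S) (h2 : (unlabel x p).Selects θ R S') : S = S' := by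
  rcases h1 with ⟨c1, rfl⟩ | ⟨c1, n1, rfl⟩ | ⟨c1, φ, a, b, w, q, i, hφ, ha, hb, hab, hw, hi, rfl⟩
  · rcases h2 with ⟨c2, rfl⟩ | ⟨c2, -⟩ | ⟨c2, -⟩
    · rfl
    · exact absurd c1 c2
    · exact absurd c1 c2
  · rcases h2 with ⟨c2, -⟩ | ⟨c2, -, rfl⟩ | ⟨c2, φ, a, b, w, q, i, -, ha, -⟩
    · exact absurd c2 c1
    · rfl
    · exact absurd ha (n1 a)
  · rcases h2 with ⟨c2, -⟩ | ⟨-, n2, -⟩ |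
      ⟨-, φ', a', b', w', q', i', hφ', ha', hb', hab', hw', hi', rfl⟩
    · exact absurd c2 c1
    · exact absurd ha (n2 a)
    have hB : ∀ u v, (unlabel x p).IsLong θ u → (unlabel x p).IsLong θ v →
        Before φ' u v → Before φ u v := by
      intro u v hu hv huv
      obtain ⟨i, rfl⟩ := IsLong.exists_label hu
      obtain ⟨j, rfl⟩ := IsLong.exists_label hv
      have := IsLift.sub_eq hp hφ hφ' i j
      rcases huv with h | ⟨h, h'⟩
      · left; linarith
      · right; exact ⟨by linarith, h'⟩
    have hanti : ∀ u v, (unlabel x p).IsLong θ u → (unlabel x p).IsLong θ v →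
        Before φ u v → Before φ v u → u = v := by
      intro u v hu hv h1 h2
      obtain ⟨i, rfl⟩ := IsLong.exists_label hu
      obtain ⟨j, rfl⟩ := IsLong.exists_label hv
      have e : φ (x i) = φ (x j) := by
        rcases h1 with h | ⟨h, -⟩ <;> rcases h2 with h' | ⟨h', -⟩ <;> linarith
      refine IsLift.eq_of_eq hφ (mem_verts_unlabel.2 ⟨i, rfl⟩) (mem_verts_unlabel.2 ⟨j, rfl⟩)
        (hs i) (hs j) e ?_
      rcases h1 with h | ⟨-, h⟩ <;> rcases h2 with h' | ⟨-, h'⟩ <;> linarith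
    have hea : a = a' := hanti _ _ ha ha' (hab a' ha').1 (hB _ _ ha' ha (hab' a ha).1)
    have heb : b = b' := hanti _ _ hb hb' (hB _ _ hb hb' (hab' b hb).2) (hab b' hb').2
    subst hea heb
    obtain ⟨rfl, hww⟩ := simplePath_unique hx hp (IsLong.exists_label ha)
      (IsLong.exists_label hb) hw hw'
    have hsh : ∀ j < q, |shift (w j) (w (j + 1))| = |shift (w' j) (w' (j + 1))| := by
      intro j hj
      rw [hww j hj.le, hww (j + 1) hj]
    have hii : i = i' := by
      rcases lt_trichotomy i i' with hl | hl | hl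
      · have h1 := hi'.lt_of_lt i hl
        have h2 := hi.le i' hi'.lt
        rw [hsh _ hi.lt, hsh _ hi'.lt] at h2
        linarith
      · exact hl
      · have h1 := hi.lt_of_lt i' hl
        have h2 := hi'.le i hi.lt
        rw [hsh _ hi.lt, hsh _ hi'.lt] at h1
        linarith
    subst hii
    unfold window
    apply Finset.image_congr
    intro j hj
    simp only [Finset.coe_filter, Finset.mem_range, Set.mem_ofPred_eq] at hj
    exact hww j (by omega)

end Unlabel

/-! ### Growth of a nearest neighbour tree on the universal cover of the circle -/

/-- The lifts `κ` of the first `N` vertices, when no vertex is ever passed over by an edge. -/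
structure NonCrossing {n : ℕ} (N : ℕ) (p : Fin n → Fin n) (κ : Fin n → ℝ) : Prop where
  lt : ∀ j : Fin n, 0 < j.val → p j < j
  small : ∀ j : Fin n, 0 < j.val → |κ j - κ (p j)| < 1
  ne : ∀ i j : Fin n, i.val < N → j.val < N → i ≠ j → κ i ≠ κ j
  cross : ∀ j : Fin n, 0 < j.val → j.val < N → ∀ i < j, i ≠ p j → ∀ m : ℤ,
    κ i + m ∉ Set.uIcc (κ (p j)) (κ j)

/-- The vertex `j` is to the right of all its predecessors. -/
def IsRightmost {n : ℕ} (κ : Fin n → ℝ) (j : Fin n) : Prop := ∀ i < j, κ i < κ j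

namespace NonCrossing

variable {n N : ℕ} {p : Fin n → Fin n} {κ : Fin n → ℝ}

lemma neg (H : NonCrossing N p κ) : NonCrossing N p (-κ) where
  lt := H.lt
  small j hj := by
    have := H.small j hj
    rwa [Pi.neg_apply, Pi.neg_apply, ← abs_neg, neg_sub_neg, neg_sub]
  ne i j hi hj hij := by simpa using H.ne i j hi hj hij
  cross j h0 hj i hi hij m := by
    have := H.cross j h0 hj i hi hij (-m)
    rw [Set.mem_uIcc] at this ⊢
    push_cast at this
    simp only [Pi.neg_apply]
    rintro (⟨h1, h2⟩ | ⟨h1, h2⟩)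
    · exact this (Or.inr ⟨by linarith, by linarith⟩)
    · exact this (Or.inl ⟨by linarith, by linarith⟩)

lemma cross_zero (H : NonCrossing N p κ) {j : Fin n} (h0 : 0 < j.val) (hj : j.val < N) {i : Fin n}
    (hi : i < j) (hij : i ≠ p j) : κ i ∉ Set.uIcc (κ (p j)) (κ j) := by
  simpa using H.cross j h0 hj i hi hij 0

/-- A new vertex at distance at least one from an earlier `i` would have an edge covering the
translate of `i` by 1 or -1, because its parent is still within distance one of `i`. The lifted tree
therefore never laps the circle. -/
lemma lt_add_one (H : NonCrossing N p κ) :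
    ∀ t ≤ N, ∀ i j : Fin n, i.val < t → j.val < t → κ i < κ j + 1 := by
  have step : ∀ t < N, (∀ i j : Fin n, i.val < t → j.val < t → κ i < κ j + 1) →
      ∀ i j : Fin n, i.val < t → j.val = t → κ i < κ j + 1 ∧ κ j < κ i + 1 := by
    intro t ht ih i j hi hj
    have h0 : 0 < j.val := by omega
    have hpj : (p j).val < t := by have := H.lt j h0; rw [Fin.lt_def] at this; omega
    have hs := abs_lt.1 (H.small j h0)
    have hij : i < j := by rw [Fin.lt_def]; omega
    by_cases hip : i = p j
    · subst hip; constructor <;> linarith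
    have h1 := H.cross j h0 (by omega) i hij hip 1
    have h2 := H.cross j h0 (by omega) i hij hip (-1)
    rw [Set.mem_uIcc] at h1 h2
    push_cast at h1 h2
    have h3 := ih i (p j) hi hpj
    have h4 := ih (p j) i hpj hi
    constructor
    · by_contra hc
      exact h2 (Or.inr ⟨by linarith, by linarith⟩)
    · by_contra hc
      exact h1 (Or.inl ⟨by linarith, by linarith⟩)
  intro t
  induction t with
  | zero => intro _ i _ hi; omega
  | succ t ih =>
    intro ht i j hi hj
    have ih' := ih (by omega)
    rcases (by omega : i.val < t ∨ i.val = t) with hi' | hi' <;>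
    rcases (by omega : j.val < t ∨ j.val = t) with hj' | hj'
    · exact ih' i j hi' hj'
    · exact (step t (by omega) ih' i j hi' hj').1
    · exact (step t (by omega) ih' j i hj' hi').2
    · have : i = j := Fin.ext (by omega)
      subst this; linarith

/-- An earlier vertex between the parent and the record would be passed over by the new edge; so
records always attach to the current end. -/
lemma IsRightmost.parent (H : NonCrossing N p κ) {j : Fin n} (h0 : 0 < j.val) (hj : j.val < N)
    (ht : IsRightmost κ j) : κ (p j) < κ j ∧ ∀ i < j, κ i ≤ κ (p j) := by
  have h1 := ht (p j) (H.lt j h0)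
  refine ⟨h1, fun i hi => ?_⟩
  by_cases hip : i = p j
  · rw [hip]
  have := H.cross_zero h0 hj hi hip
  by_contra hc
  exact this (Set.mem_uIcc.2 (Or.inl ⟨by linarith, (ht i hi).le⟩))

lemma IsRightmost.isRightmost_parent (H : NonCrossing N p κ) {j : Fin n} (h0 : 0 < j.val) (hj : j.val < N)
    (ht : IsRightmost κ j) : IsRightmost κ (p j) := by
  intro i hi
  have hpj := H.lt j h0
  refine lt_of_le_of_ne ((IsRightmost.parent H h0 hj ht).2 i (hi.trans hpj)) ?_
  rw [Fin.lt_def] at hi hpj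
  exact H.ne _ _ (by omega) (by omega) (by rintro rfl; omega)

/-- A vertex beyond a record descends from it. -/
lemma IsRightmost.exists_iterate (H : NonCrossing N p κ) {ρ : Fin n} (ht : IsRightmost κ ρ)
    (hρ : ρ.val < N) : ∀ u : Fin n, u.val < N → κ ρ ≤ κ u →
      ∃ k, p^[k] u = ρ ∧ ∀ l < k, κ ρ < κ (p^[l] u) ∧ 0 < (p^[l] u).val := by
  have key : ∀ m (u : Fin n), u.val = m → u.val < N → κ ρ ≤ κ u →
      ∃ k, p^[k] u = ρ ∧ ∀ l < k, κ ρ < κ (p^[l] u) ∧ 0 < (p^[l] u).val := by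
    intro m
    induction m using Nat.strong_induction_on with
    | _ m ih =>
      intro u hum huN hu
      by_cases hur : u = ρ
      · exact ⟨0, hur, fun l hl => by omega⟩
      have hlt : κ ρ < κ u := lt_of_le_of_ne hu (H.ne _ _ hρ huN (Ne.symm hur))
      have hρu : ρ < u := by
        by_contra hc
        have := ht u (lt_of_le_of_ne (not_lt.1 hc) hur)
        linarith
      have h0 : 0 < u.val := by rw [Fin.lt_def] at hρu; omega
      have hpu := H.lt u h0
      rw [Fin.lt_def] at hpu
      have hp : κ ρ ≤ κ (p u) := by
        by_cases hp : ρ = p u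
        · rw [hp]
        have := H.cross_zero h0 huN hρu hp
        by_contra hc
        exact this (Set.mem_uIcc.2 (Or.inl ⟨by linarith, hu⟩))
      obtain ⟨k, hk, hl⟩ := ih (p u).val (by omega) (p u) rfl (by omega) hp
      refine ⟨k + 1, by rwa [Function.iterate_succ_apply], fun l hlk => ?_⟩
      cases l with
      | zero => exact ⟨hlt, h0⟩
      | succ l => rw [Function.iterate_succ_apply]; exact hl l (by omega)
  exact fun u => key _ u rfl

/-- The edge of a vertex that is no record is shorter than the edge of some record. -/
lemma exists_longer (H : NonCrossing N p κ) {j : Fin n} (hj : j.val < N) {o : Fin n}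
    (ho : o.val = 0) (hoj : κ o < κ j) (ht : ¬ IsRightmost κ j) :
    ∃ ρ : Fin n, 0 < ρ.val ∧ ρ < j ∧ IsRightmost κ ρ ∧ |κ j - κ (p j)| < |κ ρ - κ (p ρ)| := by
  classical
  have h0 : 0 < j.val := by
    rcases Nat.eq_zero_or_pos j.val with h | h
    · have : j = o := Fin.ext (by omega)
      subst this; linarith
    · exact h
  -- The first vertex `ρ` to reach beyond `j` is a record, and since its parent came before it, its
  -- edge spans `κ j`.
  have hex : ∃ m, ∃ i : Fin n, i.val = m ∧ i < j ∧ κ j ≤ κ i := by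
    unfold IsRightmost at ht
    push Not at ht
    obtain ⟨i, hi, hi'⟩ := ht
    exact ⟨_, i, rfl, hi, hi'⟩
  obtain ⟨ρ, hρm, hρj, hρ⟩ := Nat.find_spec hex
  have hmin : ∀ i < ρ, κ i < κ j := by
    intro i hi
    by_contra hc
    refine Nat.find_min hex (m := i.val) ?_ ⟨i, rfl, hi.trans hρj, not_lt.1 hc⟩
    rw [Fin.lt_def] at hi
    omega
  have hρ0 : 0 < ρ.val := by
    rcases Nat.eq_zero_or_pos ρ.val with h | h
    · have : ρ = o := Fin.ext (by omega)
      subst this; linarith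
    · exact h
  have hlt : κ j < κ ρ := lt_of_le_of_ne hρ
    (H.ne _ _ hj (by rw [Fin.lt_def] at hρj; omega) hρj.ne')
  have htop : IsRightmost κ ρ := fun i hi => (hmin i hi).trans hlt
  have hpρ := H.lt ρ hρ0
  have hlt' : κ (p ρ) < κ j := hmin _ hpρ
  refine ⟨ρ, hρ0, hρj, htop, ?_⟩
  -- If `p j` were outside the interval spanned by the edge of `ρ`, the edge of `j` would pass over
  -- an endpoint of that interval. So the edge of `j` lies inside it, and `κ j` is an interior
  -- point.
  have h1 : κ (p j) ≤ κ ρ := by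
    by_cases e : ρ = p j
    · rw [e]
    have := H.cross_zero h0 hj hρj e
    by_contra hc
    exact this (Set.mem_uIcc.2 (Or.inr ⟨hlt.le, by linarith⟩))
  have h2 : κ (p ρ) ≤ κ (p j) := by
    by_cases e : p ρ = p j
    · rw [e]
    have := H.cross_zero h0 hj (hpρ.trans hρj) e
    by_contra hc
    exact this (Set.mem_uIcc.2 (Or.inl ⟨by linarith, hlt'.le⟩))
  rw [abs_of_pos (by linarith : 0 < κ ρ - κ (p ρ)), abs_lt]
  constructor <;> linarith

end NonCrossing

/-! ### The uncovered arc and its hits -/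

/-- `Escapes γ l k r G`: an interval of length `G` with left end `r` on the circle is hit by the
points of `l` one after the other, each hit replaces it by one of its two parts, and after `k` hits
its length can be at least `γ`. -/
def Escapes (γ : ℝ) : List ℝ → ℕ → ℝ → ℝ → Prop
  | _, 0, _, G => γ ≤ G
  | [], _ + 1, _, _ => False
  | X :: l, k + 1, r, G => (G ≤ Int.fract (X - r) ∧ Escapes γ l (k + 1) r G) ∨
      (Int.fract (X - r) < G ∧
        (Escapes γ l k (r + Int.fract (X - r)) (G - Int.fract (X - r)) ∨
          Escapes γ l k r (Int.fract (X - r))))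

lemma escapes_zero (γ : ℝ) (l : List ℝ) (r G : ℝ) : Escapes γ l 0 r G ↔ γ ≤ G := by
  cases l <;> simp [Escapes]

lemma fract_eq_of_int {y z : ℝ} (h0 : 0 ≤ z) (h1 : z < 1) (m : ℤ) (h : y = z + m) :
    Int.fract y = z := by
  rw [h, Int.fract_add_intCast]
  exact Int.fract_eq_self.2 ⟨h0, h1⟩

open Classical in
/-- The number of records among the vertices `1, …, t - 1`. -/
noncomputable def recordCount {n : ℕ} (κ : Fin n → ℝ) (t : ℕ) : ℕ :=
  (Finset.univ.filter fun i : Fin n => 0 < i.val ∧ i.val < t ∧ (IsRightmost κ i ∨ IsRightmost (-κ) i)).card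

lemma recordCount_succ_of_record {n : ℕ} {κ : Fin n → ℝ} {i : Fin n} (h0 : 0 < i.val)
    (h : IsRightmost κ i ∨ IsRightmost (-κ) i) : recordCount κ (i.val + 1) = recordCount κ i.val + 1 := by
  classical
  unfold recordCount
  rw [← Finset.card_insert_of_notMem (a := i) (by simp)]
  congr 1
  ext j
  simp only [Finset.mem_filter, Finset.mem_univ, true_and, Finset.mem_insert]
  constructor
  · rintro ⟨a, b, c⟩
    rcases (by omega : j.val = i.val ∨ j.val < i.val) with e | e
    · exact Or.inl (Fin.ext e)
    · exact Or.inr ⟨a, e, c⟩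
  · rintro (rfl | ⟨a, b, c⟩)
    · exact ⟨h0, by omega, h⟩
    · exact ⟨a, by omega, c⟩

lemma recordCount_succ_of_not {n : ℕ} {κ : Fin n → ℝ} {i : Fin n}
    (h : ¬ (IsRightmost κ i ∨ IsRightmost (-κ) i)) : recordCount κ (i.val + 1) = recordCount κ i.val := by
  classical
  unfold recordCount
  congr 1
  ext j
  simp only [Finset.mem_filter, Finset.mem_univ, true_and]
  constructor
  · rintro ⟨a, b, c⟩
    rcases (by omega : j.val = i.val ∨ j.val < i.val) with e | e
    · exact absurd (by rwa [Fin.ext e] at c) h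
    · exact ⟨a, e, c⟩
  · rintro ⟨a, b, c⟩
    exact ⟨a, by omega, c⟩

lemma recordCount_mono {n : ℕ} (κ : Fin n → ℝ) : Monotone (recordCount κ) := by
  classical
  intro s t hst
  unfold recordCount
  apply Finset.card_le_card
  intro j
  simp only [Finset.mem_filter, Finset.mem_univ, true_and]
  rintro ⟨a, b, c⟩
  exact ⟨a, by omega, c⟩

lemma recordCount_neg {n : ℕ} (κ : Fin n → ℝ) (t : ℕ) :
    recordCount (-κ) t = recordCount κ t := by
  classical
  unfold recordCount
  congr 1
  ext j
  simp [neg_neg, or_comm]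

namespace NonCrossing

variable {n N : ℕ} {p : Fin n → Fin n} {κ : Fin n → ℝ}

/-- The depth of a record is at most the number of records so far. -/
lemma IsRightmost.depth_le (H : NonCrossing N p κ) : ∀ (m : ℕ) (j : Fin n), j.val = m → j.val < N →
    IsRightmost κ j → ∃ d ≤ recordCount κ (j.val + 1), (p^[d] j).val = 0 ∧
      ∀ l < d, 0 < (p^[l] j).val := by
  intro m
  induction m using Nat.strong_induction_on with
  | _ m ih =>
    intro j hjm hjN ht
    rcases Nat.eq_zero_or_pos j.val with h0 | h0
    · exact ⟨0, Nat.zero_le _, h0, fun l hl => by omega⟩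
    have hp := H.lt j h0
    rw [Fin.lt_def] at hp
    obtain ⟨d, hd, hd0, hl⟩ := ih (p j).val (by omega) (p j) rfl (by omega)
      (IsRightmost.isRightmost_parent H h0 hjN ht)
    refine ⟨d + 1, ?_, by rwa [Function.iterate_succ_apply], fun l hld => ?_⟩
    · rw [recordCount_succ_of_record h0 (Or.inl ht)]
      have := recordCount_mono κ (by omega : (p j).val + 1 ≤ j.val)
      omega
    · cases l with
      | zero => exact h0
      | succ l => rw [Function.iterate_succ_apply]; exact hl l (by omega)

/-- If a record edge at least as long as all the earlier ones comes after `R` records, then the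
uncovered interval was still long at the `R`-th record. -/
lemma escapes (H : NonCrossing N p κ) {X : Fin n → ℝ} (hX : ∀ i, ∃ m : ℤ, κ i = X i + m)
    {R : ℕ} {j : Fin n} (hjN : j.val < N) (hjr : IsRightmost κ j ∨ IsRightmost (-κ) j)
    (hmax : ∀ i : Fin n, 0 < i.val → i < j → (IsRightmost κ i ∨ IsRightmost (-κ) i) →
      |κ i - κ (p i)| ≤ |κ j - κ (p j)|)
    (hR : R ≤ recordCount κ j.val) (h0 : 0 < j.val) (o : Fin n) (ho : o.val = 0) :
    Escapes (1 / (1 + R)) ((List.ofFn X).drop 1) R (X o) 1 := by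
  set e := |κ j - κ (p j)| with he
  -- The process is read from time `t` on, by induction on the time left until `j`. The uncovered
  -- arc runs from `κ hi` to `κ lo + 1`; the last hypothesis says that the covered length is at most
  -- `e` per record so far.
  have key : ∀ s t : ℕ, t + s = j.val → 1 ≤ t → recordCount κ t ≤ R →
      ∀ (hi lo : Fin n) (r : ℝ), hi.val < t → lo.val < t →
      (∀ i : Fin n, i.val < t → κ lo ≤ κ i ∧ κ i ≤ κ hi) → (∃ m : ℤ, r = κ hi + m) →
      1 - recordCount κ t * e ≤ 1 - (κ hi - κ lo) →
      Escapes (1 / (1 + R)) ((List.ofFn X).drop t) (R - recordCount κ t) r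
        (1 - (κ hi - κ lo)) := by
    intro s
    induction s with
    | zero =>
      intro t hts ht hrec hi lo r hhi hlo hb hr hG
      -- The record `j` attaches to an end of the tree at a time when the whole spread, `j`
      -- included, is still below one. Its edge therefore fits into every earlier gap.
      have heG : e < 1 - (κ hi - κ lo) := by
        have hd := H.lt_add_one N le_rfl
        have hl : lo < j := by rw [Fin.lt_def]; omega
        have hh : hi < j := by rw [Fin.lt_def]; omega
        rcases hjr with ht | ht
        · obtain ⟨a, b⟩ := IsRightmost.parent H h0 hjN ht
          rw [he, abs_of_pos (by linarith)]
          have := hd j lo hjN (by omega)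
          have := b hi hh
          linarith
        · obtain ⟨a, b⟩ := IsRightmost.parent H.neg h0 hjN ht
          simp only [Pi.neg_apply] at a b
          rw [he, abs_of_neg (by linarith)]
          have := hd hi j (by omega) hjN
          have := b lo hl
          linarith
      have e1 : R - recordCount κ t = 0 := by rw [show t = j.val by omega]; omega
      have e2 : recordCount κ t = R := by omega
      -- With G the gap, 1 - G ≤ R e ≤ R G, which is the required G ≥ 1/(1+R).
      rw [e1, escapes_zero, div_le_iff₀ (by positivity)]
      rw [e2] at hG
      have : (R : ℝ) * e ≤ R * (1 - (κ hi - κ lo)) := by gcongr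
      nlinarith
    | succ s ih =>
      intro t hts ht hrec hi lo r hhi hlo hb hr hG
      have htn : t < n := by omega
      obtain ⟨mr, hmr⟩ := hr
      set T : Fin n := ⟨t, htn⟩ with hT
      have hT0 : 0 < T.val := ht
      have hTN : T.val < N := by simp only [hT]; omega
      have hTj : T < j := by rw [Fin.lt_def]; simp only [hT]; omega
      have hd := H.lt_add_one N le_rfl
      have hdT1 := hd T lo hTN (by omega)
      have hdT2 := hd hi T (by omega) hTN
      have hlT : lo < T := by rw [Fin.lt_def]; exact hlo
      have hhT : hi < T := by rw [Fin.lt_def]; exact hhi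
      have hdd := hd hi lo (by omega) (by omega)
      have hlh := (hb hi hhi).1
      have hdrop : (List.ofFn X).drop t = X T :: (List.ofFn X).drop (t + 1) := by
        rw [List.drop_eq_getElem_cons (by simpa using htn)]
        simp [hT]
      obtain ⟨mT, hmT⟩ := hX T
      have heG : e < 1 - (κ hi - κ lo) := by
        have hl : lo < j := by rw [Fin.lt_def]; omega
        have hh : hi < j := by rw [Fin.lt_def]; omega
        rcases hjr with ht | ht
        · obtain ⟨a, b⟩ := IsRightmost.parent H h0 hjN ht
          rw [he, abs_of_pos (by linarith)]
          have := hd j lo hjN (by omega)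
          have := b hi hh
          linarith
        · obtain ⟨a, b⟩ := IsRightmost.parent H.neg h0 hjN ht
          simp only [Pi.neg_apply] at a b
          rw [he, abs_of_neg (by linarith)]
          have := hd hi j (by omega) hjN
          have := b lo hl
          linarith
      rcases Nat.eq_zero_or_pos (R - recordCount κ t) with hk | hk
      · have e2 : recordCount κ t = R := by omega
        rw [hk, escapes_zero, div_le_iff₀ (by positivity)]
        rw [e2] at hG
        have : (R : ℝ) * e ≤ R * (1 - (κ hi - κ lo)) := by gcongr
        nlinarith
      obtain ⟨k, hk'⟩ := Nat.exists_eq_add_of_lt hk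
      rw [zero_add] at hk'
      rw [hk', hdrop, Escapes]
      by_cases hTr : IsRightmost κ T ∨ IsRightmost (-κ) T
      · have hcount : recordCount κ (t + 1) = recordCount κ t + 1 :=
          recordCount_succ_of_record (i := T) hT0 hTr
        have hkk : R - recordCount κ (t + 1) = k := by omega
        have hle := hmax T hT0 hTj hTr
        right
        -- A record on the right moves the origin `r` of the gap forward; a record on the left, seen
        -- from `r` one turn further on, keeps `r` and cuts off the far part.
        by_cases htop : IsRightmost κ T
        · have hz : Int.fract (X T - r) = κ T - κ hi := by
            refine fract_eq_of_int (sub_nonneg.2 (htop hi hhT).le) (by linarith) (-mT - mr) ?_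
            push_cast; linarith
          obtain ⟨a, b⟩ := IsRightmost.parent H hT0 hTN htop
          rw [abs_of_pos (by linarith)] at hle
          have hb' : κ (p T) ≤ κ hi := (hb (p T) (H.lt T hT0)).2
          rw [hz]
          refine ⟨by linarith, Or.inl ?_⟩
          have := ih (t + 1) (by omega) (by omega) (by omega) T lo (r + (κ T - κ hi))
            (by simp [hT]) (by omega) ?_ ⟨mr, by linarith⟩ ?_
          · rw [hkk] at this
            convert this using 1; ring
          · intro i hi'
            rcases (by omega : i.val < t ∨ i.val = t) with h | h
            · exact ⟨(hb i h).1, (htop i h).le⟩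
            · have : i = T := Fin.ext h
              rw [this]
              exact ⟨(htop lo hlT).le, le_rfl⟩
          · rw [hcount]; push_cast; linarith
        · have hbot : IsRightmost (-κ) T := hTr.resolve_left htop
          have hbot' : ∀ i < T, κ T < κ i := fun i hi => by
            have := hbot i hi
            simp only [Pi.neg_apply] at this
            linarith
          have hz : Int.fract (X T - r) = κ T + 1 - κ hi := by
            refine fract_eq_of_int (by linarith) (by have := hbot' hi hhT; linarith)
              (-mT - mr - 1) ?_
            push_cast; linarith
          obtain ⟨a, b⟩ := IsRightmost.parent H.neg hT0 hTN hbot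
          simp only [Pi.neg_apply] at a b
          rw [abs_of_neg (by linarith)] at hle
          have hb' : κ lo ≤ κ (p T) := (hb (p T) (H.lt T hT0)).1
          have hTlo := hbot' lo hlT
          rw [hz]
          refine ⟨by linarith, Or.inr ?_⟩
          have := ih (t + 1) (by omega) (by omega) (by omega) hi T r
            (by omega) (by simp [hT]) ?_ ⟨mr, hmr⟩ ?_
          · rw [hkk] at this
            convert this using 1; ring
          · intro i hi'
            rcases (by omega : i.val < t ∨ i.val = t) with h | h
            · exact ⟨(hbot' i h).le, (hb i h).2⟩
            · have : i = T := Fin.ext h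
              rw [this]
              exact ⟨le_rfl, (hbot' hi hhT).le⟩
          · rw [hcount]; push_cast; linarith
      · left
        have hcount : recordCount κ (t + 1) = recordCount κ t :=
          recordCount_succ_of_not (i := T) hTr
        obtain ⟨n1, n2⟩ := not_or.1 hTr
        unfold IsRightmost at n1 n2
        push Not at n1 n2
        obtain ⟨i1, h1, h1'⟩ := n1
        obtain ⟨i2, h2, h2'⟩ := n2
        simp only [Pi.neg_apply] at h2'
        -- Strictness matters: a point exactly at the right end would have offset 0 instead of 1 and
        -- count as a hit.
        have hTh : κ T < κ hi := lt_of_le_of_ne (h1'.trans (hb i1 h1).2)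
          (H.ne _ _ hTN (by omega) hhT.ne')
        have hTl : κ lo ≤ κ T := by linarith [(hb i2 h2).1]
        have hz : Int.fract (X T - r) = κ T + 1 - κ hi := by
          refine fract_eq_of_int (by linarith) (by linarith) (-mT - mr - 1) ?_
          push_cast; linarith
        rw [hz]
        refine ⟨by linarith, ?_⟩
        have := ih (t + 1) (by omega) (by omega) (by omega) hi lo r
          (by omega) (by omega) ?_ ⟨mr, hmr⟩ (by rw [hcount]; exact hG)
        · rwa [hcount, hk'] at this
        · intro i hi'
          rcases (by omega : i.val < t ∨ i.val = t) with h | h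
          · exact hb i h
          · have : i = T := Fin.ext h
            rw [this]
            exact ⟨hTl, hTh.le⟩
  have h1 : recordCount κ 1 = 0 := by
    classical
    unfold recordCount
    rw [Finset.card_eq_zero, Finset.filter_eq_empty_iff]
    intro i _ h
    omega
  obtain ⟨mo, hmo⟩ := hX o
  have := key (j.val - 1) 1 (by omega) le_rfl (by omega) o o (X o) (by omega) (by omega) ?_
    ⟨-mo, by push_cast; linarith⟩ (by rw [h1]; simp)
  · rw [h1] at this
    simpa using this
  · intro i hi
    have : i = o := Fin.ext (by omega)
    rw [this]
    exact ⟨le_rfl, le_rfl⟩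

end NonCrossing

/-! ### From torus distances to non-crossing lifts -/

lemma circDist_nonneg {L a b : ℝ} (ha : a ∈ Set.Ico 0 L) (hb : b ∈ Set.Ico 0 L) :
    0 ≤ circDist L a b := by
  obtain ⟨h1, h2⟩ := ha
  obtain ⟨h3, h4⟩ := hb
  unfold circDist
  rcases abs_cases (a - b) with ⟨e, _⟩ | ⟨e, _⟩ <;> rw [e] <;>
  exact le_min (by linarith) (by linarith)

lemma circDist_le_half (L a b : ℝ) : circDist L a b ≤ L / 2 := by
  unfold circDist
  rcases min_cases |a - b| (L - |a - b|) with ⟨e, _⟩ | ⟨e, _⟩ <;> rw [e] <;> linarith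

lemma circDist_le_abs {a b : ℝ} (ha : a ∈ Set.Ico (0 : ℝ) 1) (hb : b ∈ Set.Ico (0 : ℝ) 1) (m : ℤ) :
    circDist 1 a b ≤ |a - b - m| := by
  obtain ⟨h1, h2⟩ := ha
  obtain ⟨h3, h4⟩ := hb
  unfold circDist
  rcases eq_or_ne m 0 with rfl | hm
  · simp
  refine (min_le_right _ _).trans ?_
  have h5 : (1 : ℝ) ≤ |(m : ℝ)| := by
    have := Int.one_le_abs hm
    exact_mod_cast this
  have := abs_sub_abs_le_abs_sub (m : ℝ) (a - b)
  rw [abs_sub_comm (m : ℝ)] at this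
  linarith

lemma circDist_comm (L a b : ℝ) : circDist L a b = circDist L b a := by
  unfold circDist; rw [abs_sub_comm]

/-- Points whose horizontal distances differ by at least the height of the strip are compared by
their horizontal distances. -/
lemma stripDist_lt {h : ℝ} (hh : 0 < h) {u v w : Pt} (hu : u ∈ strip h) (hv : v ∈ strip h)
    (hd : circDist 1 u.1 v.1 + h ≤ circDist 1 u.1 w.1) :
    stripDist h u v < stripDist h u w := by
  unfold stripDist
  apply Real.sqrt_lt_sqrt (by positivity)
  have h1 := circDist_nonneg hu.1 hv.1
  have h2 := circDist_nonneg hu.2 hv.2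
  have h3 := circDist_le_half h u.2 v.2
  have h4 : circDist h u.2 v.2 ^ 2 ≤ (h / 2) ^ 2 := by gcongr
  have h5 : (circDist 1 u.1 v.1 + h) ^ 2 ≤ circDist 1 u.1 w.1 ^ 2 := by gcongr
  nlinarith [sq_nonneg (circDist h u.2 w.2), mul_nonneg h1 hh.le]

section

variable {n N : ℕ} {h θ : ℝ} {x : Fin n → Pt} {p : Fin n → Fin n}

lemma IsLift.apply_eq {φ : Pt → ℝ} (hφ : (unlabel x p).IsLift φ) {j : Fin n} (hj : 0 < j.val) :
    φ (x j) = φ (x (p j)) + shift (x (p j)) (x j) :=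
  hφ.edge _ _ (mem_edges_unlabel.2 ⟨j, hj, Or.inr ⟨rfl, rfl⟩⟩)

lemma IsLift.circDist_le {φ : Pt → ℝ} (hφ : (unlabel x p).IsLift φ) (hs : ∀ i, x i ∈ strip h)
    (i j : Fin n) (m : ℤ) : circDist 1 (x i).1 (x j).1 ≤ |φ (x i) - φ (x j) - m| := by
  obtain ⟨a, ha⟩ := hφ.int (x i) (mem_verts_unlabel.2 ⟨i, rfl⟩)
  obtain ⟨b, hb⟩ := hφ.int (x j) (mem_verts_unlabel.2 ⟨j, rfl⟩)
  convert circDist_le_abs (hs i).1 (hs j).1 (m + b - a) using 2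
  push_cast; linarith

/-- If the edge of `j` passed over a translate of an earlier `i`, then `j` would be horizontally
closer to `i` than to its parent by at least the distance from the parent to `i`. Separation makes
this at least `h`, so `stripDist_lt` contradicts the choice of the parent. -/
lemma nonCrossing_of_isNearest (hh : 0 < h) (hs : ∀ i, x i ∈ strip h)
    (hp : ∀ j : Fin n, 0 < j.val → IsNearest h x j (p j))
    (sep : ∀ i j : Fin n, i.val < N → j.val < N → i ≠ j → h ≤ circDist 1 (x i).1 (x j).1)
    {φ : Pt → ℝ} (hφ : (unlabel x p).IsLift φ) : NonCrossing N p fun i => φ (x i) where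
  lt j hj := (hp j hj).1
  small j hj := by
    rw [IsLift.apply_eq hφ hj, add_sub_cancel_left]
    linarith [abs_shift_le (hs (p j)) (hs j)]
  ne i j hi hj hij he := by
    have h1 := sep i j hi hj hij
    have h2 := IsLift.circDist_le hφ hs i j 0
    rw [he] at h2
    simp at h2
    linarith
  cross j h0 hj i hi hij m hmem := by
    have hz : |φ (x j) - φ (x (p j))| = circDist 1 (x j).1 (x (p j)).1 := by
      rw [IsLift.apply_eq hφ h0, add_sub_cancel_left, abs_shift_eq (hs _) (hs _), circDist_comm]
    have hpj := (hp j h0).1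
    rw [Fin.lt_def] at hi hpj
    have h1 := IsLift.circDist_le hφ hs j i m
    have h2 := IsLift.circDist_le hφ hs (p j) i m
    have h3 := sep (p j) i (by omega) (by omega) hij.symm
    have h4 : |φ (x j) - φ (x i) - m| + |φ (x (p j)) - φ (x i) - m| =
        |φ (x j) - φ (x (p j))| := by
      rcases Set.mem_uIcc.1 hmem with ⟨a, b⟩ | ⟨a, b⟩
      · rw [abs_of_nonneg (by linarith), abs_of_nonpos (by linarith), abs_of_nonneg (by linarith)]
        ring
      · rw [abs_of_nonpos (by linarith), abs_of_nonneg (by linarith), abs_of_nonpos (by linarith)]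
        ring
    have h5 := stripDist_lt hh (w := x (p j)) (hs j) (hs i) (by linarith)
    have h6 := (hp j h0).2 i hi
    linarith

end

/-! ### The root lies near the longest edge -/

lemma depth_unique {n : ℕ} {p : Fin n → Fin n} {u : Fin n} {d d' : ℕ}
    (h : (p^[d] u).val = 0) (h' : (p^[d'] u).val = 0) (hl : ∀ l < d, 0 < (p^[l] u).val)
    (hl' : ∀ l < d', 0 < (p^[l] u).val) : d = d' := by
  rcases lt_trichotomy d d' with hd | hd | hd
  · have := hl' d hd; omega
  · exact hd
  · have := hl d' hd; omega

lemma iterate_parent_lt {n : ℕ} {p : Fin n → Fin n} (hp : ∀ j : Fin n, 0 < j.val → p j < j)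
    {u : Fin n} {d : ℕ} (hl : ∀ l < d, 0 < (p^[l] u).val) {i j : ℕ} (hij : i < j) (hj : j ≤ d) :
    p^[j] u < p^[i] u := by
  induction j with
  | zero => omega
  | succ j ih =>
    have h1 : p^[j + 1] u < p^[j] u := by
      rw [Function.iterate_succ_apply']; exact hp _ (hl j (by omega))
    rcases (by omega : i = j ∨ i < j) with rfl | h
    · exact h1
    · exact h1.trans (ih h (by omega))

namespace NonCrossing

variable {n N R : ℕ} {p : Fin n → Fin n} {κ : Fin n → ℝ}

/-- The vertex with an edge of maximal horizontal extent is close to the root in the tree. -/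
lemma depth_le_of_longest (H : NonCrossing N p κ) {X : Fin n → ℝ}
    (hX : ∀ i, ∃ m : ℤ, κ i = X i + m) {o : Fin n} (ho : o.val = 0)
    (hesc : ¬ Escapes (1 / (1 + R)) ((List.ofFn X).drop 1) R (X o) 1)
    {j : Fin n} (hjN : j.val < N) (h0 : 0 < j.val)
    (hmax : ∀ i : Fin n, 0 < i.val → i.val < N → (IsRightmost κ i ∨ IsRightmost (-κ) i) →
      |κ i - κ (p i)| ≤ |κ j - κ (p j)|) :
    ∃ d ≤ R, (p^[d] j).val = 0 ∧ ∀ l < d, 0 < (p^[l] j).val := by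
  -- Otherwise `exists_longer`, applied to `κ` or `-κ` according to the side of the root on which
  -- `j` lies, produces a record with a strictly longer edge.
  have hrec : IsRightmost κ j ∨ IsRightmost (-κ) j := by
    by_contra hc
    obtain ⟨c1, c2⟩ := not_or.1 hc
    have hne : κ o ≠ κ j := H.ne _ _ (by omega) hjN (by rintro rfl; omega)
    rcases lt_or_gt_of_ne hne with hlt | hlt
    · obtain ⟨ρ, r0, rj, rt, re⟩ := H.exists_longer hjN ho hlt c1
      rw [Fin.lt_def] at rj
      have := hmax ρ r0 (by omega) (Or.inl rt)
      linarith
    · obtain ⟨ρ, r0, rj, rt, re⟩ := H.neg.exists_longer hjN ho (by simpa using hlt) c2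
      rw [Fin.lt_def] at rj
      have := hmax ρ r0 (by omega) (Or.inr rt)
      simp only [Pi.neg_apply, neg_sub_neg] at re
      rw [abs_sub_comm, abs_sub_comm (κ (p ρ))] at re
      linarith
  have hlt : recordCount κ j.val < R := by
    by_contra hc
    refine hesc (H.escapes hX hjN hrec (fun i hi hij hr => hmax i hi ?_ hr) (not_lt.1 hc) h0 o ho)
    rw [Fin.lt_def] at hij
    omega
  have hd : ∃ d ≤ recordCount κ (j.val + 1), (p^[d] j).val = 0 ∧ ∀ l < d, 0 < (p^[l] j).val := by
    rcases hrec with h | h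
    · exact IsRightmost.depth_le H _ j rfl hjN h
    · rw [← recordCount_neg]
      exact IsRightmost.depth_le H.neg _ j rfl hjN h
  obtain ⟨d, hd, hd'⟩ := hd
  rw [recordCount_succ_of_record h0 hrec] at hd
  exact ⟨d, by omega, hd'⟩

end NonCrossing

open NonCrossing in
/-- In a configuration without coincidences at the scale of the height, the selected set contains
the root. -/
theorem Selects.root_mem {n N R : ℕ} {h θ : ℝ} {x : Fin n → Pt} {p : Fin n → Fin n}
    (hh : 0 < h) (hn : 2 ≤ n) (hN : 2 ≤ N) (hs : ∀ i, x i ∈ strip h)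
    (hx : Function.Injective x) (hp : ∀ j : Fin n, 0 < j.val → IsNearest h x j (p j))
    (sep : ∀ i j : Fin n, i.val < N → j.val < N → i ≠ j → h ≤ circDist 1 (x i).1 (x j).1)
    (short : ∀ j : Fin n, N ≤ j.val → |shift (x (p j)) (x j)| < θ)
    (first : θ ≤ |shift (x ⟨0, by omega⟩) (x ⟨1, by omega⟩)|)
    (hesc : ¬ Escapes (1 / (1 + R)) ((List.ofFn fun i => (x i).1).drop 1) R (x ⟨0, by omega⟩).1 1)
    {S : Finset Pt} (hS : (unlabel x p).Selects θ R S) : x ⟨0, by omega⟩ ∈ S := by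
  classical
  set o : Fin n := ⟨0, by omega⟩ with ho
  set o' : Fin n := ⟨1, by omega⟩ with ho'
  have hp' : ∀ j : Fin n, 0 < j.val → p j < j := fun j hj => (hp j hj).1
  have hpo' : p o' = o := by
    have := hp' o' (by simp [ho'])
    rw [Fin.lt_def] at this
    apply Fin.ext
    simp only [ho', ho] at this ⊢
    omega
  have hedge : ∀ j : Fin n, 0 < j.val → s(x j, x (p j)) ∈ (unlabel x p).edges := fun j hj =>
    mem_edges_unlabel.2 ⟨j, hj, Or.inl ⟨rfl, rfl⟩⟩
  -- The first edge is long, so the root itself competes for the extremes: its lift lies between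
  -- those of `a` and `b`.
  have hlong : (unlabel x p).IsLong θ (x o) := by
    refine ⟨x o', ?_, first⟩
    have := hedge o' (by simp [ho'])
    rwa [hpo', Sym2.eq_swap] at this
  rcases hS with ⟨c, -⟩ | ⟨-, c, -⟩ | ⟨-, φ, a, b, w, q, i, hφ, ha, hb, hab, hw, hi, rfl⟩
  · rw [card_verts_unlabel hx] at c; omega
  · exact absurd hlong (c _)
  have H := nonCrossing_of_isNearest hh hs hp sep hφ
  set κ : Fin n → ℝ := fun i => φ (x i) with hκ
  have hX : ∀ i, ∃ m : ℤ, κ i = (x i).1 + m := fun i =>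
    hφ.int _ (mem_verts_unlabel.2 ⟨i, rfl⟩)
  have hext : ∀ j : Fin n, 0 < j.val → |shift (x j) (x (p j))| = |κ j - κ (p j)| := by
    intro j hj
    rw [hκ]
    simp only
    rw [IsLift.apply_eq hφ hj, add_sub_cancel_left, shift_symm, abs_neg]
  have hlongN : ∀ v, (unlabel x p).IsLong θ v → ∃ j : Fin n, x j = v ∧ j.val < N := by
    rintro v ⟨v', hv, hθv⟩
    obtain ⟨j, hj, ⟨e1, e2⟩ | ⟨e1, e2⟩⟩ := mem_edges_unlabel.1 hv
    · refine ⟨j, e1, ?_⟩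
      by_contra hc
      have := short j (not_lt.1 hc)
      rw [e1, e2, shift_symm, abs_neg] at this
      linarith
    · refine ⟨p j, e2, ?_⟩
      have h1 := hp' j hj
      rw [Fin.lt_def] at h1
      by_contra hc
      have := short j (by omega)
      rw [e1, e2] at this
      linarith
  obtain ⟨A, rfl, hAN⟩ := hlongN a ha
  obtain ⟨B, rfl, hBN⟩ := hlongN b hb
  have hle : ∀ {u v : Fin n}, Before φ (x u) (x v) → κ u ≤ κ v := by
    rintro u v (hlt | ⟨he, -⟩)
    · exact hlt.le
    · exact he.le
  have hAo : κ A ≤ κ o := hle (hab _ hlong).1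
  have hoB : κ o ≤ κ B := hle (hab _ hlong).2
  have hoR : ∀ μ : Fin n → ℝ, IsRightmost μ o := fun μ i hi => by
    rw [Fin.lt_def] at hi; simp [ho] at hi
  have hoN : o.val < N := by simp only [ho]; omega
  obtain ⟨db, hdb, hdbl⟩ := IsRightmost.exists_iterate H (hoR _) hoN B hBN hoB
  obtain ⟨da, hda, hdal⟩ := IsRightmost.exists_iterate H.neg (hoR _) hoN A hAN (by simpa using hAo)
  -- The path climbs from `B` to the root and descends to `A`. It is simple because its first part
  -- stays strictly to the right of the root and its second part strictly to the left.
  set w' : ℕ → Fin n := fun j => if j ≤ db then p^[j] B else p^[da - (j - db)] A with hw'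
  have hw1 : ∀ j ≤ db, w' j = p^[j] B := fun j hj => by simp [hw', hj]
  have hw2 : ∀ j, db ≤ j → w' j = p^[da - (j - db)] A := by
    intro j hj
    rcases hj.eq_or_lt with rfl | hj
    · rw [hw1 _ le_rfl, Nat.sub_self, Nat.sub_zero, hdb, hda]
    · simp [hw', hj.not_ge]
  have hpath : IsSimplePath (fun u v => s(u, v) ∈ (unlabel x p).edges) (x B) (x A)
      (fun j => x (w' j)) (da + db) := by
    refine ⟨by simp [hw'], ?_, ?_, ?_⟩
    · rw [hw2 _ (by omega), show da - (da + db - db) = 0 by omega]; rfl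
    · intro j hj
      rcases lt_or_ge j db with hjb | hjb
      · rw [hw1 _ hjb.le, hw1 _ hjb, Function.iterate_succ_apply']
        exact hedge _ (hdbl j hjb).2
      · rw [hw2 _ hjb, hw2 _ (by omega), show da - (j - db) = da - (j + 1 - db) + 1 by omega,
          Function.iterate_succ_apply', Sym2.eq_swap]
        exact hedge _ (hdal _ (by omega)).2
    · have hlt : ∀ i j : ℕ, i < j → j ≤ da + db → w' i ≠ w' j := by
        intro i j hij hj he
        rcases le_or_gt j db with hjb | hjb
        · rw [hw1 _ (by omega), hw1 _ hjb] at he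
          have := iterate_parent_lt hp' (fun l hl => (hdbl l hl).2) hij hjb
          exact this.ne he.symm
        · rcases lt_or_ge i db with hib | hib
          · rw [hw1 _ hib.le, hw2 _ hjb.le] at he
            have h1 := (hdbl i hib).1
            have h2 := (hdal (da - (j - db)) (by omega)).1
            rw [← he] at h2
            simp only [Pi.neg_apply] at h2
            linarith
          · rw [hw2 _ hib, hw2 _ hjb.le] at he
            have := iterate_parent_lt hp' (fun l hl => (hdal l hl).2)
              (by omega : da - (j - db) < da - (i - db)) (by omega)
            exact this.ne he
      intro i hi j hj he
      have he' := hx he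
      rcases lt_trichotomy i j with hij | hij | hij
      · exact absurd he' (hlt i j hij hj)
      · exact hij
      · exact absurd he'.symm (hlt j i hij hi)
  obtain ⟨rfl, hww⟩ := simplePath_unique hx hp' ⟨A, rfl⟩ ⟨B, rfl⟩ hw hpath
  -- the label of the longest edge
  have hmaxrec : ∃ j0 : Fin n, (0 < j0.val ∧ j0.val < N ∧
      (IsRightmost κ j0 ∨ IsRightmost (-κ) j0)) ∧ ∀ i : Fin n, 0 < i.val → i.val < N →
        (IsRightmost κ i ∨ IsRightmost (-κ) i) → |κ i - κ (p i)| ≤ |κ j0 - κ (p j0)| := by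
    have hne : (Finset.univ.filter fun i : Fin n => 0 < i.val ∧ i.val < N ∧
        (IsRightmost κ i ∨ IsRightmost (-κ) i)).Nonempty := by
      refine ⟨o', ?_⟩
      simp only [Finset.mem_filter, Finset.mem_univ, true_and]
      refine ⟨by simp [ho'], by simp only [ho']; omega, ?_⟩
      have hlt : ∀ i < o', i = o := fun i hi => by
        rw [Fin.lt_def] at hi; simp only [ho'] at hi; exact Fin.ext (by simp only [ho]; omega)
      have hne : κ o ≠ κ o' := H.ne _ _ hoN (by simp only [ho']; omega)
        (by rw [ho, ho']; simp)
      rcases lt_or_gt_of_ne hne with hc | hc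
      · left; intro i hi; rw [hlt i hi]; exact hc
      · right; intro i hi; rw [hlt i hi]; simpa using hc
    obtain ⟨j0, hj0, hm⟩ := Finset.exists_max_image _ (fun i => |κ i - κ (p i)|) hne
    simp only [Finset.mem_filter, Finset.mem_univ, true_and] at hj0 hm
    exact ⟨j0, hj0, fun i h1 h2 h3 => hm i ⟨h1, h2, h3⟩⟩
  obtain ⟨j0, ⟨hj00, hj0N, hj0r⟩, hj0m⟩ := hmaxrec
  have hj0θ : θ ≤ |κ j0 - κ (p j0)| := by
    have h1 := hext o' (by simp [ho'])
    rw [hpo', shift_symm, abs_neg] at h1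
    rw [h1, ← hpo'] at first
    refine first.trans ?_
    have : IsRightmost κ o' ∨ IsRightmost (-κ) o' := by
      by_contra hc
      obtain ⟨c1, c2⟩ := not_or.1 hc
      have hlt : ∀ i < o', i = o := fun i hi => by
        rw [Fin.lt_def] at hi; simp only [ho'] at hi; exact Fin.ext (by simp only [ho]; omega)
      unfold IsRightmost at c1 c2
      push Not at c1 c2
      obtain ⟨i1, e1, e1'⟩ := c1
      obtain ⟨i2, e2, e2'⟩ := c2
      rw [hlt _ e1] at e1'
      rw [hlt _ e2] at e2'
      simp only [Pi.neg_apply] at e2'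
      exact H.ne o o' hoN (by simp only [ho']; omega) (by rw [ho, ho']; simp) (by linarith)
    exact hj0m o' (by simp [ho']) (by simp only [ho']; omega) this
  have hj0long : (unlabel x p).IsLong θ (x j0) := ⟨x (p j0), hedge _ hj00, by rwa [hext _ hj00]⟩
  -- extents along the path
  have hE1 : ∀ j < db, |shift (w j) (w (j + 1))| = |κ (p^[j] B) - κ (p (p^[j] B))| := by
    intro j hj
    rw [hww j (by omega), hww (j + 1) (by omega), hw1 _ hj.le, hw1 _ hj,
      Function.iterate_succ_apply', hext _ (hdbl j hj).2]
  have hE2 : ∀ l < da, |shift (w (da + db - 1 - l)) (w (da + db - 1 - l + 1))| =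
      |κ (p^[l] A) - κ (p (p^[l] A))| := by
    intro l hl
    rw [hww _ (by omega), hww _ (by omega), hw2 _ (by omega), hw2 _ (by omega),
      show da - (da + db - 1 - l - db) = l + 1 by omega,
      show da - (da + db - 1 - l + 1 - db) = l by omega,
      Function.iterate_succ_apply', shift_symm, abs_neg, hext _ (hdal l hl).2]
  -- Being an endpoint of a long edge, `j0` lies between `A` and `B`. The extreme vertex on the side
  -- where `j0` is a record descends from `j0`, so the edge of `j0` is on the path.
  have hmaxle : |κ j0 - κ (p j0)| ≤ |shift (w i) (w (i + 1))| := by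
    rcases hj0r with hr | hr
    · obtain ⟨k, hk, hkl⟩ := IsRightmost.exists_iterate H hr hj0N B hBN (hle (hab _ hj0long).2)
      have hkb : k < db := by
        by_contra hc
        rcases (not_lt.1 hc).eq_or_lt with e | e
        · rw [← e, hdb] at hk; rw [← hk] at hj00; simp [ho] at hj00
        · have := (hkl db e).2; rw [hdb] at this; simp [ho] at this
      rw [← hk, ← hE1 k hkb]
      exact hi.le k (by omega)
    · obtain ⟨k, hk, hkl⟩ := IsRightmost.exists_iterate H.neg hr hj0N A hAN
        (by simpa using hle (hab _ hj0long).1)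
      have hkb : k < da := by
        by_contra hc
        rcases (not_lt.1 hc).eq_or_lt with e | e
        · rw [← e, hda] at hk; rw [← hk] at hj00; simp [ho] at hj00
        · have := (hkl da e).2; rw [hda] at this; simp [ho] at this
      rw [← hk, ← hE2 k hkb]
      exact hi.le _ (by omega)
  have hlt := hi.lt
  have hval : ∀ (u : Fin n), u.val < N → ∀ l d : ℕ, (∀ l < d, 0 < (p^[l] u).val) → l ≤ d →
      (p^[l] u).val < N := by
    intro u hu l d hl hld
    rcases Nat.eq_zero_or_pos l with rfl | h0
    · exact hu
    · have := iterate_parent_lt hp' hl h0 hld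
      rw [Fin.lt_def] at this
      exact this.trans hu
  have hwo : w db = x o := by rw [hww db (by omega), hw1 db le_rfl, hdb]
  unfold window
  rw [Finset.mem_image]
  refine ⟨db, ?_, hwo⟩
  simp only [Finset.mem_filter, Finset.mem_range]
  refine ⟨by omega, ?_⟩
  rcases lt_or_ge i db with hib | hib
  · rw [hE1 i hib] at hmaxle
    obtain ⟨d, hd, hd0, hdl⟩ := H.depth_le_of_longest hX rfl hesc
      (hval B hBN i db (fun l hl => (hdbl l hl).2) hib.le) (hdbl i hib).2
      (fun j h1 h2 h3 => (hj0m j h1 h2 h3).trans hmaxle)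
    have hdd : d = db - i := by
      refine depth_unique hd0 ?_ hdl fun l hl => ?_
      · rw [← Function.iterate_add_apply, show db - i + i = db by omega, hdb]
      · rw [← Function.iterate_add_apply]; exact (hdbl _ (by omega)).2
    omega
  -- Past the root the path runs away from it, so the child endpoint of edge `i` is `p^[l] A`, at
  -- position `i + 1`.
  · set l := da + db - 1 - i with hl
    have hil : i = da + db - 1 - l := by omega
    have hla : l < da := by omega
    rw [hil, hE2 l hla] at hmaxle
    obtain ⟨d, hd, hd0, hdl⟩ := H.depth_le_of_longest hX rfl hesc
      (hval A hAN l da (fun l hl => (hdal l hl).2) hla.le) (hdal l hla).2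
      (fun j h1 h2 h3 => (hj0m j h1 h2 h3).trans hmaxle)
    have hdd : d = da - l := by
      refine depth_unique hd0 ?_ hdl fun m hm => ?_
      · rw [← Function.iterate_add_apply, show da - l + l = da by omega, hda]
      · rw [← Function.iterate_add_apply]; exact (hdal _ (by omega)).2
    omega

/-! ### Reasoning about programs -/

namespace RamState

/-- Assignment to a natural number register. -/
def setN (s : RamState) (i v : ℕ) : RamState := { s with natReg := Function.update s.natReg i v }

/-- Assignment to a real register. -/
noncomputable def setR (s : RamState) (i : ℕ) (v : ℝ) : RamState :=
  { s with realReg := Function.update s.realReg i v }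

/-- Assignment to an entry of a natural number array. -/
def setNA (s : RamState) (a i v : ℕ) : RamState :=
  { s with natArr := Function.update s.natArr a (Function.update (s.natArr a) i v) }

/-- Assignment to an entry of a real array. -/
noncomputable def setRA (s : RamState) (a i : ℕ) (v : ℝ) : RamState :=
  { s with realArr := Function.update s.realArr a (Function.update (s.realArr a) i v) }

section
variable (s : RamState) (a i v j : ℕ) (r : ℝ)

@[simp] lemma setN_natReg : (s.setN i v).natReg j = if j = i then v else s.natReg j :=
  Function.update_apply _ _ _ _
@[simp] lemma setN_realReg : (s.setN i v).realReg = s.realReg := rfl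
@[simp] lemma setN_natArr : (s.setN i v).natArr = s.natArr := rfl
@[simp] lemma setN_realArr : (s.setN i v).realArr = s.realArr := rfl
@[simp] lemma setR_natReg : (s.setR i r).natReg = s.natReg := rfl
@[simp] lemma setR_realReg : (s.setR i r).realReg j = if j = i then r else s.realReg j :=
  Function.update_apply _ _ _ _
@[simp] lemma setR_natArr : (s.setR i r).natArr = s.natArr := rfl
@[simp] lemma setR_realArr : (s.setR i r).realArr = s.realArr := rfl
@[simp] lemma setNA_natReg : (s.setNA a i v).natReg = s.natReg := rfl
@[simp] lemma setNA_realReg : (s.setNA a i v).realReg = s.realReg := rfl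
@[simp] lemma setNA_natArr : (s.setNA a i v).natArr j =
    if j = a then Function.update (s.natArr a) i v else s.natArr j :=
  Function.update_apply _ _ _ _
@[simp] lemma setNA_realArr : (s.setNA a i v).realArr = s.realArr := rfl
@[simp] lemma setRA_natReg : (s.setRA a i r).natReg = s.natReg := rfl
@[simp] lemma setRA_realReg : (s.setRA a i r).realReg = s.realReg := rfl
@[simp] lemma setRA_natArr : (s.setRA a i r).natArr = s.natArr := rfl
@[simp] lemma setRA_realArr : (s.setRA a i r).realArr j =
    if j = a then Function.update (s.realArr a) i r else s.realArr j :=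
  Function.update_apply _ _ _ _

end

end RamState

/-- Started in `s`, the program `P` halts within `B` steps in a state that satisfies `Q`. -/
def Runs (P : RamProg) (s : RamState) (B : ℕ) (Q : RamState → Prop) : Prop :=
  ∃ s' t, Exec P s s' t ∧ t ≤ B ∧ Q s'

namespace Runs

variable {P P' : RamProg} {s : RamState} {B B' : ℕ} {Q Q' : RamState → Prop}

lemma mono (h : Runs P s B Q) (hB : B ≤ B') (hQ : ∀ s', Q s' → Q' s') : Runs P s B' Q' := by
  obtain ⟨s', t, h1, h2, h3⟩ := h
  exact ⟨s', t, h1, h2.trans hB, hQ _ h3⟩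

lemma skip (h : Q s) : Runs .skip s 1 Q := ⟨s, 1, .skip s, le_rfl, h⟩

lemma setNat {i : ℕ} {e : NatExp} (h : Q (s.setN i (e.eval s))) : Runs (.setNat i e) s 1 Q :=
  ⟨_, 1, .setNat s i e, le_rfl, h⟩

lemma setReal {i : ℕ} {e : RealExp} (h : Q (s.setR i (e.eval s))) : Runs (.setReal i e) s 1 Q :=
  ⟨_, 1, .setReal s i e, le_rfl, h⟩

lemma setNatArr {a : ℕ} {e f : NatExp} (h : Q (s.setNA a (e.eval s) (f.eval s))) :
    Runs (.setNatArr a e f) s 1 Q :=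
  ⟨_, 1, .setNatArr s a e f, le_rfl, h⟩

lemma setRealArr {a : ℕ} {e : NatExp} {f : RealExp}
    (h : Q (s.setRA a (e.eval s) (f.eval s))) : Runs (.setRealArr a e f) s 1 Q :=
  ⟨_, 1, .setRealArr s a e f, le_rfl, h⟩

lemma seq (h : Runs P s B fun s' => Runs P' s' B' Q) : Runs (.seq P P') s (B + B') Q := by
  obtain ⟨s', t, h1, h2, s'', t', h3, h4, h5⟩ := h
  exact ⟨s'', t + t', .seq h1 h3, by omega, h5⟩

lemma branch {b : TestExp} (h : b.Holds s → Runs P s B Q) (h' : ¬ b.Holds s → Runs P' s B' Q) :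
    Runs (.branch b P P') s (max B B' + 1) Q := by
  by_cases hb : b.Holds s
  · obtain ⟨s', t, h1, h2, h3⟩ := h hb
    exact ⟨s', t + 1, .branchTrue hb h1, by omega, h3⟩
  · obtain ⟨s', t, h1, h2, h3⟩ := h' hb
    exact ⟨s', t + 1, .branchFalse hb h1, by omega, h3⟩

/-- A loop that is left after exactly `m` rounds. -/
lemma loop {b : TestExp} (I : ℕ → RamState → Prop) (m : ℕ) (hs : I 0 s)
    (htest : ∀ k s, k ≤ m → I k s → (b.Holds s ↔ k < m))
    (hstep : ∀ k s, k < m → I k s → Runs P s B (I (k + 1))) :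
    Runs (.loop b P) s (m * (B + 1) + 1) (I m) := by
  have key : ∀ d k s, k + d = m → I k s → Runs (.loop b P) s (d * (B + 1) + 1) (I m) := by
    intro d
    induction d with
    | zero =>
      intro k s hk hI
      obtain rfl : k = m := by omega
      exact ⟨s, 1, .loopDone (by rw [htest k s le_rfl hI]; omega), by omega, hI⟩
    | succ d ih =>
      intro k s hk hI
      obtain ⟨s', t, h1, h2, h3⟩ := hstep k s (by omega) hI
      obtain ⟨s'', t', h4, h5, h6⟩ := ih (k + 1) s' (by omega) h3
      refine ⟨s'', t + t' + 1, .loopStep ((htest k s (by omega) hI).2 (by omega)) h1 h4, ?_, h6⟩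
      rw [Nat.succ_mul]
      omega
  exact key m 0 s (by omega) hs

end Runs

/-- The loop `for i in [0, bound)`. -/
def forLoop (i : ℕ) (bound : NatExp) (P : RamProg) : RamProg :=
  .seq (.setNat i (.const 0)) (.loop (.ltNat (.reg i) bound)
    (.seq P (.setNat i (.add (.reg i) (.const 1)))))

/-- The body may change anything as long as the counter is back at `k` when it ends. The bound is
evaluated anew at each test, hence the demand that the invariant fixes its value. -/
lemma Runs.forLoop {i : ℕ} {bound : NatExp} {P : RamProg} {s : RamState} {B : ℕ}
    (I : ℕ → RamState → Prop) (m : ℕ) (hs : I 0 (s.setN i 0))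
    (hbound : ∀ k s, k ≤ m → s.natReg i = k → I k s → bound.eval s = m)
    (hstep : ∀ k s, k < m → s.natReg i = k → I k s →
      Runs P s B fun s' => s'.natReg i = k ∧ I (k + 1) (s'.setN i (k + 1))) :
    Runs (forLoop i bound P) s (m * (B + 2) + 2) (I m) := by
  have hl := Runs.loop (b := .ltNat (.reg i) bound) (s := s.setN i 0)
    (P := .seq P (.setNat i (.add (.reg i) (.const 1)))) (B := B + 1)
    (fun k s => s.natReg i = k ∧ I k s) m ⟨by simp, hs⟩ ?_ ?_
  · have := Runs.seq (P := .setNat i (.const 0)) (B := 1) (s := s) (Runs.setNat hl)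
    exact this.mono (by rw [show B + 1 + 1 = B + 2 from rfl]; omega) fun s' h => h.2
  · rintro k s hk ⟨h1, h2⟩
    simp only [TestExp.Holds, NatExp.eval]
    rw [hbound k s hk h1 h2, h1]
  · rintro k s hk ⟨h1, h2⟩
    apply Runs.seq
    refine (hstep k s hk h1 h2).mono le_rfl fun s' hs' => Runs.setNat ?_
    simp only [NatExp.eval]
    rw [hs'.1]
    exact ⟨by simp, hs'.2⟩

/-! ### The root finding program -/

/-- Puts the displacement between the vertices in registers `7` and `8` into real register `1`. -/
def shiftProg : RamProg :=
  .seq (.setReal 1 (.sub (.arr 0 (.reg 8)) (.arr 0 (.reg 7))))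
    (.branch (.ltReal (.const (1 / 2)) (.reg 1)) (.setReal 1 (.sub (.reg 1) (.const 1)))
      (.branch (.ltReal (.reg 1) (.const (-(1 / 2)))) (.setReal 1 (.add (.reg 1) (.const 1))) .skip))

/-- The position of vertex `i` in memory. -/
def RamState.pos (s : RamState) (i : ℕ) : Pt := (s.realArr 0 i, s.realArr 1 i)

lemma RamState.setR_setR (s : RamState) (i : ℕ) (r r' : ℝ) :
    (s.setR i r).setR i r' = s.setR i r' := by
  simp [RamState.setR]

lemma runs_shiftProg {s : RamState} {Q : RamState → Prop}
    (h : Q (s.setR 1 (shift (s.pos (s.natReg 7)) (s.pos (s.natReg 8))))) :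
    Runs shiftProg s 4 Q := by
  unfold shiftProg
  refine Runs.mono (Runs.seq (B' := 3) (Runs.setReal ?_)) le_rfl fun _ h => h
  refine Runs.mono (Runs.branch (B := 1) (B' := 2) (fun h1 => Runs.setReal ?_) fun h1 =>
    Runs.mono (Runs.branch (B := 1) (B' := 1) (fun h2 => Runs.setReal ?_) fun h2 => Runs.skip ?_)
      le_rfl fun _ h => h) le_rfl fun _ h => h
  all_goals
    simp only [TestExp.Holds, RealExp.eval, NatExp.eval, RamState.setR_realReg, if_true,
      RamState.setR_setR] at *
    push_cast at *
  · rwa [show shift (s.pos (s.natReg 7)) (s.pos (s.natReg 8)) = _ from if_pos h1] at h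
  · rwa [show shift (s.pos (s.natReg 7)) (s.pos (s.natReg 8)) = _ from
      (if_neg h1).trans (if_pos h2)] at h
  · rwa [show shift (s.pos (s.natReg 7)) (s.pos (s.natReg 8)) = _ from
      (if_neg h1).trans (if_neg h2)] at h

/-- If the vertex in register `7` has been reached and the one in register `8` has not, then the
latter is attached to the former. -/
def relaxProg (dA pA lA : ℕ) : RamProg :=
  .branch (.conj (.ltNat (.const 0) (.arr dA (.reg 7))) (.neg (.ltNat (.const 0) (.arr dA (.reg 8)))))
    (.seq shiftProg (.seq (.setRealArr lA (.reg 8) (.add (.arr lA (.reg 7)) (.reg 1)))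
      (.seq (.setNatArr pA (.reg 8) (.reg 7))
        (.setNatArr dA (.reg 8) (.add (.arr dA (.reg 7)) (.const 1))))))
    .skip

/-- Breadth first propagation along the edges from the vertex `src`: depths plus one, parents and
lifts are stored in the arrays `dA`, `pA` and `lA`. -/
def propagateProg (dA pA lA : ℕ) (src : NatExp) : RamProg :=
  .seq (.setNatArr dA src (.const 1)) (.seq (.setRealArr lA src (.arr 0 src))
    (forLoop 2 (.add (.reg 0) (.reg 0)) (forLoop 1 (.sub (.reg 0) (.const 1))
      (.seq (.setNat 7 (.arr 0 (.reg 1))) (.seq (.setNat 8 (.arr 1 (.reg 1)))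
        (.seq (relaxProg dA pA lA) (.seq (.setNat 7 (.arr 1 (.reg 1)))
          (.seq (.setNat 8 (.arr 0 (.reg 1))) (relaxProg dA pA lA)))))))))

/-- The input part of the memory. -/
structure SameInput (s s' : RamState) : Prop where
  size : s'.natReg 0 = s.natReg 0
  eps : s'.realReg 0 = s.realReg 0
  src : s'.natArr 0 = s.natArr 0
  tgt : s'.natArr 1 = s.natArr 1
  fst : s'.realArr 0 = s.realArr 0
  snd : s'.realArr 1 = s.realArr 1

lemma SameInput.pos {s s' : RamState} (h : SameInput s s') : s'.pos = s.pos := by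
  funext i; simp [RamState.pos, h.fst, h.snd]

/-- The vertices `u` and `w` are the endpoints of one of the first `m` edges in memory. -/
def RamState.Edge (s : RamState) (m u w : ℕ) : Prop :=
  ∃ j < m, (s.natArr 0 j = u ∧ s.natArr 1 j = w) ∨ (s.natArr 0 j = w ∧ s.natArr 1 j = u)

/-- `D`, `p`, `f` are depths plus one, parents and lifts on the part of the tree reached so far. -/
structure Reached (s : RamState) (src : ℕ) (D p : ℕ → ℕ) (f : ℕ → ℝ) : Prop where
  depth_src : D src = 1
  lift_src : f src = s.realArr 0 src
  parent : ∀ v, D v ≠ 0 → v = src ∨ (s.Edge (s.natReg 0 - 1) (p v) v ∧ D (p v) ≠ 0 ∧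
    D v = D (p v) + 1 ∧ f v = f (p v) + shift (s.pos (p v)) (s.pos v))

/-- The part of the memory that `propagateProg` leaves alone. -/
structure PropFrame (dA pA lA : ℕ) (s s' : RamState) : Prop where
  natReg : ∀ i, i ≠ 1 → i ≠ 2 → i ≠ 7 → i ≠ 8 → s'.natReg i = s.natReg i
  realReg : ∀ i, i ≠ 1 → s'.realReg i = s.realReg i
  natArr : ∀ a, a ≠ dA → a ≠ pA → s'.natArr a = s.natArr a
  realArr : ∀ a, a ≠ lA → s'.realArr a = s.realArr a

section Propagate

variable {dA pA lA : ℕ}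

/-- The state during a propagation that was started in `s₀`. -/
structure Propagating (dA pA lA : ℕ) (s₀ : RamState) (src : ℕ) (s : RamState) : Prop where
  frame : PropFrame dA pA lA s₀ s
  reached : Reached s₀ src (s.natArr dA) (s.natArr pA) (s.realArr lA)

/-- Depths are shifted by one so that the zero of fresh memory means "not reached". Only unreached
vertices are written, and their data come from a reached vertex, so the equations recorded earlier
survive. -/
lemma runs_relaxProg {s₀ s : RamState} {src : ℕ} (h3 : 2 ≤ lA)
    (h4 : dA ≠ pA) (hs : Propagating dA pA lA s₀ src s)
    (he : s₀.Edge (s₀.natReg 0 - 1) (s.natReg 7) (s.natReg 8)) :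
    Runs (relaxProg dA pA lA) s 9 fun s' => Propagating dA pA lA s₀ src s' ∧
      s'.natReg = s.natReg ∧ (∀ v, s.natArr dA v ≠ 0 → s'.natArr dA v ≠ 0) ∧
      (s.natArr dA (s.natReg 7) ≠ 0 → s'.natArr dA (s.natReg 8) ≠ 0) := by
  unfold relaxProg
  have hpos : s.pos = s₀.pos := by
    funext i
    simp [RamState.pos, hs.frame.realArr 0 (by omega), hs.frame.realArr 1 (by omega)]
  refine Runs.mono (Runs.branch (B := 7) (B' := 1) (fun hb => ?_) fun hb => Runs.skip ?_)
    (by norm_num) fun _ h => h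
  · simp only [TestExp.Holds, NatExp.eval, not_lt, Nat.le_zero] at hb
    obtain ⟨hb1, hb2⟩ := hb
    refine Runs.mono (Runs.seq (B' := 3) (runs_shiftProg ?_)) le_rfl fun _ h => h
    refine Runs.mono (Runs.seq (B' := 2) (Runs.setRealArr ?_)) le_rfl fun _ h => h
    refine Runs.mono (Runs.seq (B' := 1) (Runs.setNatArr (Runs.setNatArr ?_))) le_rfl fun _ h => h
    simp only [NatExp.eval, RealExp.eval, RamState.setR_natReg, RamState.setRA_natReg,
      RamState.setNA_natReg, RamState.setR_realArr, RamState.setR_realReg, if_true,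
      RamState.setNA_natArr, RamState.setRA_natArr, RamState.setR_natArr, h4, if_false]
    set u := s.natReg 7
    set w := s.natReg 8
    have huw : u ≠ w := by intro e; rw [e] at hb1; omega
    have hwsrc : w ≠ src := by
      intro e; rw [e, hs.reached.depth_src] at hb2; omega
    refine ⟨⟨⟨?_, ?_, ?_, ?_⟩, ⟨?_, ?_, ?_⟩⟩, trivial, ?_, ?_⟩
    · intro i a b c d; simpa using hs.frame.natReg i a b c d
    · intro i a; simpa [a] using hs.frame.realReg i a
    · intro a b c; simpa [b, c] using hs.frame.natArr a b c
    · intro a b; simpa [b] using hs.frame.realArr a b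
    · simp [h4, Function.update_of_ne hwsrc.symm, hs.reached.depth_src]
    · simp [Function.update_of_ne hwsrc.symm, hs.reached.lift_src]
    · intro v hv
      simp only [RamState.setNA_natArr, if_true, RamState.setNA_realArr, RamState.setRA_realArr,
        RamState.setRA_natArr, RamState.setR_natArr, RamState.setR_realArr, h4, h4.symm,
        if_false] at hv ⊢
      by_cases hvw : v = w
      · right
        subst hvw
        simp only [Function.update_self, Function.update_of_ne huw]
        refine ⟨he, by omega, trivial, ?_⟩
        rw [hpos]
      · rw [Function.update_of_ne hvw] at hv
        rcases hs.reached.parent v hv with hv' | ⟨e1, e2, e3, e4⟩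
        · exact Or.inl hv'
        · right
          have hpw : s.natArr pA v ≠ w := by intro e; rw [e] at e2; exact e2 hb2
          simp only [Function.update_of_ne hvw, Function.update_of_ne hpw]
          exact ⟨e1, e2, e3, e4⟩
    · intro v hv
      have hvw : v ≠ w := by rintro rfl; exact hv hb2
      simpa [h4, Function.update_of_ne hvw] using hv
    · intro _
      simp
  · refine ⟨hs, rfl, fun v hv => hv, fun hv => ?_⟩
    simp only [TestExp.Holds, NatExp.eval, not_lt, Nat.le_zero, not_and] at hb
    exact hb (by omega)

/-- The vertices at distance at most `r` from `src`. -/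
def Within (s : RamState) (src : ℕ) : ℕ → ℕ → Prop
  | 0, v => v = src
  | r + 1, v => Within s src r v ∨ ∃ u, Within s src r u ∧ s.Edge (s.natReg 0 - 1) u v

/-- Each pass treats all edges in both directions, so after `r` passes everything within distance
`r` is reached. `hsrc` says that the source depends on number registers only and is not disturbed by
the two initial array writes. -/
lemma runs_propagateProg {s : RamState} {src : NatExp} (h1 : 2 ≤ dA) (h2 : 2 ≤ pA) (h3 : 2 ≤ lA)
    (h4 : dA ≠ pA) (hsrc : ∀ s' : RamState, s'.natReg = s.natReg → src.eval s' = src.eval s)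
    (hd : s.natArr dA = fun _ => 0) :
    Runs (propagateProg dA pA lA src) s
      (2 + (2 * s.natReg 0 * ((s.natReg 0 - 1) * 24 + 4) + 2))
      fun s' => Propagating dA pA lA s (src.eval s) s' ∧
        ∀ v, Within s (src.eval s) (2 * s.natReg 0) v → s'.natArr dA v ≠ 0 := by
  unfold propagateProg
  set z := src.eval s with hz
  refine Runs.mono (Runs.seq (B := 1) (Runs.setNatArr (Runs.seq (B := 1) (Runs.setRealArr ?_))))
    (by omega : 1 + (1 + (2 * s.natReg 0 * ((s.natReg 0 - 1) * 24 + 4) + 2)) ≤ _) fun _ h => h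
  simp only [NatExp.eval, RealExp.eval]
  have hz' : src.eval (s.setNA dA z 1) = z := hsrc _ rfl
  rw [hz']
  have hcase : Propagating dA pA lA s z
      ((s.setNA dA z 1).setRA lA z ((s.setNA dA z 1).realArr 0 z)) := by
    refine ⟨⟨fun i _ _ _ _ => rfl, fun i _ => rfl, fun a b c => by simp [b],
      fun a b => by simp [b]⟩, ⟨by simp, by simp, ?_⟩⟩
    intro v hv
    left
    by_contra hc
    simp [Function.update_of_ne hc, hd] at hv
  have hn : ∀ {s' : RamState}, Propagating dA pA lA s z s' → s'.natReg 0 = s.natReg 0 :=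
    fun h => h.frame.natReg 0 (by omega) (by omega) (by omega) (by omega)
  have hset : ∀ {s' : RamState} {i v : ℕ}, (i = 1 ∨ i = 2 ∨ i = 7 ∨ i = 8) →
      Propagating dA pA lA s z s' → Propagating dA pA lA s z (s'.setN i v) := by
    intro s' i v hi h
    refine ⟨⟨fun j a b c d => ?_, h.frame.realReg, h.frame.natArr, h.frame.realArr⟩, h.reached⟩
    rw [RamState.setN_natReg, if_neg (by omega)]
    exact h.frame.natReg j a b c d
  refine Runs.mono (Runs.forLoop (fun r s' => Propagating dA pA lA s z s' ∧
    ∀ v, Within s z r v → s'.natArr dA v ≠ 0) (2 * s.natReg 0)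
    (B := (s.natReg 0 - 1) * 24 + 2) ?_ ?_ ?_) le_rfl fun _ h => h
  · refine ⟨hset (by omega) hcase, fun v hv => ?_⟩
    rw [show v = z from hv]
    simp [← hz]
  · rintro k s' - - ⟨h, -⟩
    simp only [NatExp.eval, hn h]
    omega
  · rintro r s₁ hr hr1 ⟨hs1, hw1⟩
    have hrun := Runs.forLoop (i := 1) (bound := .sub (.reg 0) (.const 1)) (s := s₁) (B := 22)
      (P := (.seq (.setNat 7 (.arr 0 (.reg 1))) (.seq (.setNat 8 (.arr 1 (.reg 1)))
        (.seq (relaxProg dA pA lA) (.seq (.setNat 7 (.arr 1 (.reg 1)))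
          (.seq (.setNat 8 (.arr 0 (.reg 1))) (relaxProg dA pA lA)))))))
      -- The inner invariant compares with the state `s₁` at the beginning of the pass: whatever was
      -- reached then has been handed across the first `k` edges.
      (fun k s' => Propagating dA pA lA s z s' ∧ s'.natReg 2 = r ∧
        (∀ v, s₁.natArr dA v ≠ 0 → s'.natArr dA v ≠ 0) ∧
        ∀ j < k, (s₁.natArr dA (s.natArr 0 j) ≠ 0 → s'.natArr dA (s.natArr 1 j) ≠ 0) ∧
          (s₁.natArr dA (s.natArr 1 j) ≠ 0 → s'.natArr dA (s.natArr 0 j) ≠ 0))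
      (s.natReg 0 - 1) ?_ ?_ ?_
    · refine hrun.mono (by omega) ?_
      rintro s' ⟨p1, p2, p3, p4⟩
      refine ⟨p2, hset (by omega) p1, fun v hv => ?_⟩
      simp only [RamState.setN_natArr]
      rcases hv with hv | ⟨u, hu, j, hj, ⟨e1, e2⟩ | ⟨e1, e2⟩⟩
      · exact p3 v (hw1 v hv)
      · rw [← e2]; exact (p4 j hj).1 (by rw [e1]; exact hw1 u hu)
      · rw [← e1]; exact (p4 j hj).2 (by rw [e2]; exact hw1 u hu)
    · exact ⟨hset (by omega) hs1, by simpa using hr1, fun v hv => hv, fun j hj => by omega⟩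
    · rintro k s' - - ⟨h, -⟩
      simp only [NatExp.eval, hn h]
    · rintro k s' hk hk1 ⟨p1, p2, p3, p4⟩
      have e0 : s'.natArr 0 = s.natArr 0 := p1.frame.natArr 0 (by omega) (by omega)
      have e1 : s'.natArr 1 = s.natArr 1 := p1.frame.natArr 1 (by omega) (by omega)
      refine Runs.mono (Runs.seq (B := 1) (B' := 21) (Runs.setNat (Runs.mono
        (Runs.seq (B := 1) (B' := 20) (Runs.setNat (Runs.mono
          (Runs.seq (B := 9) (B' := 11) ?_) le_rfl fun _ h => h))) le_rfl fun _ h => h)))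
        le_rfl fun _ h => h
      refine Runs.mono (runs_relaxProg h3 h4 (hset (by omega) (hset (by omega) p1)) ?_)
        le_rfl ?_
      · refine ⟨k, hk, Or.inl ⟨?_, ?_⟩⟩ <;> simp [NatExp.eval, hk1, e0, e1]
      · rintro s2 ⟨q1, q2, q3, q4⟩
        have e0' : s2.natArr 0 = s.natArr 0 := q1.frame.natArr 0 (by omega) (by omega)
        have e1' : s2.natArr 1 = s.natArr 1 := q1.frame.natArr 1 (by omega) (by omega)
        have er : s2.natReg 1 = k := by rw [q2]; simp [hk1]
        simp only [NatExp.eval, RamState.setN_natReg, RamState.setN_natArr, hk1, e0, e1] at q3 q4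
        norm_num at q4
        refine Runs.mono (Runs.seq (B := 1) (B' := 10) (Runs.setNat (Runs.mono
          (Runs.seq (B := 1) (B' := 9) (Runs.setNat ?_)) le_rfl fun _ h => h)))
          le_rfl fun _ h => h
        refine Runs.mono (runs_relaxProg h3 h4 (hset (by omega) (hset (by omega) q1)) ?_)
          le_rfl ?_
        · refine ⟨k, hk, Or.inr ⟨?_, ?_⟩⟩ <;> simp [NatExp.eval, er, e0', e1']
        · rintro s3 ⟨r1, r2, r3, r4⟩
          simp only [NatExp.eval, RamState.setN_natReg, RamState.setN_natArr, er, e0', e1'] at r3 r4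
          norm_num at r4
          refine ⟨by rw [r2]; simp [er], hset (by omega) r1, ?_, ?_, ?_⟩
          · rw [RamState.setN_natReg, if_neg (by omega), r2]
            simp [q2, p2]
          · intro v hv
            exact r3 v (q3 v (p3 v hv))
          · intro j hj
            simp only [RamState.setN_natArr]
            rcases (by omega : j < k ∨ j = k) with hj | rfl
            · exact ⟨fun hv => r3 _ (q3 _ ((p4 j hj).1 hv)), fun hv => r3 _ (q3 _ ((p4 j hj).2 hv))⟩
            · exact ⟨fun hv => r3 _ (q4 (p3 _ hv)), fun hv => r4 (q3 _ (p3 _ hv))⟩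

end Propagate

/-- `s'` agrees with `s` outside of the listed registers and arrays. -/
structure Keeps (Nr Rr Na Ra : List ℕ) (s s' : RamState) : Prop where
  natReg : ∀ i ∉ Nr, s'.natReg i = s.natReg i
  realReg : ∀ i ∉ Rr, s'.realReg i = s.realReg i
  natArr : ∀ i ∉ Na, s'.natArr i = s.natArr i
  realArr : ∀ i ∉ Ra, s'.realArr i = s.realArr i

section Keeps

variable {Nr Rr Na Ra : List ℕ} {s s' : RamState}

lemma Keeps.refl (Nr Rr Na Ra : List ℕ) (s : RamState) : Keeps Nr Rr Na Ra s s :=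
  ⟨fun _ _ => rfl, fun _ _ => rfl, fun _ _ => rfl, fun _ _ => rfl⟩

lemma Keeps.setN (h : Keeps Nr Rr Na Ra s s') {i v : ℕ} (hi : i ∈ Nr) :
    Keeps Nr Rr Na Ra s (s'.setN i v) := by
  refine ⟨fun j hj => ?_, h.realReg, h.natArr, h.realArr⟩
  rw [RamState.setN_natReg, if_neg (by rintro rfl; exact hj hi), h.natReg j hj]

lemma Keeps.setR (h : Keeps Nr Rr Na Ra s s') {i : ℕ} {v : ℝ} (hi : i ∈ Rr) :
    Keeps Nr Rr Na Ra s (s'.setR i v) := by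
  refine ⟨h.natReg, fun j hj => ?_, h.natArr, h.realArr⟩
  rw [RamState.setR_realReg, if_neg (by rintro rfl; exact hj hi), h.realReg j hj]

lemma Keeps.setNA (h : Keeps Nr Rr Na Ra s s') {a i v : ℕ} (ha : a ∈ Na) :
    Keeps Nr Rr Na Ra s (s'.setNA a i v) := by
  refine ⟨h.natReg, h.realReg, fun j hj => ?_, h.realArr⟩
  rw [RamState.setNA_natArr, if_neg (by rintro rfl; exact hj ha), h.natArr j hj]

lemma Keeps.pos (h : Keeps Nr Rr Na Ra s s') (h0 : 0 ∉ Ra) (h1 : 1 ∉ Ra) : s'.pos = s.pos := by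
  funext i; simp [RamState.pos, h.realArr 0 h0, h.realArr 1 h1]

end Keeps

/-- The least `k` with `k! ≥ 1 / ε`. -/
noncomputable def factorialInv (ε : ℝ) : ℕ := sInf {k : ℕ | 1 ≤ (k.factorial : ℝ) * ε}

lemma factorialInv_spec {ε : ℝ} (hε : 0 < ε) : 1 ≤ ((factorialInv ε).factorial : ℝ) * ε := by
  refine Nat.sInf_mem (s := {k : ℕ | 1 ≤ (k.factorial : ℝ) * ε}) ?_
  obtain ⟨k, hk⟩ := exists_nat_gt (1 / ε)
  refine ⟨k, ?_⟩
  have h1 : (k : ℝ) ≤ k.factorial := by exact_mod_cast Nat.self_le_factorial k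
  rw [Set.mem_ofPred_eq, ← div_le_iff₀ hε]
  linarith

lemma factorial_mul_lt_of_lt {ε : ℝ} {k : ℕ} (hk : k < factorialInv ε) :
    (k.factorial : ℝ) * ε < 1 := by
  have := Nat.notMem_of_lt_sInf hk
  simpa using this

/-- Computes the radius, eight times the least `k` with `k! ≥ 1 / ε`, into register `12`. -/
def radiusProg : RamProg :=
  .seq (.setReal 2 (.const 1)) (.seq (.loop (.ltReal (.mul (.reg 2) (.reg 0)) (.const 1))
    (.seq (.setNat 3 (.add (.reg 3) (.const 1))) (.setReal 2 (.mul (.reg 2) (.ofNat (.reg 3))))))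
    (.seq (.setNat 12 (.add (.reg 3) (.reg 3))) (.seq (.setNat 12 (.add (.reg 12) (.reg 12)))
      (.setNat 12 (.add (.reg 12) (.reg 12))))))

/-- The machine has no logarithm. The inverse factorial has the order of s(ε) and needs only
multiplication and comparison; three doublings supply the factor 8. -/
lemma runs_radiusProg {s : RamState} (hε : 0 < s.realReg 0) (h3 : s.natReg 3 = 0) :
    Runs radiusProg s (3 * factorialInv (s.realReg 0) + 5) fun s' =>
      Keeps [3, 12] [2] [] [] s s' ∧ s'.natReg 12 = 8 * factorialInv (s.realReg 0) := by
  unfold radiusProg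
  set ε := s.realReg 0 with hεdef
  refine Runs.mono (Runs.seq (B' := 3 * factorialInv ε + 4) (Runs.setReal
    (Runs.mono (Runs.seq (B' := 3) (Runs.mono (Runs.loop (B := 2) (fun k s' =>
      Keeps [3, 12] [2] [] [] s s' ∧ s'.natReg 3 = k ∧ s'.realReg 2 = k.factorial)
      (factorialInv ε) ?_ ?_ ?_) le_rfl ?_)) (by omega) fun _ h => h))) (by omega) fun _ h => h
  · exact ⟨(Keeps.refl _ _ _ _ s).setR (by simp), h3, by simp [RealExp.eval]⟩
  · rintro k s' hk ⟨hK, -, h2⟩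
    have h0 : s'.realReg 0 = ε := hK.realReg 0 (by simp)
    simp only [TestExp.Holds, RealExp.eval, h0, h2, Rat.cast_one]
    constructor
    · intro h
      refine lt_of_le_of_ne hk ?_
      rintro rfl
      linarith [factorialInv_spec hε]
    · exact factorial_mul_lt_of_lt
  · rintro k s' hk ⟨hK, h1, h2⟩
    refine Runs.seq (B := 1) (Runs.setNat (Runs.setReal ?_))
    refine ⟨(hK.setN (by simp)).setR (by simp), by simp [NatExp.eval, h1], ?_⟩
    simp [NatExp.eval, RealExp.eval, h1, h2, Nat.factorial_succ]
    ring
  · rintro s' ⟨hK, h1, -⟩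
    refine Runs.seq (B := 1) (Runs.setNat (Runs.seq (B := 1) (Runs.setNat (Runs.setNat ?_))))
    refine ⟨((hK.setN (by simp)).setN (by simp)).setN (by simp), ?_⟩
    simp [NatExp.eval, h1]
    ring

/-- The lexicographic order of the vertices in memory, with the first coordinates given by `f`. -/
def KeyLE (f g : ℕ → ℝ) (u v : ℕ) : Prop := f u < f v ∨ (f u = f v ∧ g u ≤ g v)

lemma KeyLE.refl (f g : ℕ → ℝ) (u : ℕ) : KeyLE f g u u := Or.inr ⟨rfl, le_rfl⟩

lemma KeyLE.trans {f g : ℕ → ℝ} {u v w : ℕ} (h : KeyLE f g u v) (h' : KeyLE f g v w) :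
    KeyLE f g u w := by
  rcases h with h | ⟨h1, h2⟩ <;> rcases h' with h' | ⟨h1', h2'⟩
  · exact Or.inl (h.trans h')
  · exact Or.inl (by linarith)
  · exact Or.inl (by linarith)
  · exact Or.inr ⟨h1.trans h1', h2.trans h2'⟩

lemma KeyLE.of_not {f g : ℕ → ℝ} {u v : ℕ} (h : ¬ KeyLE f g u v) : KeyLE f g v u := by
  unfold KeyLE at *
  push Not at h
  rcases h.1.lt_or_eq with h1 | h1
  · exact Or.inl h1
  · exact Or.inr ⟨h1, (h.2 h1.symm).le⟩

/-- The vertex in register `i` does not come after the one in register `j`. -/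
def keyTest (i j : ℕ) : TestExp :=
  .neg (.conj (.neg (.ltReal (.arr 2 (.reg i)) (.arr 2 (.reg j))))
    (.neg (.conj (.neg (.ltReal (.arr 2 (.reg j)) (.arr 2 (.reg i))))
      (.neg (.ltReal (.arr 1 (.reg j)) (.arr 1 (.reg i)))))))

lemma holds_keyTest (s : RamState) (i j : ℕ) : (keyTest i j).Holds s ↔
    KeyLE (s.realArr 2) (s.realArr 1) (s.natReg i) (s.natReg j) := by
  unfold keyTest KeyLE
  simp only [TestExp.Holds, RealExp.eval, NatExp.eval, not_lt]
  constructor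
  · intro h
    by_contra hc
    obtain ⟨h1, h2⟩ := not_or.1 hc
    rw [not_lt] at h1
    exact h ⟨h1, fun h3 => h2 ⟨le_antisymm h3.1 h1, h3.2⟩⟩
  · rintro (h | ⟨h1, h2⟩) ⟨h3, h4⟩
    · linarith
    · exact h4 ⟨h1.le, h2⟩

/-- Updates the extreme vertices in registers `4` and `5` with the vertex in register `7`. -/
def considerProg : RamProg :=
  .seq (.branch (.ltNat (.const 0) (.reg 6)) .skip
      (.seq (.setNat 4 (.reg 7)) (.seq (.setNat 5 (.reg 7)) (.setNat 6 (.const 1)))))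
    (.seq (.branch (keyTest 4 7) .skip (.setNat 4 (.reg 7)))
      (.branch (keyTest 7 5) .skip (.setNat 5 (.reg 7))))

/-- Registers `4` and `5` hold the first and the last vertex of `C`, if there is one. -/
def Extremes (C : Set ℕ) (s : RamState) : Prop :=
  (s.natReg 6 = 0 ∧ C = ∅) ∨ (s.natReg 6 ≠ 0 ∧ s.natReg 4 ∈ C ∧ s.natReg 5 ∈ C ∧
    ∀ v ∈ C, KeyLE (s.realArr 2) (s.realArr 1) (s.natReg 4) v ∧
      KeyLE (s.realArr 2) (s.realArr 1) v (s.natReg 5))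

lemma runs_considerProg {s : RamState} {C : Set ℕ} (h : Extremes C s) :
    Runs considerProg s 8 fun s' => Keeps [4, 5, 6] [] [] [] s s' ∧
      Extremes (insert (s.natReg 7) C) s' := by
  unfold considerProg
  set u := s.natReg 7 with hu
  have h1 : Runs (.branch (.ltNat (.const 0) (.reg 6)) .skip
      (.seq (.setNat 4 (.reg 7)) (.seq (.setNat 5 (.reg 7)) (.setNat 6 (.const 1))))) s 4
      fun s' => Keeps [4, 5, 6] [] [] [] s s' ∧ s'.natReg 6 ≠ 0 ∧
        s'.natReg 4 ∈ insert u C ∧ s'.natReg 5 ∈ insert u C ∧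
        ∀ v ∈ C, KeyLE (s'.realArr 2) (s'.realArr 1) (s'.natReg 4) v ∧
          KeyLE (s'.realArr 2) (s'.realArr 1) v (s'.natReg 5) := by
    refine Runs.mono (Runs.branch (B := 1) (B' := 3) (fun hb => Runs.skip ?_) fun hb => ?_)
      (by norm_num) fun _ h => h
    · simp only [TestExp.Holds, NatExp.eval] at hb
      rcases h with ⟨h, -⟩ | ⟨h, h4, h5, hC⟩
      · omega
      · exact ⟨Keeps.refl _ _ _ _ s, h, Or.inr h4, Or.inr h5, hC⟩
    · simp only [TestExp.Holds, NatExp.eval] at hb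
      rcases h with ⟨h, rfl⟩ | ⟨h, -⟩
      · refine Runs.seq (B := 1) (Runs.setNat (Runs.seq (B := 1) (Runs.setNat (Runs.setNat ?_))))
        refine ⟨(((Keeps.refl _ _ _ _ s).setN (by simp)).setN (by simp)).setN (by simp), ?_⟩
        simp [NatExp.eval, hu]
      · omega
  refine Runs.mono (Runs.seq (B' := 4) (h1.mono le_rfl ?_)) le_rfl fun _ h => h
  rintro s1 ⟨k1, a1, b1, c1, d1⟩
  have e1 : s1.natReg 7 = u := k1.natReg 7 (by simp)
  have h2 : Runs (.branch (keyTest 4 7) .skip (.setNat 4 (.reg 7))) s1 2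
      fun s' => Keeps [4, 5, 6] [] [] [] s s' ∧ s'.natReg 6 ≠ 0 ∧
        s'.natReg 4 ∈ insert u C ∧ s'.natReg 5 ∈ insert u C ∧
        (∀ v ∈ insert u C, KeyLE (s'.realArr 2) (s'.realArr 1) (s'.natReg 4) v) ∧
        ∀ v ∈ C, KeyLE (s'.realArr 2) (s'.realArr 1) v (s'.natReg 5) := by
    refine Runs.mono (Runs.branch (B := 1) (B' := 1) (fun hb => Runs.skip ?_) fun hb =>
      Runs.setNat ?_) (by norm_num) fun _ h => h
    · rw [holds_keyTest, e1] at hb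
      refine ⟨k1, a1, b1, c1, ?_, fun v hv => (d1 v hv).2⟩
      rintro v (rfl | hv)
      · exact hb
      · exact (d1 v hv).1
    · rw [holds_keyTest, e1] at hb
      refine ⟨k1.setN (by simp), by simpa using a1, by simp [NatExp.eval, e1],
        by simpa using c1, ?_, fun v hv => by simpa using (d1 v hv).2⟩
      simp only [NatExp.eval, e1, RamState.setN_natReg, if_true, RamState.setN_realArr]
      rintro v (rfl | hv)
      · exact KeyLE.refl _ _ _
      · exact (KeyLE.of_not hb).trans (d1 v hv).1
  refine Runs.mono (Runs.seq (B' := 2) (h2.mono le_rfl ?_)) le_rfl fun _ h => h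
  rintro s2 ⟨k2, a2, b2, c2, d2, f2⟩
  have e2 : s2.natReg 7 = u := k2.natReg 7 (by simp)
  refine Runs.mono (Runs.branch (B := 1) (B' := 1) (fun hb => Runs.skip ?_) fun hb =>
    Runs.setNat ?_) (by norm_num) fun _ h => h
  · rw [holds_keyTest, e2] at hb
    refine ⟨k2, Or.inr ⟨a2, b2, c2, fun v hv => ⟨d2 v hv, ?_⟩⟩⟩
    rcases hv with rfl | hv
    · exact hb
    · exact f2 v hv
  · rw [holds_keyTest, e2] at hb
    refine ⟨k2.setN (by simp), Or.inr ⟨by simpa using a2, by simpa using b2,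
      by simp [NatExp.eval, e2], fun v hv => ⟨by simpa using d2 v hv, ?_⟩⟩⟩
    simp only [NatExp.eval, e2, RamState.setN_natReg, if_true, RamState.setN_realArr]
    rcases hv with rfl | hv
    · exact KeyLE.refl _ _ _
    · exact (f2 v hv).trans (KeyLE.of_not hb)

/-- The vertices in memory on one of the first `m` edges with horizontal extent at least `θ`. -/
def LongVerts (s : RamState) (θ : ℝ) (m : ℕ) : Set ℕ :=
  {u | ∃ j < m, θ ≤ |shift (s.pos (s.natArr 0 j)) (s.pos (s.natArr 1 j))| ∧
    (u = s.natArr 0 j ∨ u = s.natArr 1 j)}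

/-- Finds the extreme endpoints of long edges. -/
def extremesProg : RamProg :=
  forLoop 1 (.sub (.reg 0) (.const 1)) (.seq (.setNat 7 (.arr 0 (.reg 1)))
    (.seq (.setNat 8 (.arr 1 (.reg 1))) (.seq shiftProg
      (.branch (.conj (.ltReal (.reg 1) (.div (.reg 0) (.const 8)))
          (.ltReal (.sub (.const 0) (.div (.reg 0) (.const 8))) (.reg 1))) .skip
        (.seq considerProg (.seq (.setNat 7 (.reg 8)) considerProg))))))

lemma runs_extremesProg {s : RamState} (h6 : s.natReg 6 = 0) :
    Runs extremesProg s ((s.natReg 0 - 1) * 26 + 2) fun s' =>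
      Keeps [1, 4, 5, 6, 7, 8] [1] [] [] s s' ∧
      Extremes (LongVerts s (s.realReg 0 / 8) (s.natReg 0 - 1)) s' := by
  unfold extremesProg
  set θ := s.realReg 0 / 8 with hθ
  have hsetN : ∀ {C : Set ℕ} {s' : RamState} {i v : ℕ}, i ≠ 4 → i ≠ 5 → i ≠ 6 →
      Extremes C s' → Extremes C (s'.setN i v) := by
    intro C s' i v h4 h5 h6 h
    unfold Extremes at *
    simpa only [RamState.setN_natReg, h4.symm, h5.symm, h6.symm, if_false,
      RamState.setN_realArr] using h
  refine Runs.mono (Runs.forLoop (B := 24) (fun k s' => Keeps [1, 4, 5, 6, 7, 8] [1] [] [] s s' ∧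
    Extremes (LongVerts s θ k) s') (s.natReg 0 - 1) ?_ ?_ ?_) le_rfl fun _ h => h
  · refine ⟨(Keeps.refl _ _ _ _ s).setN (by simp), Or.inl ⟨by simpa using h6, ?_⟩⟩
    ext u; simp [LongVerts]
  · rintro k s' - - ⟨h, -⟩
    simp [NatExp.eval, h.natReg 0 (by simp)]
  · rintro k s' hk hk1 ⟨hK, hE⟩
    refine Runs.mono (Runs.seq (B := 1) (B' := 23) (Runs.setNat (Runs.mono
      (Runs.seq (B := 1) (B' := 22) (Runs.setNat (Runs.mono
        (Runs.seq (B := 4) (B' := 18) (runs_shiftProg ?_)) le_rfl fun _ h => h)))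
        le_rfl fun _ h => h))) le_rfl fun _ h => h
    have e0 : s'.natArr 0 = s.natArr 0 := hK.natArr 0 (by simp)
    have e1 : s'.natArr 1 = s.natArr 1 := hK.natArr 1 (by simp)
    have hpos : ∀ i v j w, ((s'.setN i v).setN j w).pos = s.pos := fun i v j w =>
      hK.pos (by simp) (by simp)
    simp only [NatExp.eval, hk1, e0, RamState.setN_natArr, RamState.setN_natReg, e1, hpos]
    norm_num [e1, hk1]
    set u := s.natArr 0 k
    set w := s.natArr 1 k
    set d := shift (s.pos u) (s.pos w)
    set s1 := ((s'.setN 7 u).setN 8 w).setR 1 d with hs1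
    have hK1 : Keeps [1, 4, 5, 6, 7, 8] [1] [] [] s s1 :=
      ((hK.setN (by simp)).setN (by simp)).setR (by simp)
    have hE1 : Extremes (LongVerts s θ k) s1 :=
      (hsetN (by norm_num) (by norm_num) (by norm_num) (hsetN (by norm_num) (by norm_num)
        (by norm_num) hE) : Extremes (LongVerts s θ k) ((s'.setN 7 u).setN 8 w))
    have ε1 : s1.realReg 0 = s.realReg 0 := hK1.realReg 0 (by simp)
    have r1 : s1.realReg 1 = d := by simp [hs1]
    have n7 : s1.natReg 7 = u := by simp [hs1]
    have n8 : s1.natReg 8 = w := by simp [hs1]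
    have n1 : s1.natReg 1 = k := by simp [hs1, hk1]
    refine Runs.mono (Runs.branch (B := 1) (B' := 17) (fun hb => Runs.skip ?_) fun hb => ?_)
      (by norm_num) fun _ h => h
    · simp only [TestExp.Holds, RealExp.eval, r1, ε1] at hb
      push_cast at hb
      refine ⟨n1, hK1.setN (by simp), hsetN (by omega) (by omega) (by omega) ?_⟩
      have : LongVerts s θ (k + 1) = LongVerts s θ k := by
        ext v
        constructor
        · rintro ⟨j, hj, hj'⟩
          rcases (by omega : j < k ∨ j = k) with h | rfl
          · exact ⟨j, h, hj'⟩
          · exfalso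
            have h1 : |d| < θ := abs_lt.2 ⟨by linarith [hb.2], hb.1⟩
            linarith [hj'.1]
        · rintro ⟨j, hj, hj'⟩
          exact ⟨j, by omega, hj'⟩
      rwa [this]
    · simp only [TestExp.Holds, RealExp.eval, r1, ε1] at hb
      push_cast at hb
      have hlong : θ ≤ |d| := by
        by_contra hc
        rw [not_le, abs_lt] at hc
        exact hb ⟨hc.2, by linarith [hc.1]⟩
      have hset : LongVerts s θ (k + 1) = insert w (insert u (LongVerts s θ k)) := by
        ext v
        constructor
        · rintro ⟨j, hj, hj', hv⟩
          rcases (by omega : j < k ∨ j = k) with h | rfl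
          · exact Or.inr (Or.inr ⟨j, h, hj', hv⟩)
          · rcases hv with hv | hv
            · exact Or.inr (Or.inl hv)
            · exact Or.inl hv
        · rintro (rfl | rfl | ⟨j, hj, hj'⟩)
          · exact ⟨k, by omega, hlong, Or.inr rfl⟩
          · exact ⟨k, by omega, hlong, Or.inl rfl⟩
          · exact ⟨j, by omega, hj'⟩
      refine Runs.mono (Runs.seq (B := 8) (B' := 9) ((runs_considerProg hE1).mono le_rfl ?_))
        le_rfl fun _ h => h
      rintro s2 ⟨k2, hE2⟩
      have n8' : s2.natReg 8 = w := by rw [k2.natReg 8 (by simp), n8]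
      rw [n7] at hE2
      refine Runs.mono (Runs.seq (B := 1) (B' := 8) (Runs.setNat ((runs_considerProg
        (hsetN (by omega) (by omega) (by omega) hE2)).mono le_rfl ?_))) le_rfl fun _ h => h
      rintro s3 ⟨k3, hE3⟩
      simp only [NatExp.eval, n8', RamState.setN_natReg, if_true] at hE3
      refine ⟨?_, ?_, hsetN (by omega) (by omega) (by omega) (by rwa [hset])⟩
      · rw [k3.natReg 1 (by simp), RamState.setN_natReg, if_neg (by omega), k2.natReg 1 (by simp), n1]
      · refine Keeps.setN ⟨fun i hi => ?_, fun i hi => ?_, fun i hi => ?_, fun i hi => ?_⟩ (by simp)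
        · simp only [List.mem_cons, List.not_mem_nil, or_false, not_or] at hi
          rw [k3.natReg i (by simp; tauto), RamState.setN_natReg, if_neg (by tauto),
            k2.natReg i (by simp; tauto), hK1.natReg i (by simp; tauto)]
        · rw [k3.realReg i (by simp), RamState.setN_realReg, k2.realReg i (by simp),
            hK1.realReg i hi]
        · rw [k3.natArr i (by simp), RamState.setN_natArr, k2.natArr i (by simp),
            hK1.natArr i hi]
        · rw [k3.realArr i (by simp), RamState.setN_realArr, k2.realArr i (by simp),
            hK1.realArr i hi]

/-- Follows the parents in array `6` from the vertex in register `5` and records in register `11`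
the position of the first longest edge. -/
def longestProg : RamProg :=
  .seq (.setNat 9 (.reg 5)) (.seq (.setReal 3 (.const (-1))) (.seq (.setNat 11 (.const 0))
    (forLoop 10 (.sub (.arr 5 (.reg 5)) (.const 1))
      (.seq (.setNat 7 (.reg 9)) (.seq (.setNat 8 (.arr 6 (.reg 9))) (.seq shiftProg
        (.seq (.branch (.ltReal (.reg 1) (.const 0)) (.setReal 1 (.sub (.const 0) (.reg 1))) .skip)
          (.seq (.branch (.ltReal (.reg 3) (.reg 1))
              (.seq (.setReal 3 (.reg 1)) (.setNat 11 (.reg 10))) .skip)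
            (.setNat 9 (.reg 8))))))))))

/-- The stored depth is one more than the number of edges of the path. The initial maximum -1 is
below every absolute value, so the first edge is always recorded; afterwards the strict comparison
keeps the first maximum. -/
lemma runs_longestProg {s : RamState} :
    Runs longestProg s ((s.natArr 5 (s.natReg 5) - 1) * 14 + 5) fun s' =>
      Keeps [7, 8, 9, 10, 11] [1, 3] [] [] s s' ∧
      (1 < s.natArr 5 (s.natReg 5) →
        IsFirstLongest (fun j => s.pos ((s.natArr 6)^[j] (s.natReg 5)))
          (s.natArr 5 (s.natReg 5) - 1) (s'.natReg 11)) := by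
  unfold longestProg
  set b := s.natReg 5 with hb
  set p := s.natArr 6 with hp
  set m := s.natArr 5 b - 1 with hm
  set g : ℕ → ℝ := fun j => |shift (s.pos (p^[j] b)) (s.pos (p^[j + 1] b))| with hg
  have hloop := fun (s₁ : RamState) h₁ h₂ h₃ => Runs.forLoop (i := 10)
    (bound := .sub (.arr 5 (.reg 5)) (.const 1)) (s := s₁) (B := 12)
    (P := (.seq (.setNat 7 (.reg 9)) (.seq (.setNat 8 (.arr 6 (.reg 9))) (.seq shiftProg
        (.seq (.branch (.ltReal (.reg 1) (.const 0)) (.setReal 1 (.sub (.const 0) (.reg 1))) .skip)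
          (.seq (.branch (.ltReal (.reg 3) (.reg 1))
              (.seq (.setReal 3 (.reg 1)) (.setNat 11 (.reg 10))) .skip)
            (.setNat 9 (.reg 8))))))))
    (fun k s' => Keeps [7, 8, 9, 10, 11] [1, 3] [] [] s s' ∧ s'.natReg 9 = p^[k] b ∧
      (∀ j < k, g j ≤ s'.realReg 3) ∧ (∀ j < s'.natReg 11, g j < s'.realReg 3) ∧
      ((k = 0 ∧ s'.natReg 11 = 0 ∧ s'.realReg 3 = -1) ∨
        (s'.natReg 11 < k ∧ s'.realReg 3 = g (s'.natReg 11)))) m h₁ h₂ h₃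
  refine Runs.mono (Runs.seq (B := 1) (B' := m * 14 + 4) (Runs.setNat (Runs.mono
    (Runs.seq (B := 1) (B' := m * 14 + 3) (Runs.setReal (Runs.mono
      (Runs.seq (B := 1) (B' := m * 14 + 2) (Runs.setNat (Runs.mono (hloop _ ?_ ?_ ?_)
        le_rfl ?_))) (by omega) fun _ h => h))) (by omega) fun _ h => h))) (by omega) fun _ h => h
  · refine ⟨((((Keeps.refl _ _ _ _ s).setN (by simp)).setR (by simp)).setN (by simp)).setN
      (by simp), ?_⟩
    simp [NatExp.eval, RealExp.eval, hb]
  · rintro k s' - - ⟨hK, -⟩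
    simp only [NatExp.eval, hK.natReg 5 (by simp), hK.natArr 5 (by simp)]
    rfl
  · rintro k s' hk hk1 ⟨hK, h9, hle, hlt, hor⟩
    have e6 : s'.natArr 6 = p := hK.natArr 6 (by simp)
    have hpos : ∀ i v j w, ((s'.setN i v).setN j w).pos = s.pos := fun i v j w =>
      hK.pos (by simp) (by simp)
    refine Runs.mono (Runs.seq (B := 1) (B' := 11) (Runs.setNat (Runs.mono
      (Runs.seq (B := 1) (B' := 10) (Runs.setNat (Runs.mono
        (Runs.seq (B := 4) (B' := 6) (runs_shiftProg ?_)) le_rfl fun _ h => h)))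
        le_rfl fun _ h => h))) le_rfl fun _ h => h
    simp only [NatExp.eval, h9, RamState.setN_natArr, RamState.setN_natReg, hpos, e6]
    norm_num [h9]
    rw [← Function.iterate_succ_apply' p k b]
    set u := p^[k] b
    set w := p^[k + 1] b with hw
    set d := shift (s.pos u) (s.pos w)
    have hgd : g k = |d| := rfl
    set s1 := ((s'.setN 7 u).setN 8 w).setR 1 d with hs1
    have hK1 : Keeps [7, 8, 9, 10, 11] [1, 3] [] [] s s1 :=
      ((hK.setN (by simp)).setN (by simp)).setR (by simp)
    have hA : Runs (.branch (.ltReal (.reg 1) (.const 0))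
        (.setReal 1 (.sub (.const 0) (.reg 1))) .skip) s1 2 fun s2 =>
        Keeps [7, 8, 9, 10, 11] [1, 3] [] [] s s2 ∧ s2.natReg = s1.natReg ∧
          s2.realReg 3 = s1.realReg 3 ∧ s2.realReg 1 = |d| := by
      refine Runs.mono (Runs.branch (B := 1) (B' := 1) (fun hb => Runs.setReal ?_) fun hb =>
        Runs.skip ?_) (by norm_num) fun _ h => h
      · refine ⟨hK1.setR (by simp), rfl, by simp, ?_⟩
        simp only [TestExp.Holds, RealExp.eval, hs1, RamState.setR_realReg, if_true] at hb
        simp only [RealExp.eval, hs1, RamState.setR_realReg, if_true]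
        push_cast at hb ⊢
        rw [abs_of_neg hb]; ring
      · refine ⟨hK1, rfl, rfl, ?_⟩
        simp only [TestExp.Holds, RealExp.eval, hs1, RamState.setR_realReg, if_true] at hb
        simp only [hs1, RamState.setR_realReg, if_true]
        push_cast at hb
        rw [abs_of_nonneg (not_lt.1 hb)]
    refine Runs.mono (Runs.seq (B := 2) (B' := 4) (hA.mono le_rfl ?_)) le_rfl fun _ h => h
    rintro s2 ⟨hK2, hN2, hR3, hR1⟩
    have n10 : s2.natReg 10 = k := by rw [hN2]; simp [hs1, hk1]
    have n8 : s2.natReg 8 = w := by rw [hN2]; simp [hs1]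
    have n11 : s2.natReg 11 = s'.natReg 11 := by rw [hN2]; simp [hs1]
    have r3 : s2.realReg 3 = s'.realReg 3 := by rw [hR3]; simp [hs1]
    refine Runs.mono (Runs.seq (B := 3) (B' := 1) (Runs.mono (Runs.branch (B := 2) (B' := 1)
      (fun hb => Runs.seq (B := 1) (Runs.setReal (Runs.setNat (Runs.setNat ?_))))
      fun hb => Runs.skip (Runs.setNat ?_)) (by norm_num) fun _ h => h)) le_rfl fun _ h => h
    · simp only [TestExp.Holds, RealExp.eval, r3, hR1] at hb
      simp only [NatExp.eval, RealExp.eval, RamState.setN_natReg, RamState.setR_natReg, n10, n8,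
        hR1, RamState.setN_realReg, RamState.setR_realReg]
      norm_num [n10, n8]
      refine ⟨(((hK2.setR (by simp)).setN (by simp)).setN (by simp)).setN (by simp),
        by rw [hw, Function.iterate_succ_apply], ?_, ?_, ?_⟩
      · intro j hj
        rcases (by omega : j < k ∨ j = k) with hj | rfl
        · exact (hle j hj).trans hb.le
        · exact hgd.le
      · intro j hj
        exact (hle j hj).trans_lt hb
      · rw [hgd]
    · simp only [TestExp.Holds, RealExp.eval, r3, hR1] at hb
      simp only [NatExp.eval, RamState.setN_natReg, n10, n8, n11, r3, RamState.setN_realReg]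
      norm_num [n10, n11, n8, r3]
      refine ⟨(hK2.setN (by simp)).setN (by simp),
        by rw [hw, Function.iterate_succ_apply], ?_, hlt, ?_⟩
      · intro j hj
        rcases (by omega : j < k ∨ j = k) with hj | rfl
        · exact hle j hj
        · rw [hgd]; exact not_lt.1 hb
      · rcases hor with ⟨rfl, h1, h2⟩ | ⟨h1, h2⟩
        · rw [h2] at hb
          exact absurd (by linarith [abs_nonneg d] : (-1 : ℝ) < |d|) hb
        · exact ⟨by omega, h2⟩
  · rintro s' ⟨hK, h9, hle, hlt, hor⟩
    refine ⟨hK, fun h1 => ?_⟩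
    rcases hor with ⟨h, -⟩ | ⟨h2, h3⟩
    · omega
    · exact ⟨h2, fun j hj => by rw [h3] at hle; exact hle j hj,
        fun j hj => by rw [h3] at hlt; exact hlt j hj⟩

/-- Marks the vertices of the path whose distance from the position in register `11` is at most the
number in register `12`. -/
def markProg : RamProg :=
  .seq (.setNat 9 (.reg 5)) (forLoop 10 (.arr 5 (.reg 5))
    (.seq (.branch (.conj (.neg (.ltNat (.add (.reg 11) (.reg 12)) (.reg 10)))
        (.neg (.ltNat (.add (.reg 10) (.reg 12)) (.reg 11)))) (.setNatArr 2 (.reg 9) (.const 1))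
        .skip)
      (.setNat 9 (.arr 6 (.reg 9)))))

lemma runs_markProg {s : RamState} (h2 : s.natArr 2 = fun _ => 0) :
    Runs markProg s (s.natArr 5 (s.natReg 5) * 5 + 3) fun s' => ∀ u, s'.natArr 2 u ≠ 0 ↔
      ∃ j < s.natArr 5 (s.natReg 5), (j ≤ s.natReg 11 + s.natReg 12 ∧
        s.natReg 11 ≤ j + s.natReg 12) ∧ u = (s.natArr 6)^[j] (s.natReg 5) := by
  unfold markProg
  set b := s.natReg 5 with hb
  set p := s.natArr 6 with hp
  set m := s.natArr 5 b with hm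
  have hloop := fun (s₁ : RamState) h₁ h₂ h₃ => Runs.forLoop (i := 10)
    (bound := .arr 5 (.reg 5)) (s := s₁) (B := 3)
    (P := (.seq (.branch (.conj (.neg (.ltNat (.add (.reg 11) (.reg 12)) (.reg 10)))
        (.neg (.ltNat (.add (.reg 10) (.reg 12)) (.reg 11)))) (.setNatArr 2 (.reg 9) (.const 1))
        .skip)
      (.setNat 9 (.arr 6 (.reg 9)))))
    (fun k s' => Keeps [9, 10] [] [2] [] s s' ∧ s'.natReg 9 = p^[k] b ∧
      ∀ u, s'.natArr 2 u ≠ 0 ↔ ∃ j < k, (j ≤ s.natReg 11 + s.natReg 12 ∧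
        s.natReg 11 ≤ j + s.natReg 12) ∧ u = p^[j] b) m h₁ h₂ h₃
  refine Runs.mono (Runs.seq (B := 1) (B' := m * 5 + 2) (Runs.setNat (Runs.mono
    (hloop _ ?_ ?_ ?_) le_rfl fun s' h => h.2.2))) (by omega) fun _ h => h
  · refine ⟨((Keeps.refl _ _ _ _ s).setN (by simp)).setN (by simp), ?_⟩
    simp [NatExp.eval, hb, h2]
  · rintro k s' - - ⟨hK, -⟩
    simp only [NatExp.eval, hK.natReg 5 (by simp), hK.natArr 5 (by simp)]
    rfl
  · rintro k s' hk hk1 ⟨hK, h9, hu⟩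
    have e6 : s'.natArr 6 = p := hK.natArr 6 (by simp)
    have e11 : s'.natReg 11 = s.natReg 11 := hK.natReg 11 (by simp)
    have e12 : s'.natReg 12 = s.natReg 12 := hK.natReg 12 (by simp)
    refine Runs.mono (Runs.seq (B := 2) (B' := 1) (Runs.mono (Runs.branch (B := 1) (B' := 1)
      (fun hb => Runs.setNatArr (Runs.setNat ?_))
      fun hb => Runs.skip (Runs.setNat ?_)) (by norm_num) fun _ h => h)) le_rfl fun _ h => h
    · simp only [TestExp.Holds, NatExp.eval, e11, e12, hk1, not_lt] at hb
      simp only [NatExp.eval, RamState.setN_natReg, RamState.setNA_natReg, h9,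
        RamState.setNA_natArr]
      norm_num [e6, h9, hk1]
      refine ⟨((hK.setNA (by simp)).setN (by simp)).setN (by simp), ?_, fun u => ?_⟩
      · rw [← Function.iterate_succ_apply' p k b, Function.iterate_succ_apply]
      · by_cases huk : u = p^[k] b
        · subst huk
          simp only [Function.update_self]
          exact ⟨fun _ => ⟨k, by omega, hb, rfl⟩, fun _ => one_ne_zero⟩
        · rw [Function.update_of_ne huk]
          refine (hu u).trans ⟨?_, ?_⟩
          · rintro ⟨j, hj, hj'⟩; exact ⟨j, by omega, hj'⟩
          · rintro ⟨j, hj, hj', rfl⟩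
            exact ⟨j, lt_of_le_of_ne (by omega) (by rintro rfl; exact huk rfl), hj', rfl⟩
    · simp only [TestExp.Holds, NatExp.eval, e11, e12, hk1, not_lt] at hb
      simp only [NatExp.eval, RamState.setN_natReg, h9]
      norm_num [e6, h9, hk1]
      refine ⟨(hK.setN (by simp)).setN (by simp), ?_, fun u => ?_⟩
      · rw [← Function.iterate_succ_apply' p k b, Function.iterate_succ_apply]
      · refine (hu u).trans ⟨?_, ?_⟩
        · rintro ⟨j, hj, hj'⟩; exact ⟨j, by omega, hj'⟩
        · rintro ⟨j, hj, hj', rfl⟩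
          exact ⟨j, lt_of_le_of_ne (by omega) (by rintro rfl; exact hb hj'), hj', rfl⟩

/-- The root finding program. -/
def rootProg : RamProg :=
  .branch (.ltNat (.reg 0) (.const 2)) (.setNatArr 2 (.const 0) (.const 1))
    (.seq radiusProg (.seq (propagateProg 3 4 2 (.const 0)) (.seq extremesProg
      (.branch (.ltNat (.const 0) (.reg 6))
        (.seq (propagateProg 5 6 3 (.reg 4)) (.seq longestProg markProg)) .skip))))

/-! ### Paths read off from the parent array -/

section Reached

variable {s s' : RamState} {src : ℕ} {D p : ℕ → ℕ} {f : ℕ → ℝ}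

lemma SameInput.edge (h : SameInput s s') : s'.Edge = s.Edge := by
  funext m u w; simp only [RamState.Edge, h.src, h.tgt]

lemma SameInput.within (h : SameInput s s') (src : ℕ) : ∀ r v, Within s' src r v ↔ Within s src r v
  | 0, _ => Iff.rfl
  | r + 1, v => by simp only [Within, SameInput.within h src r, h.edge, h.size]

lemma Reached.of_sameInput (h : SameInput s s') (hr : Reached s' src D p f) :
    Reached s src D p f := by
  obtain ⟨h1, h2, h3⟩ := hr
  rw [h.edge, h.size, h.pos] at h3
  rw [h.fst] at h2
  exact ⟨h1, h2, h3⟩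

lemma Keeps.sameInput {Nr Rr Na Ra : List ℕ} (h : Keeps Nr Rr Na Ra s s') (h1 : 0 ∉ Nr)
    (h2 : 0 ∉ Rr) (h3 : 0 ∉ Na) (h4 : 1 ∉ Na) (h5 : 0 ∉ Ra) (h6 : 1 ∉ Ra) : SameInput s s' :=
  ⟨h.natReg 0 h1, h.realReg 0 h2, h.natArr 0 h3, h.natArr 1 h4, h.realArr 0 h5, h.realArr 1 h6⟩

lemma PropFrame.sameInput {dA pA lA : ℕ} (h : PropFrame dA pA lA s s') (h1 : 2 ≤ dA) (h2 : 2 ≤ pA)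
    (h3 : 2 ≤ lA) : SameInput s s' :=
  ⟨h.natReg 0 (by omega) (by omega) (by omega) (by omega), h.realReg 0 (by omega),
    h.natArr 0 (by omega) (by omega), h.natArr 1 (by omega) (by omega), h.realArr 0 (by omega),
    h.realArr 1 (by omega)⟩

lemma SameInput.trans {s'' : RamState} (h : SameInput s s') (h' : SameInput s' s'') :
    SameInput s s'' :=
  ⟨h'.size.trans h.size, h'.eps.trans h.eps, h'.src.trans h.src, h'.tgt.trans h.tgt,
    h'.fst.trans h.fst, h'.snd.trans h.snd⟩

/-- The depth drops by one at each parent, and the source, with stored value 1, cannot be met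
earlier. All facts about the path to the source follow from this. -/
lemma Reached.depth_iterate (h : Reached s src D p f) {v : ℕ} :
    ∀ k < D v, D (p^[k] v) = D v - k
  | 0, _ => rfl
  | k + 1, hk => by
    have ih := h.depth_iterate (v := v) k (by omega)
    rcases h.parent (p^[k] v) (by omega) with h1 | ⟨-, -, h3, -⟩
    · rw [h1, h.depth_src] at ih; omega
    · rw [Function.iterate_succ_apply']; omega

lemma Reached.edge_iterate (h : Reached s src D p f) {v k : ℕ} (hk : k < D v - 1) :
    s.Edge (s.natReg 0 - 1) (p^[k + 1] v) (p^[k] v) := by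
  have h1 := h.depth_iterate (v := v) k (by omega)
  rcases h.parent (p^[k] v) (by omega) with h2 | ⟨h2, -⟩
  · rw [h2, h.depth_src] at h1; omega
  · rwa [Function.iterate_succ_apply']

lemma Reached.iterate_eq_src (h : Reached s src D p f) {v : ℕ} (hv : D v ≠ 0) :
    p^[D v - 1] v = src := by
  have h1 := h.depth_iterate (v := v) (D v - 1) (by omega)
  rcases h.parent (p^[D v - 1] v) (by omega) with h2 | ⟨-, h2, h3, -⟩
  · exact h2
  · omega

lemma Reached.injOn_iterate (h : Reached s src D p f) {v : ℕ} :
    Set.InjOn (fun k => p^[k] v) {k | k < D v} := by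
  intro i hi j hj hij
  have h1 := h.depth_iterate (v := v) i hi
  have h2 := h.depth_iterate (v := v) j hj
  simp only at hij
  simp only [Set.mem_ofPred_eq] at hi hj
  rw [hij] at h1
  omega

lemma Reached.iterate_lt (h : Reached s src D p f)
    (he : ∀ u w, s.Edge (s.natReg 0 - 1) u w → u < s.natReg 0) {v : ℕ} (hv : v < s.natReg 0) :
    ∀ k < D v, p^[k] v < s.natReg 0
  | 0, _ => hv
  | _ + 1, hk => he _ _ (h.edge_iterate (by omega))

/-- Pigeonhole: the vertices on the way to the source have different depths and are indices below
the number of vertices. This bounds the running time of the last two loops. -/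
lemma Reached.depth_le (h : Reached s src D p f)
    (he : ∀ u w, s.Edge (s.natReg 0 - 1) u w → u < s.natReg 0) {v : ℕ} (hv : v < s.natReg 0) :
    D v ≤ s.natReg 0 := by
  have h1 : (Finset.range (D v)).card ≤ (Finset.range (s.natReg 0)).card := by
    refine Finset.card_le_card_of_injOn (fun k => p^[k] v) ?_ ?_
    · intro k hk
      simpa using h.iterate_lt he hv k (by simpa using hk)
    · intro i hi j hj hij
      exact h.injOn_iterate (by simpa using hi) (by simpa using hj) hij
  simpa using h1

end Reached

/-- What the program leaves in memory when there are at least two vertices. -/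
def RootOutput (s : RamState) (R : ℕ) (s' : RamState) : Prop :=
  (LongVerts s (s.realReg 0 / 8) (s.natReg 0 - 1) = ∅ ∧ ∀ u, s'.natArr 2 u = 0) ∨
  ∃ (D p : ℕ → ℕ) (f : ℕ → ℝ) (D' p' : ℕ → ℕ) (f' : ℕ → ℝ) (a b i : ℕ),
    Reached s 0 D p f ∧ (∀ v < s.natReg 0, D v ≠ 0) ∧
    a ∈ LongVerts s (s.realReg 0 / 8) (s.natReg 0 - 1) ∧
    b ∈ LongVerts s (s.realReg 0 / 8) (s.natReg 0 - 1) ∧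
    (∀ v ∈ LongVerts s (s.realReg 0 / 8) (s.natReg 0 - 1),
      KeyLE f (s.realArr 1) a v ∧ KeyLE f (s.realArr 1) v b) ∧
    Reached s a D' p' f' ∧ (∀ v < s.natReg 0, D' v ≠ 0) ∧
    (1 < D' b → IsFirstLongest (fun j => s.pos (p'^[j] b)) (D' b - 1) i) ∧
    ∀ u, s'.natArr 2 u ≠ 0 ↔ ∃ j < D' b, (j ≤ i + R ∧ i ≤ j + R) ∧ u = p'^[j] b

lemma rootProg_bound (K : ℕ) {n : ℕ} (hn : 2 ≤ n) :
    max 1 (3 * K + 5 + (2 + (2 * n * ((n - 1) * 24 + 4) + 2) + ((n - 1) * 26 + 2 +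
      (max (2 + (2 * n * ((n - 1) * 24 + 4) + 2) + (n * 14 + 5 + (n * 5 + 3))) 1 + 1)))) + 1 ≤
      3 * K + 300 * n ^ 2 := by
  obtain ⟨m, rfl⟩ : ∃ m, n = m + 2 := ⟨n - 2, by omega⟩
  have e : m + 2 - 1 = m + 1 := by omega
  rw [e]
  have : ∀ a, max (2 + a) 1 = 2 + a := fun a => by omega
  simp only [add_assoc] at *
  rw [this, max_eq_right (by omega)]
  nlinarith

lemma runs_rootProg {s : RamState} (hn : 2 ≤ s.natReg 0) (hε : 0 < s.realReg 0)
    (h3 : s.natReg 3 = 0) (h6 : s.natReg 6 = 0) (hA2 : s.natArr 2 = fun _ => 0)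
    (hA3 : s.natArr 3 = fun _ => 0) (hA5 : s.natArr 5 = fun _ => 0)
    (hcon : ∀ u < s.natReg 0, ∀ v < s.natReg 0, Within s u (2 * s.natReg 0) v)
    (he : ∀ u w, s.Edge (s.natReg 0 - 1) u w → u < s.natReg 0) :
    Runs rootProg s (3 * factorialInv (s.realReg 0) + 300 * s.natReg 0 ^ 2)
      (RootOutput s (8 * factorialInv (s.realReg 0))) := by
  set n := s.natReg 0 with hndef
  set K := factorialInv (s.realReg 0) with hK
  have hLV : ∀ u ∈ LongVerts s (s.realReg 0 / 8) (n - 1), u < n := by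
    rintro u ⟨j, hj, -, rfl | rfl⟩
    · exact he _ _ ⟨j, hj, Or.inl ⟨rfl, rfl⟩⟩
    · exact he _ _ ⟨j, hj, Or.inr ⟨rfl, rfl⟩⟩
  set P := 2 + (2 * n * ((n - 1) * 24 + 4) + 2) with hP
  have hbound : max 1 (3 * K + 5 + (P + ((n - 1) * 26 + 2 +
      (max (P + (n * 14 + 5 + (n * 5 + 3))) 1 + 1)))) + 1 ≤ 3 * K + 300 * n ^ 2 := by
    rw [hP]
    exact rootProg_bound K hn
  unfold rootProg
  refine Runs.mono (Runs.branch (B := 1) (fun hb => ?_) fun hb => ?_) hbound fun _ h => h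
  · simp only [TestExp.Holds, NatExp.eval] at hb
    omega
  refine Runs.seq ((runs_radiusProg hε h3).mono le_rfl ?_)
  rintro s1 ⟨k1, r1⟩
  have i1 : SameInput s s1 := k1.sameInput (by simp) (by simp) (by simp) (by simp) (by simp)
    (by simp)
  have hprop1 := runs_propagateProg (dA := 3) (pA := 4) (lA := 2) (s := s1) (src := .const 0)
    (by omega) (by omega) (by omega) (by omega) (fun _ _ => rfl)
    (by rw [k1.natArr 3 (by simp), hA3])
  rw [i1.size] at hprop1
  refine Runs.seq (hprop1.mono le_rfl ?_)
  rintro s2 ⟨⟨fr2, re2⟩, all2⟩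
  have i2 : SameInput s s2 := i1.trans (fr2.sameInput (by omega) (by omega) (by omega))
  have hext := runs_extremesProg (s := s2) (by
    rw [fr2.natReg 6 (by omega) (by omega) (by omega) (by omega), k1.natReg 6 (by simp), h6])
  rw [i2.size, i2.eps] at hext
  have hLV2 : LongVerts s2 (s.realReg 0 / 8) (n - 1) = LongVerts s (s.realReg 0 / 8) (n - 1) := by
    simp only [LongVerts, i2.pos, i2.src, i2.tgt]
  rw [hLV2] at hext
  refine Runs.seq (hext.mono le_rfl ?_)
  rintro s3 ⟨k3, ex3⟩
  have i3 : SameInput s s3 := i2.trans (k3.sameInput (by simp) (by simp) (by simp) (by simp)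
    (by simp) (by simp))
  have m3 : s3.natArr 2 = fun _ => 0 := by
    rw [k3.natArr 2 (by simp), fr2.natArr 2 (by omega) (by omega), k1.natArr 2 (by simp), hA2]
  refine Runs.branch (fun hb => ?_) fun hb => Runs.skip ?_
  · simp only [TestExp.Holds, NatExp.eval] at hb
    rcases ex3 with ⟨ex3, -⟩ | ⟨-, ha, hb', hab⟩
    · omega
    set a := s3.natReg 4 with hadef
    set b := s3.natReg 5 with hbdef
    have hprop2 := runs_propagateProg (dA := 5) (pA := 6) (lA := 3) (s := s3) (src := .reg 4)
      (by omega) (by omega) (by omega) (by omega) (fun s' h => by simp [NatExp.eval, h])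
      (by rw [k3.natArr 5 (by simp), fr2.natArr 5 (by omega) (by omega), k1.natArr 5 (by simp), hA5])
    rw [i3.size] at hprop2
    refine Runs.seq (hprop2.mono le_rfl ?_)
    rintro s4 ⟨⟨fr4, re4⟩, all4⟩
    have i4 : SameInput s s4 := i3.trans (fr4.sameInput (by omega) (by omega) (by omega))
    have b4 : s4.natReg 5 = b := fr4.natReg 5 (by omega) (by omega) (by omega) (by omega)
    have R4 : Reached s a (s4.natArr 5) (s4.natArr 6) (s4.realArr 3) := re4.of_sameInput i3
    have hdepth : s4.natArr 5 b ≤ n := R4.depth_le he (hLV b hb')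
    have hlong := runs_longestProg (s := s4)
    rw [b4] at hlong
    refine Runs.seq (hlong.mono (by omega) ?_)
    rintro s5 ⟨k5, first5⟩
    have hmark := runs_markProg (s := s5) (by
      rw [k5.natArr 2 (by simp), fr4.natArr 2 (by omega) (by omega), m3])
    have e5 : s5.natArr 5 = s4.natArr 5 := k5.natArr 5 (by simp)
    have e6 : s5.natArr 6 = s4.natArr 6 := k5.natArr 6 (by simp)
    have b5 : s5.natReg 5 = b := by rw [k5.natReg 5 (by simp), b4]
    have r5 : s5.natReg 12 = 8 * K := by
      rw [k5.natReg 12 (by simp), fr4.natReg 12 (by omega) (by omega) (by omega) (by omega),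
        k3.natReg 12 (by simp), fr2.natReg 12 (by omega) (by omega) (by omega) (by omega), r1]
    rw [e5, e6, b5, r5] at hmark
    refine hmark.mono (by omega) fun s6 h6 => Or.inr ?_
    refine ⟨s2.natArr 3, s2.natArr 4, s2.realArr 2, s4.natArr 5, s4.natArr 6, s4.realArr 3, a, b,
      s5.natReg 11, re2.of_sameInput i1, ?_, ha, hb', ?_, R4, ?_, ?_, h6⟩
    · intro v hv
      exact all2 v ((i1.within _ _ _).2 (hcon 0 (by omega) v hv))
    · rw [k3.realArr 2 (by simp), k3.realArr 1 (by simp), i2.snd] at hab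
      exact hab
    · intro v hv
      exact all4 v ((i3.within _ _ _).2 (hcon a (hLV a ha) v hv))
    · rw [i4.pos] at first5
      exact first5
  · simp only [TestExp.Holds, NatExp.eval] at hb
    rcases ex3 with ⟨-, ex3⟩ | ⟨hc, -⟩
    · exact Or.inl ⟨ex3, fun u => by rw [m3]⟩
    · omega

/-! ### Correctness on valid trees -/

/-- The confidence set. -/
noncomputable def confidenceSet (ε : ℝ) (T : EmbeddedTree) : Finset Pt :=
  open Classical in
  if h : ∃ S, T.Selects (ε / 8) (8 * factorialInv ε) S then h.choose else ∅

/-- Lifts are assigned in order of arrival. Every edge joins a vertex to its parent, so no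
compatibility condition arises. -/
lemma exists_isLift {n : ℕ} {x : Fin n → Pt} {p : Fin n → Fin n} (hx : Function.Injective x)
    (hp : ∀ j : Fin n, 0 < j.val → p j < j) : ∃ φ, (unlabel x p).IsLift φ := by
  classical
  have key : ∀ m ≤ n, ∃ g : Fin n → ℝ,
      (∀ j : Fin n, j.val < m → 0 < j.val → g j = g (p j) + shift (x (p j)) (x j)) ∧
      ∀ j : Fin n, j.val < m → ∃ k : ℤ, g j = (x j).1 + k := by
    intro m
    induction m with
    | zero => exact fun _ => ⟨fun _ => 0, fun j hj => by omega, fun j hj => by omega⟩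
    | succ m ih =>
      intro hm
      obtain ⟨g, hg, hg'⟩ := ih (by omega)
      set M : Fin n := ⟨m, hm⟩ with hM
      have hne : ∀ j : Fin n, j.val < m → j ≠ M := by
        rintro j hj rfl; simp [hM] at hj
      have hpm : ∀ j : Fin n, j.val < m + 1 → 0 < j.val → (p j).val < m := by
        intro j hj h0
        have := hp j h0
        rw [Fin.lt_def] at this
        omega
      refine ⟨Function.update g M (if 0 < m then g (p M) + shift (x (p M)) (x M) else (x M).1),
        fun j hj h0 => ?_, fun j hj => ?_⟩
      · rw [Function.update_of_ne (hne _ (hpm j hj h0))]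
        rcases (by omega : j.val < m ∨ j.val = m) with h | h
        · rw [Function.update_of_ne (hne j h), hg j h h0]
        · obtain rfl : j = M := Fin.ext h
          rw [Function.update_self, if_pos (by omega)]
      · rcases (by omega : j.val < m ∨ j.val = m) with h | h
        · rw [Function.update_of_ne (hne j h)]; exact hg' j h
        · obtain rfl : j = M := Fin.ext h
          rw [Function.update_self]
          split_ifs with h0
          · obtain ⟨k, hk⟩ := hg' (p M) (hpm M hj (by rwa [h]))
            obtain ⟨l, hl⟩ := shift_int (x (p M)) (x M)
            exact ⟨k + l, by rw [hk, hl]; push_cast; ring⟩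
          · exact ⟨0, by simp⟩
  obtain ⟨g, hg, hg'⟩ := key n le_rfl
  refine ⟨Function.extend x g 0, ?_, ?_⟩
  · intro u v huv
    obtain ⟨j, h0, ⟨rfl, rfl⟩ | ⟨rfl, rfl⟩⟩ := mem_edges_unlabel.1 huv
    · rw [hx.extend_apply, hx.extend_apply, hg j j.isLt h0, shift_symm]; ring
    · rw [hx.extend_apply, hx.extend_apply, hg j j.isLt h0]
  · intro u hu
    obtain ⟨i, rfl⟩ := mem_verts_unlabel.1 hu
    rw [hx.extend_apply]
    exact hg' i i.isLt

lemma exists_presentation {n : ℕ} {x : Fin n → Pt} {p : Fin n → Fin n}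
    (hx : Function.Injective x) :
    ∃ e : Fin (n - 1) → Fin n × Fin n, IsPresentation (unlabel x p) x e := by
  have hlt : ∀ j : Fin (n - 1), j.val + 1 < n := fun j => by omega
  refine ⟨fun j => (⟨j.val + 1, hlt j⟩, p ⟨j.val + 1, hlt j⟩), hx, rfl, ?_⟩
  ext z
  simp only [unlabel, Finset.mem_image, Finset.mem_filter, Finset.mem_univ, true_and]
  constructor
  · rintro ⟨j, h0, rfl⟩
    refine ⟨⟨j.val - 1, by omega⟩, ?_⟩
    have : (⟨j.val - 1 + 1, by omega⟩ : Fin n) = j := Fin.ext (by simp only; omega)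
    simp only [this]
  · rintro ⟨j, rfl⟩
    exact ⟨⟨j.val + 1, hlt j⟩, by simp, rfl⟩

lemma Within.mono {s : RamState} {src r r' v : ℕ} (h : Within s src r v) (hr : r ≤ r') :
    Within s src r' v := by
  induction hr with
  | refl => exact h
  | step _ ih => exact Or.inl ih

section Presented

variable {n : ℕ} {x : Fin n → Pt} {p : Fin n → Fin n} {v : Fin n → Pt}
  {e : Fin (n - 1) → Fin n × Fin n} {ε : ℝ}

lemma initState_pos (i : Fin n) : (initState ε v e).pos i = v i := by
  simp [RamState.pos, initState]

lemma initState_edge (hpres : IsPresentation (unlabel x p) v e) {u w : ℕ} :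
    (initState ε v e).Edge (n - 1) u w ↔
      ∃ i j : Fin n, u = i ∧ w = j ∧ s(v i, v j) ∈ (unlabel x p).edges := by
  obtain ⟨hv, -, hE⟩ := hpres
  rw [hE]
  simp only [RamState.Edge, initState, Finset.mem_image, Finset.mem_univ, true_and, Sym2.eq_iff]
  constructor
  · rintro ⟨j, hj, ⟨h1, h2⟩ | ⟨h1, h2⟩⟩
    · simp [hj] at h1 h2
      exact ⟨_, _, h1.symm, h2.symm, ⟨j, hj⟩, Or.inl ⟨rfl, rfl⟩⟩
    · simp [hj] at h1 h2
      exact ⟨_, _, h2.symm, h1.symm, ⟨j, hj⟩, Or.inr ⟨rfl, rfl⟩⟩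
  · rintro ⟨i, j, rfl, rfl, l, ⟨h1, h2⟩ | ⟨h1, h2⟩⟩
    · refine ⟨l, l.isLt, Or.inl ?_⟩
      simp [hv h1, hv h2]
    · refine ⟨l, l.isLt, Or.inr ?_⟩
      simp [hv h1, hv h2]

/-- From `u` the labels decrease along parents to the root, and the same route is taken backwards to
`w`. Each half has fewer than `n` steps, which is why 2n passes suffice. Here `σ` translates arrival
labels into list indices. -/
lemma initState_within (hp : ∀ j : Fin n, 0 < j.val → p j < j)
    (hpres : IsPresentation (unlabel x p) v e) (u w : Fin n) :
    Within (initState ε v e) u (2 * n) w := by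
  have hmem : ∀ j, ∃ i, v i = x j := by
    intro j
    have : x j ∈ (unlabel x p).verts := mem_verts_unlabel.2 ⟨j, rfl⟩
    rw [hpres.2.1] at this
    simpa using this
  choose σ hσ using hmem
  have hsurj : ∀ i, ∃ j, σ j = i := by
    intro i
    have : v i ∈ (unlabel x p).verts := by rw [hpres.2.1]; simp
    obtain ⟨j, hj⟩ := mem_verts_unlabel.1 this
    exact ⟨j, hpres.1 (by rw [hσ, hj])⟩
  have hn : 0 < n := u.pos
  have hedge : ∀ j : Fin n, 0 < j.val →
      (initState ε v e).Edge (n - 1) (σ j) (σ (p j)) ∧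
      (initState ε v e).Edge (n - 1) (σ (p j)) (σ j) := by
    intro j h0
    rw [initState_edge hpres, initState_edge hpres]
    refine ⟨⟨_, _, rfl, rfl, ?_⟩, ⟨_, _, rfl, rfl, ?_⟩⟩ <;> rw [hσ, hσ, mem_edges_unlabel]
    · exact ⟨j, h0, Or.inl ⟨rfl, rfl⟩⟩
    · exact ⟨j, h0, Or.inr ⟨rfl, rfl⟩⟩
  have hup : ∀ m r (j : Fin n), j.val = m → Within (initState ε v e) u r (σ j) →
      Within (initState ε v e) u (r + m) (σ ⟨0, hn⟩) := by
    intro m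
    induction m using Nat.strong_induction_on with
    | _ m ih =>
      intro r j hj h
      rcases Nat.eq_zero_or_pos j.val with h0 | h0
      · rw [show (⟨0, hn⟩ : Fin n) = j from Fin.ext h0.symm]; exact h.mono (by omega)
      · have hlt := hp j h0
        rw [Fin.lt_def] at hlt
        refine (ih (p j).val (by omega) (r + 1) (p j) rfl
          (Or.inr ⟨_, h, (hedge j h0).1⟩)).mono (by omega)
  have hdown : ∀ m r (j : Fin n), j.val = m → Within (initState ε v e) u r (σ ⟨0, hn⟩) →
      Within (initState ε v e) u (r + m) (σ j) := by
    intro m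
    induction m using Nat.strong_induction_on with
    | _ m ih =>
      intro r j hj h
      rcases Nat.eq_zero_or_pos j.val with h0 | h0
      · rw [show j = (⟨0, hn⟩ : Fin n) from Fin.ext h0]; exact h.mono (by omega)
      · have hlt := hp j h0
        rw [Fin.lt_def] at hlt
        have h1 := ih (p j).val (by omega) r (p j) rfl h
        have h2 : Within (initState ε v e) u (r + (p j).val + 1) (σ j) :=
          Or.inr ⟨_, h1, (hedge j h0).2⟩
        exact h2.mono (by omega)
  obtain ⟨ju, hju⟩ := hsurj u
  obtain ⟨jw, hjw⟩ := hsurj w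
  have h1 : Within (initState ε v e) u 0 (σ ju) := by rw [hju]; rfl
  have h2 := hdown _ _ jw rfl (hup _ _ ju rfl h1)
  rw [hjw] at h2
  exact h2.mono (by omega)

lemma initState_isLong {θ : ℝ} (hpres : IsPresentation (unlabel x p) v e) (u : Fin n) :
    u.val ∈ LongVerts (initState ε v e) θ (n - 1) ↔ (unlabel x p).IsLong θ (v u) := by
  have hE : ∀ {a b : ℕ}, _ := fun {a b} => initState_edge (ε := ε) (u := a) (w := b) hpres
  constructor
  · rintro ⟨j, hj, hθ, hu⟩
    obtain ⟨a, b, ha, hb, hab⟩ := hE.1 ⟨j, hj, Or.inl ⟨rfl, rfl⟩⟩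
    rw [ha, hb, initState_pos, initState_pos] at hθ
    rw [ha, hb] at hu
    rcases hu with hu | hu
    · rw [Fin.ext hu]; exact ⟨_, hab, hθ⟩
    · rw [Fin.ext hu]
      exact ⟨v a, by rwa [Sym2.eq_swap], by rwa [shift_symm, abs_neg]⟩
  · rintro ⟨z, hz, hθ⟩
    obtain ⟨k, hk⟩ := right_mem_of_edge hz
    have : z ∈ (unlabel x p).verts := mem_verts_unlabel.2 ⟨k, hk⟩
    rw [hpres.2.1] at this
    obtain ⟨w, -, rfl⟩ := Finset.mem_image.1 this
    obtain ⟨j, hj, ⟨h1, h2⟩ | ⟨h1, h2⟩⟩ := hE.2 ⟨u, w, rfl, rfl, hz⟩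
    · exact ⟨j, hj, by rwa [h1, h2, initState_pos, initState_pos], Or.inl h1.symm⟩
    · exact ⟨j, hj, by rwa [h1, h2, initState_pos, initState_pos, shift_symm, abs_neg],
        Or.inr h2.symm⟩

/-- The program returns a set that the selection rule selects. -/
theorem exists_exec_selects (hε : 0 < ε) (hn : 0 < n) (hx : Function.Injective x)
    (hp : ∀ j : Fin n, 0 < j.val → p j < j) (hpres : IsPresentation (unlabel x p) v e) :
    Runs rootProg (initState ε v e) (3 * factorialInv ε + 300 * n ^ 2) fun s =>
      (unlabel x p).Selects (ε / 8) (8 * factorialInv ε) (returned v s) := by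
  classical
  have hcard : (unlabel x p).verts.card = n := card_verts_unlabel hx
  rcases (by omega : n = 1 ∨ 2 ≤ n) with rfl | hn2
  · have : Runs rootProg (initState ε v e) (1 + 1) fun s =>
        (unlabel x p).Selects (ε / 8) (8 * factorialInv ε) (returned v s) := by
      unfold rootProg
      refine ⟨_, _, .branchTrue ?_ (.setNatArr _ _ _ _), le_rfl, Or.inl ⟨hcard, ?_⟩⟩
      · simp [TestExp.Holds, NatExp.eval, initState]
      · rw [hpres.2.1]
        unfold returned
        congr 1
    exact this.mono (by omega) fun _ h => h
  set s := initState ε v e with hs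
  have hs0 : s.natReg 0 = n := by simp [hs, initState]
  have hsε : s.realReg 0 = ε := by simp [hs, initState]
  have hrun := runs_rootProg (s := s) (by omega) (by rwa [hsε]) (by simp [hs, initState])
    (by simp [hs, initState]) (by funext j; simp [hs, initState])
    (by funext j; simp [hs, initState]) (by funext j; simp [hs, initState])
    (fun u hu w hw => by
      rw [hs0] at hu hw ⊢
      exact initState_within hp hpres ⟨u, hu⟩ ⟨w, hw⟩)
    (fun u w h => by
      rw [hs0] at h ⊢
      obtain ⟨i, j, rfl, -⟩ := (initState_edge hpres).1 h
      exact i.isLt)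
  rw [hs0, hsε] at hrun
  refine hrun.mono le_rfl fun s' hout => ?_
  have hlongv : ∀ z, (unlabel x p).IsLong (ε / 8) z → ∃ u : Fin n, v u = z ∧
      u.val ∈ LongVerts s (ε / 8) (n - 1) := by
    intro z hz
    obtain ⟨k, rfl⟩ := IsLong.exists_label hz
    have : x k ∈ (unlabel x p).verts := mem_verts_unlabel.2 ⟨k, rfl⟩
    rw [hpres.2.1] at this
    obtain ⟨u, -, hu⟩ := Finset.mem_image.1 this
    rw [← hu] at hz
    exact ⟨u, hu, (initState_isLong hpres u).2 hz⟩
  have hpos : ∀ i : Fin n, s.pos i = v i := initState_pos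
  rw [RootOutput, hs0, hsε] at hout
  rcases hout with ⟨hnone, hzero⟩ | ⟨D, q, f, D', q', f', a, b, i, hR, hD, ha, hb, hab, hR', hD',
    hfirst, hmark⟩
  · refine Or.inr (Or.inl ⟨by omega, fun z hz => ?_, ?_⟩)
    · obtain ⟨u, -, hu⟩ := hlongv z hz
      rw [hnone] at hu
      exact hu
    · unfold returned
      rw [Finset.image_eq_empty, Finset.filter_eq_empty_iff]
      intro i _ h
      exact h (hzero i)
  have hlt : ∀ u ∈ LongVerts s (ε / 8) (n - 1), u < n := by
    rintro u ⟨j, hj, -, hu⟩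
    obtain ⟨i1, i2, e1, e2, -⟩ := (initState_edge (ε := ε) hpres).1 ⟨j, hj, Or.inl ⟨rfl, rfl⟩⟩
    rcases hu with rfl | rfl
    · rw [hs, e1]; exact i1.isLt
    · rw [hs, e2]; exact i2.isLt
  obtain ⟨A, rfl⟩ : ∃ A : Fin n, A.val = a := ⟨⟨a, hlt a ha⟩, rfl⟩
  obtain ⟨B, rfl⟩ : ∃ B : Fin n, B.val = b := ⟨⟨b, hlt b hb⟩, rfl⟩
  obtain ⟨ψ, hψ⟩ := exists_isLift hx hp
  -- The stored lifts are only known to be consistent along stored parents. Comparison with an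
  -- abstract lift `ψ` shows that they differ from it by a constant, and this gives consistency
  -- along every edge.
  have hfψ : ∀ m (u : Fin n), D u = m → f u - ψ (v u) = f 0 - ψ (v ⟨0, hn⟩) := by
    intro m
    induction m using Nat.strong_induction_on with
    | _ m ih =>
      intro u hu
      rcases hR.parent u (hD u u.isLt) with h0 | ⟨h1, h2, h3, h4⟩
      · have : u = ⟨0, hn⟩ := Fin.ext h0
        rw [h0, this]
      · rw [hs0, hs, initState_edge hpres] at h1
        obtain ⟨i1, i2, e1, e2, hE⟩ := h1
        obtain rfl : u = i2 := Fin.ext e2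
        rw [h4, hψ.edge _ _ hE, ← ih (D i1) (by rw [e1] at h3; omega) i1 rfl, e1, hpos, hpos]
        ring
  have hv := hpres.1
  set φ : Pt → ℝ := Function.extend v (fun i : Fin n => f i) 0 with hφ
  have hφv : ∀ i : Fin n, φ (v i) = f i := fun i => hv.extend_apply _ _ i
  have hverts : ∀ z ∈ (unlabel x p).verts, ∃ i : Fin n, v i = z := by
    intro z hz
    rw [hpres.2.1] at hz
    simpa using hz
  have hfψ' : ∀ z ∈ (unlabel x p).verts, φ z = ψ z + (f 0 - ψ (v ⟨0, hn⟩)) := by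
    intro z hz
    obtain ⟨i, rfl⟩ := hverts z hz
    rw [hφv, ← hfψ _ i rfl]; ring
  have hlift : (unlabel x p).IsLift φ := by
    constructor
    · intro u w huw
      rw [hfψ' u (mem_verts_unlabel.2 (left_mem_of_edge huw)),
        hfψ' w (mem_verts_unlabel.2 (right_mem_of_edge huw)), hψ.edge u w huw]
      ring
    · intro z hz
      obtain ⟨k, hk⟩ := hψ.int z hz
      obtain ⟨l, hl⟩ := hψ.int (v ⟨0, hn⟩) (by rw [hpres.2.1]; simp)
      have h0 : f 0 = (v ⟨0, hn⟩).1 := by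
        rw [hR.lift_src, ← hpos ⟨0, hn⟩]; rfl
      exact ⟨k - l, by rw [hfψ' z hz, hk, hl, h0]; push_cast; ring⟩
  have hbefore : ∀ u w : Fin n, KeyLE f (s.realArr 1) u w → Before φ (v u) (v w) := by
    intro u w h
    have e1 : ∀ i : Fin n, s.realArr 1 i = (v i).2 := fun i => by rw [← hpos i]; rfl
    unfold KeyLE at h
    rw [e1, e1, ← hφv, ← hφv] at h
    exact h
  have hext : ∀ z, (unlabel x p).IsLong (ε / 8) z → Before φ (v A) z ∧ Before φ z (v B) := by
    intro z hz
    obtain ⟨u, rfl, hu⟩ := hlongv z hz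
    exact ⟨hbefore _ _ (hab u hu).1, hbefore _ _ (hab u hu).2⟩
  have hlA : (unlabel x p).IsLong (ε / 8) (v A) := (initState_isLong hpres A).1 ha
  have hlB : (unlabel x p).IsLong (ε / 8) (v B) := (initState_isLong hpres B).1 hb
  have hle : ∀ {y z}, Before φ y z → φ y ≤ φ z := by
    rintro y z (h | ⟨h, -⟩)
    · exact h.le
    · exact h.le
  have hDB := hD' B B.isLt
  -- If the extremes coincided, all endpoints of long edges would have the same lift, whereas a long
  -- edge displaces by at least ε/8 > 0.
  have h1D : 1 < D' B := by
    by_contra hc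
    have h1 : D' B - 1 = 0 := by omega
    have h2 := hR'.iterate_eq_src hDB
    rw [h1] at h2
    have h3 : B = A := Fin.ext h2
    rw [h3] at hext
    have hconst : ∀ z, (unlabel x p).IsLong (ε / 8) z → φ z = φ (v A) := fun z hz =>
      le_antisymm (hle (hext z hz).2) (hle (hext z hz).1)
    obtain ⟨z, hz, hθ⟩ := hlA
    have hz' : (unlabel x p).IsLong (ε / 8) z :=
      ⟨v A, by rwa [Sym2.eq_swap], by rwa [shift_symm, abs_neg]⟩
    have h4 := hlift.edge _ _ hz
    rw [hconst z hz'] at h4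
    have h5 : shift (v A) z = 0 := by linarith
    rw [h5, abs_zero] at hθ
    linarith
  have hiter : ∀ j < D' B, q'^[j] B.val < n := by
    have := hR'.iterate_lt (fun u w h => by
      rw [hs0] at h ⊢
      obtain ⟨i1, -, rfl, -⟩ := (initState_edge hpres).1 h
      exact i1.isLt) (v := B.val) B.isLt
    rwa [hs0] at this
  refine Or.inr (Or.inr ⟨by omega, φ, v A, v B, fun j => s.pos (q'^[j] B.val), D' B - 1, i, hlift,
    hlA, hlB, hext, ⟨hpos B, ?_, ?_, ?_⟩, hfirst h1D, ?_⟩)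
  · rw [hR'.iterate_eq_src hDB, hpos]
  · intro j hj
    have := hR'.edge_iterate hj
    rw [hs0, hs, initState_edge hpres] at this
    obtain ⟨i1, i2, e1, e2, hE⟩ := this
    rw [e1, e2, hpos, hpos, Sym2.eq_swap]
    exact hE
  · intro j hj k hk hjk
    simp only [Set.mem_ofPred_eq] at hj hk
    have h1 := hpos ⟨_, hiter j (by omega)⟩
    have h2 := hpos ⟨_, hiter k (by omega)⟩
    simp only at h1 h2 hjk
    rw [h1, h2] at hjk
    exact hR'.injOn_iterate (by simp only [Set.mem_ofPred_eq]; omega)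
      (by simp only [Set.mem_ofPred_eq]; omega) (congrArg Fin.val (hv hjk))
  · ext z
    simp only [returned, window, Finset.mem_image, Finset.mem_filter, Finset.mem_univ, true_and,
      Finset.mem_range]
    constructor
    · rintro ⟨u, hu, rfl⟩
      obtain ⟨j, hj, hj', hu'⟩ := (hmark u).1 hu
      exact ⟨j, ⟨by omega, hj'⟩, by rw [← hu', hpos]⟩
    · rintro ⟨j, ⟨hj, hj'⟩, rfl⟩
      exact ⟨⟨_, hiter j (by omega)⟩, (hmark _).2 ⟨j, by omega, hj', rfl⟩,
        (hpos ⟨_, hiter j (by omega)⟩).symm⟩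

end Presented

/-- Existence of a selected set comes from running the program on one presentation of the tree. -/
lemma selects_confidenceSet {h ε : ℝ} (hε : 0 < ε) {n : ℕ} (hn : 0 < n) {x : Fin n → Pt}
    {p : Fin n → Fin n} (hx : Function.Injective x)
    (hp : ∀ j : Fin n, 0 < j.val → IsNearest h x j (p j)) :
    (unlabel x p).Selects (ε / 8) (8 * factorialInv ε) (confidenceSet ε (unlabel x p)) := by
  obtain ⟨e, he⟩ := exists_presentation (p := p) hx
  obtain ⟨s, -, -, -, hs⟩ := exists_exec_selects hε hn hx (fun j hj => (hp j hj).1) he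
  have hex : ∃ S, (unlabel x p).Selects (ε / 8) (8 * factorialInv ε) S := ⟨_, hs⟩
  unfold confidenceSet
  rw [dif_pos hex]
  exact hex.choose_spec

lemma returnsWithin_confidenceSet {h ε : ℝ} (hε : 0 < ε) {n : ℕ} (hn : 0 < n) {T : EmbeddedTree}
    (hT : IsNNTree h n T) : ReturnsWithin rootProg ε n T (confidenceSet ε T)
      (3 * factorialInv ε + 300 * (n : ℝ) ^ 2) := by
  obtain ⟨x, p, hx, hs, hp, rfl⟩ := hT
  intro v e hpres
  obtain ⟨s, t, h1, h2, h3⟩ := exists_exec_selects hε hn hx (fun j hj => (hp j hj).1) hpres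
  refine ⟨s, t, h1, ?_, by exact_mod_cast h2⟩
  exact Selects.unique hx hs (fun j hj => (hp j hj).1) h3 (selects_confidenceSet hε hn hx hp)

lemma card_confidenceSet_le {h ε : ℝ} (hε : 0 < ε) {n : ℕ} (hn : 0 < n) {T : EmbeddedTree}
    (hT : IsNNTree h n T) : confidenceSet ε T ⊆ T.verts ∧
      (confidenceSet ε T).card ≤ 16 * factorialInv ε + 1 := by
  obtain ⟨x, p, hx, hs, hp, rfl⟩ := hT
  rcases selects_confidenceSet hε hn hx hp with ⟨h1, h2⟩ | ⟨-, -, h2⟩ |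
    ⟨-, φ, a, b, w, q, i, -, ha, hb, -, hw, -, h2⟩
  · rw [h2]; exact ⟨subset_rfl, by omega⟩
  · rw [h2]; exact ⟨by simp, by simp⟩
  · rw [h2]
    refine ⟨?_, (card_window_le _ _ _ _).trans (by omega)⟩
    intro z hz
    simp only [window, Finset.mem_image, Finset.mem_filter, Finset.mem_range] at hz
    obtain ⟨j, ⟨hj, -⟩, rfl⟩ := hz
    refine mem_verts_unlabel.2 ?_
    cases j with
    | zero => rw [hw.start]; exact IsLong.exists_label hb
    | succ j => exact right_mem_of_edge (hw.adj j (by omega))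

/-! ### The uniform law on the thin torus -/

lemma volume_strip (h : ℝ) : volume (strip h) = ENNReal.ofReal h := by
  rw [strip, Measure.volume_eq_prod, Measure.prod_prod, Real.volume_Ico, Real.volume_Ico]
  simp

lemma isProbabilityMeasure_strip {h : ℝ} (hh : 0 < h) :
    IsProbabilityMeasure ((volume : Measure Pt)[|strip h]) :=
  cond_isProbabilityMeasure_of_finite (by rw [volume_strip]; simpa using hh)
    (by rw [volume_strip]; simp)

lemma measurableSet_strip (h : ℝ) : MeasurableSet (strip h) :=
  measurableSet_Ico.prod measurableSet_Ico

lemma map_fst_strip {h : ℝ} (hh : 0 < h) :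
    Measure.map Prod.fst ((volume : Measure Pt)[|strip h]) =
      (volume : Measure ℝ).restrict (Set.Ico 0 1) := by
  rw [ProbabilityTheory.cond, volume_strip, strip, Measure.volume_eq_prod,
    ← Measure.prod_restrict, Measure.map_smul, Measure.map_fst_prod]
  simp only [Measure.restrict_apply_univ, Real.volume_Ico, sub_zero]
  rw [smul_smul, ENNReal.inv_mul_cancel (by simpa using hh) (by simp), one_smul]

/-- Translation invariance on the circle group, transported to the fundamental domain. It makes the
offset from any gap end uniform. -/
lemma lintegral_fract_sub (f : ℝ → ENNReal) (r : ℝ) :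
    ∫⁻ u in Set.Ico (0 : ℝ) 1, f (Int.fract (u - r)) = ∫⁻ u in Set.Ico (0 : ℝ) 1, f u := by
  set g : UnitAddCircle → ENNReal := fun z => f (AddCircle.equivIco 1 0 z) with hg
  have hga : ∀ a : ℝ, g a = f (Int.fract a) := fun a => by
    rw [hg]
    simp only [AddCircle.coe_equivIco_mk_apply, div_one, mul_one]
  have h1 := UnitAddCircle.lintegral_preimage 0 g
  have h2 := UnitAddCircle.lintegral_preimage 0 fun z => g (z - (r : UnitAddCircle))
  rw [lintegral_sub_right_eq_self, ← h1] at h2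
  simp only [zero_add, ← AddCircle.coe_sub, hga] at h2
  rw [← restrict_Ico_eq_restrict_Ioc] at h2
  rw [h2]
  refine setLIntegral_congr_fun measurableSet_Ico fun u hu => ?_
  rw [Int.fract_eq_self.2 hu]

lemma lintegral_strip_fract {h : ℝ} (hh : 0 < h) {f : ℝ → ENNReal} (hf : Measurable f) (r : ℝ) :
    ∫⁻ z, f (Int.fract (z.1 - r)) ∂((volume : Measure Pt)[|strip h]) =
      ∫⁻ u in Set.Ico (0 : ℝ) 1, f u := by
  rw [← lintegral_fract_sub f r, ← map_fst_strip hh, lintegral_map _ measurable_fst]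
  exact hf.comp (measurable_fract.comp (measurable_id.sub_const r))

lemma strip_fract {h : ℝ} (hh : 0 < h) {s : Set ℝ} (hs : MeasurableSet s) (r : ℝ) :
    ((volume : Measure Pt)[|strip h]) {z | Int.fract (z.1 - r) ∈ s} =
      volume (s ∩ Set.Ico 0 1) := by
  have := lintegral_strip_fract hh (measurable_one.indicator hs) r
  have hm : MeasurableSet {z : Pt | Int.fract (z.1 - r) ∈ s} :=
    (measurable_fract.comp (measurable_fst.sub_const r)) hs
  rw [lintegral_indicator_one hs, Measure.restrict_apply hs] at this
  rw [← this, ← lintegral_indicator_one hm]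
  rfl

lemma isProbabilityMeasure_stripLaw {h : ℝ} (hh : 0 < h) (n : ℕ) :
    IsProbabilityMeasure (stripLaw h n) := by
  have := isProbabilityMeasure_strip hh
  unfold stripLaw
  infer_instance

/-- Integrating out coordinate `j` first: an estimate for one uniform point, valid for all positions
of the others, passes to the product law. -/
lemma stripLaw_le_of_update {h : ℝ} (hh : 0 < h) {n : ℕ} (j : Fin n) {A : Set (Fin n → Pt)}
    (hA : MeasurableSet A) {c : ENNReal}
    (H : ∀ x, ((volume : Measure Pt)[|strip h]) {z | Function.update x j z ∈ A} ≤ c) :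
    stripLaw h n A ≤ c := by
  have := isProbabilityMeasure_strip hh
  have := isProbabilityMeasure_stripLaw hh n
  have key : ∫⁻ x, A.indicator 1 x ∂stripLaw h n ≤ ∫⁻ _, c ∂stripLaw h n := by
    refine lintegral_le_of_lmarginal_le {j} (measurable_one.indicator hA) measurable_const ?_
    intro x
    rw [lmarginal_singleton, lmarginal_singleton, lintegral_const, measure_univ, mul_one]
    refine le_trans (le_of_eq ?_) (H x)
    have hm : MeasurableSet {z | Function.update x j z ∈ A} := measurable_update x hA
    rw [← lintegral_indicator_one hm]
    rfl
  rwa [lintegral_indicator_one hA, lintegral_const, measure_univ, mul_one] at key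

lemma ae_mem_strip {h : ℝ} (hh : 0 < h) (n : ℕ) : ∀ᵐ x ∂stripLaw h n, ∀ i, x i ∈ strip h := by
  have := isProbabilityMeasure_strip hh
  rw [ae_all_iff]
  intro i
  refine (Measure.quasiMeasurePreserving_eval
    (fun _ : Fin n => (volume : Measure Pt)[|strip h]) i).ae ?_
  exact ae_cond_mem (measurableSet_strip h)

lemma ae_fst_ne {h : ℝ} (hh : 0 < h) (n : ℕ) :
    ∀ᵐ x ∂stripLaw h n, ∀ i j, i ≠ j → (x i).1 ≠ (x j).1 := by
  rw [ae_all_iff]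
  intro i
  rw [ae_all_iff]
  intro j
  by_cases hij : i = j
  · exact Filter.Eventually.of_forall fun x h => absurd hij h
  suffices stripLaw h n {x | (x i).1 = (x j).1} = 0 by
    refine Filter.Eventually.mono (measure_eq_zero_iff_ae_notMem.1 this) ?_
    intro x hx _ hx'
    exact hx hx'
  refine le_antisymm (stripLaw_le_of_update hh j (measurableSet_eq_fun
    (measurable_fst.comp (measurable_pi_apply i)) (measurable_fst.comp (measurable_pi_apply j)))
    fun x => ?_) zero_le
  have : {z : Pt | Function.update x j z ∈ {x : Fin n → Pt | (x i).1 = (x j).1}} ⊆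
      {z : Pt | Int.fract (z.1 - (x i).1) ∈ ({0} : Set ℝ)} := by
    intro z hz
    simp only [Set.mem_ofPred_eq, Function.update_self, Function.update_of_ne hij] at hz
    simp [hz]
  refine (measure_mono this).trans ?_
  rw [strip_fract hh (measurableSet_singleton 0)]
  exact (measure_mono Set.inter_subset_left).trans (by simp)

lemma ae_injective {h : ℝ} (hh : 0 < h) (n : ℕ) :
    ∀ᵐ x ∂stripLaw h n, Function.Injective x := by
  filter_upwards [ae_fst_ne hh n] with x hx i j hij
  by_contra hne
  exact hx i j hne (by rw [hij])

/-! ### Close pairs -/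

lemma fract_mem_of_circDist_lt {a b t : ℝ} (ha : a ∈ Set.Ico (0 : ℝ) 1)
    (hb : b ∈ Set.Ico (0 : ℝ) 1) (h : circDist 1 a b < t) :
    Int.fract (b - a) ∈ Set.Iio t ∪ Set.Ioi (1 - t) := by
  obtain ⟨h1, h2⟩ := ha
  obtain ⟨h3, h4⟩ := hb
  rcases le_or_gt a b with hab | hab
  · rw [Int.fract_eq_self.2 ⟨by linarith, by linarith⟩]
    rw [circDist, abs_of_nonpos (by linarith), min_lt_iff] at h
    rcases h with h | h
    · left; rw [Set.mem_Iio]; linarith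
    · right; rw [Set.mem_Ioi]; linarith
  · rw [fract_eq_of_int (z := b - a + 1) (by linarith) (by linarith) (-1) (by push_cast; ring)]
    rw [circDist, abs_of_nonneg (by linarith), min_lt_iff] at h
    rcases h with h | h
    · right; rw [Set.mem_Ioi]; linarith
    · left; rw [Set.mem_Iio]; linarith

lemma stripLaw_circDist_lt_le {h : ℝ} (hh : 0 < h) {n : ℕ} {i j : Fin n} (hij : i ≠ j) (t : ℝ) :
    stripLaw h n {x | circDist 1 (x i).1 (x j).1 < t} ≤ ENNReal.ofReal (2 * t) := by
  rcases le_or_gt t 0 with ht | ht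
  · refine le_trans (le_of_eq ?_) zero_le
    rw [measure_eq_zero_iff_ae_notMem]
    filter_upwards [ae_mem_strip hh n] with x hx hx'
    have := circDist_nonneg (hx i).1 (hx j).1
    exact absurd (hx'.trans_le ht) this.not_gt
  have hU : MeasurableSet (Set.Iio t ∪ Set.Ioi (1 - t)) := measurableSet_Iio.union measurableSet_Ioi
  have h1 : stripLaw h n {x | circDist 1 (x i).1 (x j).1 < t} ≤
      stripLaw h n {x | Int.fract ((x j).1 - (x i).1) ∈ Set.Iio t ∪ Set.Ioi (1 - t)} := by
    refine measure_mono_ae ?_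
    filter_upwards [ae_mem_strip hh n] with x hx hx'
    exact fract_mem_of_circDist_lt (hx i).1 (hx j).1 hx'
  refine h1.trans (stripLaw_le_of_update hh j ?_ fun x => ?_)
  · exact (measurable_fract.comp ((measurable_fst.comp (measurable_pi_apply j)).sub
      (measurable_fst.comp (measurable_pi_apply i)))) hU
  · simp only [Set.mem_ofPred_eq, Function.update_self, Function.update_of_ne hij]
    rw [strip_fract hh hU]
    have : (Set.Iio t ∪ Set.Ioi (1 - t)) ∩ Set.Ico 0 1 ⊆ Set.Ico 0 t ∪ Set.Ioo (1 - t) 1 := by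
      rintro u ⟨hu | hu, h0, h1⟩
      · exact Or.inl ⟨h0, hu⟩
      · exact Or.inr ⟨hu, h1⟩
    refine (measure_mono this).trans ((measure_union_le _ _).trans ?_)
    rw [Real.volume_Ico, Real.volume_Ioo, ← ENNReal.ofReal_add (by linarith) (by linarith)]
    exact ENNReal.ofReal_le_ofReal (by linarith)

lemma stripLaw_exists_circDist_lt_le {h : ℝ} (hh : 0 < h) (n N : ℕ) :
    stripLaw h n {x | ∃ i j : Fin n, i.val < N ∧ j.val < N ∧ i ≠ j ∧
      circDist 1 (x i).1 (x j).1 < h} ≤ ENNReal.ofReal (N ^ 2 * (2 * h)) := by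
  classical
  set s : Finset (Fin n × Fin n) := ((Finset.univ.filter fun i : Fin n => i.val < N) ×ˢ
    (Finset.univ.filter fun i : Fin n => i.val < N)).filter fun q => q.1 ≠ q.2 with hs
  have hcard : s.card ≤ N ^ 2 := by
    refine (Finset.card_filter_le _ _).trans ?_
    rw [Finset.card_product, sq]
    have : (Finset.univ.filter fun i : Fin n => i.val < N).card ≤ N := by
      have := Finset.card_le_card_of_injOn (s := Finset.univ.filter fun i : Fin n => i.val < N)
        (t := Finset.range N) Fin.val (by intro i; simp) (Fin.val_injective.injOn)
      simpa using this
    exact Nat.mul_le_mul this this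
  have : {x : Fin n → Pt | ∃ i j : Fin n, i.val < N ∧ j.val < N ∧ i ≠ j ∧
      circDist 1 (x i).1 (x j).1 < h} ⊆
      ⋃ q ∈ s, {x | circDist 1 (x q.1).1 (x q.2).1 < h} := by
    rintro x ⟨i, j, hi, hj, hij, hd⟩
    simp only [Set.mem_iUnion]
    exact ⟨(i, j), by simp [hs, hi, hj, hij], hd⟩
  refine (measure_mono this).trans ((measure_biUnion_finset_le _ _).trans ?_)
  refine (Finset.sum_le_card_nsmul _ _ (ENNReal.ofReal (2 * h)) fun q hq => ?_).trans ?_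
  · exact stripLaw_circDist_lt_le hh (by simpa [hs] using (Finset.mem_filter.1 hq).2) h
  · rw [nsmul_eq_mul, ENNReal.ofReal_mul (p := (N : ℝ) ^ 2) (by positivity), ← Nat.cast_pow,
      ENNReal.ofReal_natCast]
    gcongr

/-! ### Empty arcs -/

lemma stripLaw_empty_arc_le {h : ℝ} (hh : 0 < h) {n N : ℕ} (hN : N ≤ n) {a b : ℝ} (ha : 0 ≤ a)
    (hab : a ≤ b) (hb : b ≤ 1) :
    stripLaw h n {x | ∀ j : Fin n, j.val < N → (x j).1 ∉ Set.Ico a b} ≤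
      ENNReal.ofReal ((1 - (b - a)) ^ N) := by
  classical
  have := isProbabilityMeasure_strip hh
  have hset : {x : Fin n → Pt | ∀ j : Fin n, j.val < N → (x j).1 ∉ Set.Ico a b} =
      Set.pi Set.univ fun j : Fin n => if j.val < N then Prod.fst ⁻¹' (Set.Ico a b)ᶜ
        else Set.univ := by
    ext x
    simp only [Set.mem_ofPred_eq, Set.mem_pi, Set.mem_univ, true_imp_iff]
    refine forall_congr' fun j => ?_
    by_cases hj : j.val < N <;> simp [hj]
  have hp : ((volume : Measure Pt)[|strip h]) (Prod.fst ⁻¹' (Set.Ico a b)ᶜ) =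
      ENNReal.ofReal (1 - (b - a)) := by
    have h1 : ((volume : Measure Pt)[|strip h]) (Prod.fst ⁻¹' (Set.Ico a b)) =
        ENNReal.ofReal (b - a) := by
      rw [← Measure.map_apply measurable_fst measurableSet_Ico, map_fst_strip hh,
        Measure.restrict_apply measurableSet_Ico, Set.inter_eq_left.2 (Set.Ico_subset_Ico ha hb),
        Real.volume_Ico]
    rw [Set.preimage_compl, measure_compl (measurable_fst measurableSet_Ico) (by simp), h1,
      measure_univ, ENNReal.ofReal_sub (p := 1) (q := b - a) (by linarith), ENNReal.ofReal_one]
  rw [hset, stripLaw, Measure.pi_pi]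
  have : ∀ j : Fin n, ((volume : Measure Pt)[|strip h])
      (if j.val < N then Prod.fst ⁻¹' (Set.Ico a b)ᶜ else Set.univ) =
      if j.val < N then ENNReal.ofReal (1 - (b - a)) else 1 := by
    intro j
    split_ifs
    · exact hp
    · exact measure_univ
  simp only [this]
  rw [← Finset.prod_filter, Finset.prod_const, ENNReal.ofReal_pow (by linarith)]
  refine le_of_eq (congrArg _ ?_)
  rw [Fin.card_filter_val_lt]
  omega

/-- A given arc is missed with probability at most (1 - 1/M)^N ≤ exp(-N/M); the factor `M` is the
union over arcs. -/
lemma stripLaw_exists_empty_arc_le {h : ℝ} (hh : 0 < h) {n N M : ℕ} (hN : N ≤ n) (hM : 0 < M) :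
    stripLaw h n {x | ∃ i < M, ∀ j : Fin n, j.val < N →
      (x j).1 ∉ Set.Ico ((i : ℝ) / M) ((i + 1 : ℝ) / M)} ≤
      ENNReal.ofReal (M * Real.exp (-(N / M : ℝ))) := by
  have hM' : (0 : ℝ) < M := by exact_mod_cast hM
  have : {x : Fin n → Pt | ∃ i < M, ∀ j : Fin n, j.val < N →
      (x j).1 ∉ Set.Ico ((i : ℝ) / M) ((i + 1 : ℝ) / M)} ⊆ ⋃ i ∈ Finset.range M,
        {x | ∀ j : Fin n, j.val < N → (x j).1 ∉ Set.Ico ((i : ℝ) / M) ((i + 1 : ℝ) / M)} := by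
    rintro x ⟨i, hi, hx⟩
    simp only [Set.mem_iUnion]
    exact ⟨i, by simpa using hi, hx⟩
  refine (measure_mono this).trans ((measure_biUnion_finset_le _ _).trans ?_)
  refine (Finset.sum_le_card_nsmul _ _ (ENNReal.ofReal (Real.exp (-(N / M : ℝ))))
    fun i hi => ?_).trans ?_
  · rw [Finset.mem_range] at hi
    have hi' : (i : ℝ) + 1 ≤ M := by exact_mod_cast hi
    refine (stripLaw_empty_arc_le hh hN (by positivity)
      (div_le_div_of_nonneg_right (by linarith) hM'.le) ((div_le_one hM').2 hi')).trans ?_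
    refine ENNReal.ofReal_le_ofReal ?_
    have e : (1 - (((i : ℝ) + 1) / M - i / M)) = 1 - 1 / M := by ring
    have e2 : (-(N / M : ℝ)) = N * (-(1 / M)) := by ring
    rw [e, e2, Real.exp_nat_mul]
    have h1 : (1 : ℝ) / M ≤ 1 := (div_le_one hM').2 (by exact_mod_cast hM)
    refine pow_le_pow_left₀ (by linarith) ?_ _
    have := Real.add_one_le_exp (-(1 / (M : ℝ)))
    linarith
  · rw [Finset.card_range, nsmul_eq_mul, ENNReal.ofReal_mul hM'.le, ENNReal.ofReal_natCast]

/-! ### The moment bound for the gap process -/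

/-- Measurability is needed jointly with the left end and the length of the gap, since after a hit
both depend on the point that has arrived. -/
lemma measurableSet_escapes (γ : ℝ) (n k : ℕ) :
    MeasurableSet {q : (ℝ × ℝ) × (Fin n → Pt) |
      Escapes γ (List.ofFn fun i => (q.2 i).1) k q.1.1 q.1.2} := by
  induction n generalizing k with
  | zero =>
    cases k with
    | zero =>
      simp only [escapes_zero]
      exact measurableSet_le measurable_const (by fun_prop)
    | succ k => simp [Escapes]
  | succ n ih =>
    cases k with
    | zero =>
      simp only [escapes_zero]
      exact measurableSet_le measurable_const (by fun_prop)
    | succ k =>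
      have hfr : Measurable fun q : (ℝ × ℝ) × (Fin (n + 1) → Pt) =>
          Int.fract ((q.2 0).1 - q.1.1) := by
        refine measurable_fract.comp ?_
        fun_prop
      have htail : Measurable fun q : (ℝ × ℝ) × (Fin (n + 1) → Pt) => fun i : Fin n =>
          q.2 i.succ := by fun_prop
      have hG : Measurable fun q : (ℝ × ℝ) × (Fin (n + 1) → Pt) => q.1.2 := by fun_prop
      have hr : Measurable fun q : (ℝ × ℝ) × (Fin (n + 1) → Pt) => q.1.1 := by fun_prop
      simp only [List.ofFn_succ, Escapes]
      have m1 := ((hr.prodMk hG).prodMk htail) (ih (k + 1))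
      have m2 := (((hr.add hfr).prodMk (hG.sub hfr)).prodMk htail) (ih k)
      have m3 := ((hr.prodMk hfr).prodMk htail) (ih k)
      exact ((measurableSet_le hG hfr).inter m1).union
        ((measurableSet_lt hfr hG).inter (m2.union m3))

lemma measurableSet_escapes_section (γ : ℝ) (n k : ℕ) (r G : ℝ) :
    MeasurableSet {x : Fin n → Pt | Escapes γ (List.ofFn fun i => (x i).1) k r G} :=
  (measurable_const.prodMk measurable_id : Measurable fun x : Fin n → Pt => ((r, G), x))
    (measurableSet_escapes γ n k)

lemma stripLaw_succ {h : ℝ} (hh : 0 < h) {n : ℕ} {A : Set (Fin (n + 1) → Pt)}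
    (hA : MeasurableSet A) : stripLaw h (n + 1) A =
      ∫⁻ z, stripLaw h n {x | (Fin.cons z x : Fin (n + 1) → Pt) ∈ A}
        ∂((volume : Measure Pt)[|strip h]) := by
  have := isProbabilityMeasure_strip hh
  have hmp := (measurePreserving_piFinSuccAbove
    (fun _ : Fin (n + 1) => (volume : Measure Pt)[|strip h]) 0).symm
  have h1 := hmp.measure_preimage_equiv A
  rw [stripLaw, ← h1, Measure.prod_apply (hmp.measurable hA)]
  refine lintegral_congr fun z => congrArg _ ?_
  ext x
  simp only [Set.mem_preimage, Set.mem_ofPred_eq]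
  rw [← Fin.insertNth_zero' z x]
  rfl

/-- The bound of `stripLaw_escapes_le` is preserved by the arrival of one point. -/
lemma lintegral_split_le {γ G : ℝ} (hγ : 0 < γ) (hG0 : 0 ≤ G) (hG1 : G ≤ 1) (l k : ℕ) :
    ∫⁻ u in Set.Ico (0 : ℝ) 1, (if G ≤ u then
        ENNReal.ofReal ((G / γ) ^ l * (2 / (l + 1)) ^ (k + 1)) else
        ENNReal.ofReal (((G - u) / γ) ^ l * (2 / (l + 1)) ^ k + (u / γ) ^ l * (2 / (l + 1)) ^ k)) ≤
      ENNReal.ofReal ((G / γ) ^ l * (2 / (l + 1)) ^ (k + 1)) := by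
  rw [← Set.Ico_union_Ico_eq_Ico hG0 hG1, lintegral_union measurableSet_Ico
    (Set.disjoint_left.2 fun u h1 h2 => absurd h1.2 (not_lt.2 h2.1))]
  -- A hit: each piece contributes the integral of u^l over [0,G], which is G^(l+1)/(l+1), and
  -- together they give G^l · G · 2/(l+1).
  have e1 : ∫⁻ u in Set.Ico 0 G, (if G ≤ u then
        ENNReal.ofReal ((G / γ) ^ l * (2 / (l + 1)) ^ (k + 1)) else
        ENNReal.ofReal (((G - u) / γ) ^ l * (2 / (l + 1)) ^ k + (u / γ) ^ l * (2 / (l + 1)) ^ k)) =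
      ENNReal.ofReal (G * ((G / γ) ^ l * (2 / (l + 1)) ^ (k + 1))) := by
    have hcont : Continuous fun u : ℝ =>
        ((G - u) / γ) ^ l * (2 / (l + 1) : ℝ) ^ k + (u / γ) ^ l * (2 / (l + 1) : ℝ) ^ k := by
      fun_prop
    rw [setLIntegral_congr_fun (g := fun u => ENNReal.ofReal (((G - u) / γ) ^ l *
      (2 / (l + 1)) ^ k + (u / γ) ^ l * (2 / (l + 1)) ^ k)) measurableSet_Ico
      fun u hu => if_neg (not_le.2 hu.2), restrict_Ico_eq_restrict_Ioc,
      ← ofReal_integral_eq_lintegral_ofReal]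
    · rw [← intervalIntegral.integral_of_le hG0]
      congr 1
      rw [intervalIntegral.integral_add (by apply Continuous.intervalIntegrable; fun_prop)
        (by apply Continuous.intervalIntegrable; fun_prop),
        intervalIntegral.integral_mul_const, intervalIntegral.integral_mul_const,
        intervalIntegral.integral_comp_sub_left (fun u => (u / γ) ^ l) G]
      simp only [div_pow, sub_self, sub_zero]
      rw [intervalIntegral.integral_div, integral_pow]
      field_simp
      simp
      ring
    · exact (hcont.integrableOn_Icc (a := 0) (b := G)).mono_set Set.Ioc_subset_Icc_self
    · rw [Filter.EventuallyLE, ae_restrict_iff' measurableSet_Ioc]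
      refine Filter.Eventually.of_forall fun u hu => ?_
      have h1 := hu.1
      have h2 : 0 ≤ G - u := by linarith [hu.2]
      show (0 : ℝ) ≤ _
      positivity
  -- A miss, of probability 1 - G, leaves the bound unchanged; the two weights G and 1 - G add up to
  -- one.
  have e2 : ∫⁻ u in Set.Ico G 1, (if G ≤ u then
        ENNReal.ofReal ((G / γ) ^ l * (2 / (l + 1)) ^ (k + 1)) else
        ENNReal.ofReal (((G - u) / γ) ^ l * (2 / (l + 1)) ^ k + (u / γ) ^ l * (2 / (l + 1)) ^ k)) =
      ENNReal.ofReal ((1 - G) * ((G / γ) ^ l * (2 / (l + 1)) ^ (k + 1))) := by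
    rw [setLIntegral_congr_fun (g := fun _ =>
      ENNReal.ofReal ((G / γ) ^ l * (2 / (l + 1)) ^ (k + 1))) measurableSet_Ico
      fun u hu => if_pos hu.1, setLIntegral_const, Real.volume_Ico, mul_comm,
      ← ENNReal.ofReal_mul (by linarith)]
  rw [e1, e2, ← ENNReal.ofReal_add (by positivity)
    (mul_nonneg (by linarith) (by positivity))]
  exact ENNReal.ofReal_le_ofReal (by linarith)

/-- Which piece survives is not tracked: both are kept, at the cost of a factor 2 per hit. The bound
is Markov's inequality for the sum of the `l`-th powers of all the pieces that can arise, with the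
exponent `l` left free. -/
lemma stripLaw_escapes_le {h : ℝ} (hh : 0 < h) {γ : ℝ} (hγ : 0 < γ) (l n k : ℕ) (r : ℝ) {G : ℝ}
    (hG0 : 0 ≤ G) (hG1 : G ≤ 1) :
    stripLaw h n {x | Escapes γ (List.ofFn fun i => (x i).1) k r G} ≤
      ENNReal.ofReal ((G / γ) ^ l * (2 / (l + 1)) ^ k) := by
  have := isProbabilityMeasure_stripLaw hh
  induction n generalizing k r G with
  | zero =>
    cases k with
    | zero =>
      simp only [escapes_zero]
      by_cases hγG : γ ≤ G
      · refine prob_le_one.trans ?_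
        rw [pow_zero, mul_one, ENNReal.one_le_ofReal]
        exact one_le_pow₀ ((one_le_div hγ).2 hγG)
      · simp [hγG]
    | succ k => simp [Escapes]
  | succ n ih =>
    cases k with
    | zero =>
      simp only [escapes_zero]
      by_cases hγG : γ ≤ G
      · refine prob_le_one.trans ?_
        rw [pow_zero, mul_one, ENNReal.one_le_ofReal]
        exact one_le_pow₀ ((one_le_div hγ).2 hγG)
      · simp [hγG]
    | succ k =>
      rw [stripLaw_succ hh (measurableSet_escapes_section _ _ _ _ _)]
      refine le_trans ?_ (lintegral_split_le hγ hG0 hG1 l k)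
      rw [← lintegral_strip_fract hh (f := fun u => if G ≤ u then
        ENNReal.ofReal ((G / γ) ^ l * (2 / (l + 1)) ^ (k + 1)) else ENNReal.ofReal
          (((G - u) / γ) ^ l * (2 / (l + 1)) ^ k + (u / γ) ^ l * (2 / (l + 1)) ^ k)) ?_ r]
      · refine lintegral_mono fun z => ?_
        simp only [Set.mem_ofPred_eq, List.ofFn_succ, Fin.cons_zero, Fin.cons_succ, Escapes]
        have hf0 := Int.fract_nonneg (z.1 - r)
        split_ifs with hG
        · refine (measure_mono ?_).trans (ih (k + 1) r hG0 hG1)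
          rintro x (⟨-, hx⟩ | ⟨hx, -⟩)
          · exact hx
          · exact absurd hx (not_lt.2 hG)
        · rw [not_le] at hG
          rw [ENNReal.ofReal_add (by have : 0 ≤ G - Int.fract (z.1 - r) := by linarith
                                     positivity) (by positivity)]
          refine (measure_mono ?_).trans ((measure_union_le _ _).trans
            (add_le_add (ih k (r + Int.fract (z.1 - r)) (by linarith) (by linarith))
            (ih k r hf0 (by linarith))))
          rintro x (⟨hx, -⟩ | ⟨-, hx⟩)
          · exact absurd hG (not_lt.2 hx)
          · exact hx
      · refine Measurable.ite measurableSet_Ici measurable_const ?_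
        fun_prop

lemma stripLaw_escapes_drop_le {h : ℝ} (hh : 0 < h) {γ : ℝ} (hγ : 0 < γ) (l n k : ℕ)
    (hn : 0 < n) :
    stripLaw h n {x | Escapes γ ((List.ofFn fun i => (x i).1).drop 1) k (x ⟨0, hn⟩).1 1} ≤
      ENNReal.ofReal ((1 / γ) ^ l * (2 / (l + 1)) ^ k) := by
  have := isProbabilityMeasure_strip hh
  obtain ⟨n, rfl⟩ : ∃ m, n = m + 1 := ⟨n - 1, by omega⟩
  simp only [List.ofFn_succ, List.drop_succ_cons, List.drop_zero]
  have hm : MeasurableSet {x : Fin (n + 1) → Pt |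
      Escapes γ (List.ofFn fun i : Fin n => (x i.succ).1) k (x ⟨0, hn⟩).1 1} := by
    have : Measurable fun x : Fin (n + 1) → Pt =>
        (((x ⟨0, hn⟩).1, (1 : ℝ)), fun i : Fin n => x i.succ) := by fun_prop
    exact this (measurableSet_escapes γ n k)
  rw [stripLaw_succ hh hm]
  refine (lintegral_mono (g := fun _ => ENNReal.ofReal ((1 / γ) ^ l * (2 / (l + 1)) ^ k))
    fun z => ?_).trans (by simp)
  exact stripLaw_escapes_le hh hγ l n k z.1 zero_le_one le_rfl

/-! ### Late edges are short -/

lemma isNearest_nnParent {h : ℝ} {n : ℕ} (x : Fin n → Pt) {j : Fin n} (hj : 0 < j.val) :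
    IsNearest h x j (nnParent h x j) := by
  have hex : ∃ i, IsNearest h x j i := by
    obtain ⟨i, hi, hmin⟩ := Finset.exists_min_image (Finset.univ.filter fun i : Fin n => i < j)
      (fun i => stripDist h (x j) (x i)) ⟨⟨0, by omega⟩, Finset.mem_filter.2 ⟨Finset.mem_univ _, hj⟩⟩
    simp only [Finset.mem_filter, Finset.mem_univ, true_and] at hi hmin
    exact ⟨i, hi, hmin⟩
  rw [nnParent, dif_pos hex]
  exact hex.choose_spec

/-- The arc that contains `x j` holds an earlier vertex at horizontal distance below 1/M ≤ θ/2.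
Choosing a nearest vertex in the torus distance instead can lose less than `h` ≤ θ/2 horizontally.
-/
lemma abs_shift_lt_of_arc {h θ : ℝ} (hh : 0 < h) {n M : ℕ} (hM : 2 / θ ≤ M) (hθ : 0 < θ)
    (hhθ : h ≤ θ / 2) {x : Fin n → Pt} (hs : ∀ i, x i ∈ strip h) {j p : Fin n}
    (hp : IsNearest h x j p)
    (harc : ∀ i < M, ∃ l, l < j ∧ (x l).1 ∈ Set.Ico ((i : ℝ) / M) ((i + 1 : ℝ) / M)) :
    |shift (x p) (x j)| < θ := by
  have hM0 : (0 : ℝ) < M := lt_of_lt_of_le (by positivity) hM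
  obtain ⟨⟨h0, h1⟩, -⟩ := hs j
  have hfl : ⌊(x j).1 * M⌋₊ < M := by
    rw [Nat.floor_lt (by positivity)]
    nlinarith
  obtain ⟨l, hl, hl1, hl2⟩ := harc _ hfl
  have hj1 := Nat.floor_le (show 0 ≤ (x j).1 * M by positivity)
  have hj2 := Nat.lt_floor_add_one ((x j).1 * M)
  rw [div_le_iff₀ hM0] at hl1
  rw [lt_div_iff₀ hM0] at hl2
  have hM2 : 2 ≤ M * θ := by rwa [div_le_iff₀ hθ] at hM
  have hd : |(x j).1 - (x l).1| < θ / 2 := by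
    rw [abs_lt]
    constructor <;> nlinarith
  rw [shift_symm, abs_neg, abs_shift_eq (hs _) (hs _)]
  by_contra! hge
  have := stripDist_lt hh (hs j) (hs l) (w := x p) (by
    have : circDist 1 (x j).1 (x l).1 ≤ |(x j).1 - (x l).1| := min_le_left _ _
    linarith)
  exact absurd (hp.2 l hl) (not_le.2 this)

lemma stripLaw_exists_long_le {h θ : ℝ} (hh : 0 < h) (n : ℕ) {M N : ℕ} (hM : 2 / θ ≤ M)
    (hN : 0 < N) (hθ : 0 < θ) (hhθ : h ≤ θ / 2) :
    stripLaw h n {x | ∃ j : Fin n, N ≤ j.val ∧ θ ≤ |shift (x (nnParent h x j)) (x j)|} ≤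
      ENNReal.ofReal (M * Real.exp (-(N / M : ℝ))) := by
  have hM0 : (0 : ℝ) < M := lt_of_lt_of_le (by positivity) hM
  rcases lt_or_ge n N with hnN | hnN
  · refine le_trans (le_of_eq ?_) zero_le
    convert measure_empty (μ := stripLaw h n)
    ext x
    simp only [Set.mem_ofPred_eq, Set.mem_empty_iff_false, iff_false]
    rintro ⟨j, hj, -⟩
    omega
  refine (measure_mono_ae ?_).trans (stripLaw_exists_empty_arc_le hh hnN (by exact_mod_cast hM0))
  filter_upwards [ae_mem_strip hh n] with x hs hx
  obtain ⟨j, hj, hlong⟩ := hx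
  by_contra hcon
  have hcon : ¬ ∃ i < M, ∀ j : Fin n, j.val < N →
    (x j).1 ∉ Set.Ico ((i : ℝ) / M) ((i + 1 : ℝ) / M) := hcon
  push Not at hcon
  refine absurd hlong (not_le.2 (abs_shift_lt_of_arc hh hM hθ hhθ hs
    (isNearest_nnParent x (by omega)) fun i hi => ?_))
  obtain ⟨l, hl, hl'⟩ := hcon i hi
  exact ⟨l, by rw [Fin.lt_def]; omega, hl'⟩

/-! ### The union bound for the confidence set -/

/-- The four summands bound a close pair among the first `N` vertices, a long edge created later, a
first edge that is not long, and an escape of the gap. A single vertex is treated apart, since there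
is no first edge. -/
lemma stripLaw_root_notMem_le {h ε : ℝ} (hh : 0 < h) (hε : 0 < ε) {n M N : ℕ} (hn : 0 < n)
    (l : ℕ) (hM : 16 / ε ≤ M) (hN : 2 ≤ N) (hhε : h ≤ ε / 16) :
    stripLaw h n {x | x ⟨0, hn⟩ ∉ confidenceSet ε (nnTree h x)} ≤
      ENNReal.ofReal (N ^ 2 * (2 * h) + M * Real.exp (-(N / M : ℝ)) + ε / 4 +
        (1 + (8 * factorialInv ε : ℕ)) ^ l * (2 / (l + 1)) ^ (8 * factorialInv ε)) := by
  set R := 8 * factorialInv ε with hR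
  rcases (by omega : n = 1 ∨ 2 ≤ n) with rfl | hn2
  · refine le_trans (le_of_eq ?_) zero_le
    rw [measure_eq_zero_iff_ae_notMem]
    filter_upwards [ae_injective hh 1] with x hx
    simp only [not_not]
    rcases selects_confidenceSet hε hn hx fun j => isNearest_nnParent (h := h) x with
      ⟨-, h2⟩ | ⟨h1, -⟩ | ⟨h1, -⟩
    · rw [nnTree, h2, mem_verts_unlabel]
      exact ⟨_, rfl⟩
    · exact absurd (card_verts_unlabel hx) h1
    · exact absurd (card_verts_unlabel hx) h1
  set A₁ := {x : Fin n → Pt | ∃ i j : Fin n, i.val < N ∧ j.val < N ∧ i ≠ j ∧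
      circDist 1 (x i).1 (x j).1 < h}
  set A₂ := {x : Fin n → Pt | ∃ j : Fin n, N ≤ j.val ∧
    ε / 8 ≤ |shift (x (nnParent h x j)) (x j)|}
  set A₃ := {x : Fin n → Pt | circDist 1 (x ⟨0, hn⟩).1 (x ⟨1, hn2⟩).1 < ε / 8}
  set A₄ := {x : Fin n → Pt | Escapes (1 / (1 + R)) ((List.ofFn fun i => (x i).1).drop 1) R
    (x ⟨0, hn⟩).1 1}
  have hsub : stripLaw h n {x | x ⟨0, hn⟩ ∉ confidenceSet ε (nnTree h x)} ≤
      stripLaw h n (((A₁ ∪ A₂) ∪ A₃) ∪ A₄) := by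
    refine measure_mono_ae ?_
    filter_upwards [ae_injective hh n, ae_mem_strip hh n] with x hx hs hnot
    by_contra hgood
    have hgood' : x ∉ ((A₁ ∪ A₂) ∪ A₃) ∪ A₄ := hgood
    simp only [Set.mem_union, not_or] at hgood'
    obtain ⟨⟨⟨g1, g2⟩, g3⟩, g4⟩ := hgood'
    have hp : ∀ j : Fin n, 0 < j.val → IsNearest h x j (nnParent h x j) :=
      fun j hj => isNearest_nnParent x hj
    refine hnot (Selects.root_mem (N := N) hh hn2 hN hs hx hp ?_ ?_ ?_ g4
      (selects_confidenceSet hε hn hx hp))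
    · intro i j hi hj hij
      by_contra! hlt
      exact g1 ⟨i, j, hi, hj, hij, hlt⟩
    · intro j hj
      by_contra! hlt
      exact g2 ⟨j, hj, hlt⟩
    · rw [abs_shift_eq (hs _) (hs _)]
      exact not_lt.1 g3
  refine hsub.trans ?_
  have h16 : 2 / (ε / 8) = 16 / ε := by field_simp; norm_num
  have b1 : stripLaw h n A₁ ≤ _ := stripLaw_exists_circDist_lt_le hh n N
  have b2 : stripLaw h n A₂ ≤ _ := stripLaw_exists_long_le (M := M) hh n (by rw [h16]; exact hM)
    (by omega) (by linarith) (by linarith)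
  have b3 : stripLaw h n A₃ ≤ _ := stripLaw_circDist_lt_le hh (by simp [Fin.ext_iff]) (ε / 8)
  have b4 : stripLaw h n A₄ ≤ _ := stripLaw_escapes_drop_le hh (by positivity) l n R hn
  rw [show 2 * (ε / 8) = ε / 4 by ring] at b3
  rw [one_div_one_div] at b4
  rw [ENNReal.ofReal_add (by positivity) (by positivity),
    ENNReal.ofReal_add (by positivity) (by positivity),
    ENNReal.ofReal_add (by positivity) (by positivity)]
  exact (measure_union_le _ _).trans (add_le_add ((measure_union_le _ _).trans
    (add_le_add ((measure_union_le _ _).trans (add_le_add b1 b2)) b3)) b4)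

/-! ### Asymptotics -/

/-- With q = l + 1 and l² < K ≤ q², the factor q^(8K) in the denominator splits as 2K + K + 5K: it
absorbs K! ≥ 1/ε, the power (1+8K)^l, and 4 · 2^(8K). The assumption K ≥ 25 serves to have l ≥ 4. -/
lemma escape_bound {ε : ℝ} (hε : 0 < ε) {K : ℕ} (hK : 25 ≤ K)
    (hKε : 1 ≤ (K.factorial : ℝ) * ε) :
    ∃ l : ℕ, (1 + ((8 * K : ℕ) : ℝ)) ^ l * (2 / (l + 1)) ^ (8 * K) ≤ ε / 4 := by
  obtain ⟨l, hl1, hl2⟩ : ∃ l : ℕ, l ^ 2 < K ∧ K ≤ (l + 1) ^ 2 := by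
    refine ⟨Nat.sqrt (K - 1), ?_, ?_⟩
    · have := Nat.sqrt_le' (K - 1)
      omega
    · have := Nat.lt_succ_sqrt' (K - 1)
      simp only [Nat.succ_eq_add_one] at this
      omega
  have hl4 : 4 ≤ l := by
    by_contra! hlt
    have : (l + 1) ^ 2 ≤ 4 ^ 2 := Nat.pow_le_pow_left (by omega) 2
    omega
  refine ⟨l, ?_⟩
  set q := l + 1 with hq
  have hfact : K.factorial ≤ q ^ (2 * K) := by
    rw [pow_mul]
    exact K.factorial_le_pow.trans (Nat.pow_le_pow_left hl2 K)
  have hbase : 1 + 8 * K ≤ q ^ 4 := by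
    have h1 : 1 + 8 * K ≤ 9 * q ^ 2 := by omega
    have h2 : 9 * q ^ 2 ≤ q ^ 2 * q ^ 2 := Nat.mul_le_mul_right _ (by nlinarith)
    calc 1 + 8 * K ≤ q ^ 2 * q ^ 2 := h1.trans h2
      _ = q ^ 4 := by ring
  have hpow : (1 + 8 * K) ^ l ≤ q ^ K := by
    calc (1 + 8 * K) ^ l ≤ (q ^ 4) ^ l := Nat.pow_le_pow_left hbase l
      _ = q ^ (4 * l) := by rw [pow_mul]
      _ ≤ q ^ K := Nat.pow_le_pow_right (by omega) (by nlinarith)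
  have htwo : 4 * 2 ^ (8 * K) ≤ q ^ (5 * K) := by
    calc 4 * 2 ^ (8 * K) = 2 ^ (8 * K + 2) := by rw [pow_add]; ring
      _ ≤ 2 ^ (2 * (5 * K)) := Nat.pow_le_pow_right (by omega) (by omega)
      _ = 4 ^ (5 * K) := by rw [pow_mul]; norm_num
      _ ≤ q ^ (5 * K) := Nat.pow_le_pow_left (by omega) _
  have hnat : K.factorial * ((1 + 8 * K) ^ l * (4 * 2 ^ (8 * K))) ≤ q ^ (8 * K) := by
    calc _ ≤ q ^ (2 * K) * (q ^ K * q ^ (5 * K)) :=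
          Nat.mul_le_mul hfact (Nat.mul_le_mul hpow htwo)
      _ = q ^ (8 * K) := by rw [← pow_add, ← pow_add]; congr 1; ring
  have hreal : (K.factorial : ℝ) * ((1 + 8 * K) ^ l * (4 * 2 ^ (8 * K))) ≤ (q : ℝ) ^ (8 * K) := by
    exact_mod_cast hnat
  have hq0 : (0 : ℝ) < (q : ℝ) ^ (8 * K) := by positivity
  have hql : ((l : ℝ) + 1) = q := by rw [hq]; push_cast; ring
  rw [hql, div_pow, ← mul_div_assoc, div_le_iff₀ hq0]
  push_cast
  set X := (1 + 8 * (K : ℝ)) ^ l * 2 ^ (8 * K) with hX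
  have hX0 : 0 ≤ X := by positivity
  have h5 : (K.factorial : ℝ) * (4 * X) ≤ (q : ℝ) ^ (8 * K) := by
    refine le_trans (le_of_eq ?_) hreal
    rw [hX]; ring
  have h6 : 1 * X ≤ (K.factorial : ℝ) * ε * X := mul_le_mul_of_nonneg_right hKε hX0
  have h7 := mul_le_mul_of_nonneg_left h5 hε.le
  nlinarith

lemma tendsto_log_inv : Tendsto (fun ε : ℝ => Real.log (1 / ε)) (𝓝[>] 0) atTop := by
  simp only [one_div]
  exact Real.tendsto_log_atTop.comp tendsto_inv_nhdsGT_zero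

lemma eventually_le_factorialInv (m : ℕ) : ∀ᶠ ε : ℝ in 𝓝[>] 0, m ≤ factorialInv ε := by
  have : ∀ᶠ ε : ℝ in 𝓝[>] 0, ε < 1 / (m.factorial : ℝ) :=
    (eventually_lt_nhds (by positivity)).filter_mono nhdsWithin_le_nhds
  filter_upwards [this, self_mem_nhdsWithin] with ε h1 h0
  have h0' : 0 < ε := h0
  by_contra! hlt
  have hs := factorialInv_spec h0'
  have hf : ((factorialInv ε).factorial : ℝ) ≤ m.factorial := by
    exact_mod_cast Nat.factorial_le hlt.le
  rw [lt_div_iff₀ (by positivity)] at h1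
  nlinarith

/-- For t = K - 1, minimality gives log t! < L with L = log(1/ε), while t! ≥ (t/e)^t. If t > 4L/log
L, then log t - 1 ≥ (log L)/2 for large L, and t(log t - 1) would exceed 2L. -/
lemma eventually_factorialInv_le : ∀ᶠ ε : ℝ in 𝓝[>] 0, (factorialInv ε : ℝ) ≤
    5 * (Real.log (1 / ε) / Real.log (Real.log (1 / ε))) := by
  have hL : ∀ᶠ L : ℝ in atTop, 2 < Real.log L ∧ Real.log L ≤ L ∧
      Real.log (Real.log L) + 1 ≤ Real.log L / 2 := by
    have h1 := Real.tendsto_log_atTop.eventually_gt_atTop 2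
    have h2 : ∀ᶠ y : ℝ in atTop, Real.log y + 1 ≤ y / 2 := by
      have h3 : ∀ᶠ y : ℝ in atTop, ‖Real.log y‖ ≤ (1 / 4) * ‖y‖ :=
        Real.isLittleO_log_id_atTop.def (by norm_num)
      filter_upwards [h3, eventually_ge_atTop 4] with y hy hy4
      rw [Real.norm_eq_abs, Real.norm_eq_abs, abs_of_nonneg (by linarith : (0 : ℝ) ≤ y)] at hy
      linarith [le_abs_self (Real.log y)]
    filter_upwards [h1, Real.tendsto_log_atTop.eventually h2, eventually_gt_atTop 0]
      with L h4 h5 h6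
    exact ⟨h4, Real.log_le_self h6.le, h5⟩
  filter_upwards [tendsto_log_inv.eventually hL, tendsto_log_inv.eventually_gt_atTop 0,
    eventually_le_factorialInv 1, self_mem_nhdsWithin] with ε ⟨h1, h2, h3⟩ hL0 hK1 hε
  have hε : 0 < ε := hε
  set L := Real.log (1 / ε) with hLdef
  obtain ⟨t, ht⟩ : ∃ t, factorialInv ε = t + 1 := ⟨factorialInv ε - 1, by omega⟩
  have htf := factorial_mul_lt_of_lt (ε := ε) (k := t) (by omega)
  have hlog : Real.log (t.factorial : ℝ) < L := by
    refine Real.log_lt_log (by positivity) ?_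
    rw [lt_div_iff₀ hε]
    exact htf
  have hs1 : 1 ≤ L / Real.log L := (one_le_div (by linarith)).2 h2
  suffices (t : ℝ) ≤ 4 * (L / Real.log L) by
    rw [ht]; push_cast; linarith
  by_contra! hlt
  have ht0 : (0 : ℝ) < t := by linarith
  have hst := Real.pow_div_factorial_le_exp (t : ℝ) ht0.le t
  rw [div_le_iff₀ (by positivity)] at hst
  have hst' := Real.log_le_log (by positivity) hst
  rw [Real.log_pow, Real.log_mul (by positivity) (by positivity), Real.log_exp] at hst'
  have hlt' : Real.log (L / Real.log L) ≤ Real.log t :=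
    Real.log_le_log (by linarith) (by linarith)
  rw [Real.log_div hL0.ne' (by linarith)] at hlt'
  have hlast : t * (Real.log L / 2) ≤ t * (Real.log t - 1) :=
    mul_le_mul_of_nonneg_left (by linarith) ht0.le
  have hlast' : 4 * (L / Real.log L) * (Real.log L / 2) < t * (Real.log L / 2) :=
    mul_lt_mul_of_pos_right hlt (by linarith)
  have : 4 * (L / Real.log L) * (Real.log L / 2) = 2 * L := by
    field_simp
    norm_num
  nlinarith

/-- With m = ⌈4/√ε⌉ the scales are M = m² and N = m³. Then N² is of order ε^(-3), so N²h is of order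
ε², and M exp(-N/M) = m² exp(-m) is smaller than any power of ε. The fifth power in the height gives
the first term a spare factor ε. -/
lemma eventually_exists_scales {h : ℝ → ℝ} (hpos : ∀ ε, 0 < ε → 0 < h ε)
    (hO : h =O[𝓝[>] (0 : ℝ)] (fun ε : ℝ => ε ^ 5)) :
    ∀ᶠ ε in 𝓝[>] (0 : ℝ), h ε ≤ ε / 16 ∧ ∃ M N : ℕ, 16 / ε ≤ M ∧ 2 ≤ N ∧
      (N : ℝ) ^ 2 * (2 * h ε) + M * Real.exp (-(N / M : ℝ)) ≤ ε / 2 := by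
  obtain ⟨C, hC0, hC⟩ := hO.exists_pos
  have hC := hC.bound
  have hm : Tendsto (fun ε : ℝ => ⌈4 / √ε⌉₊) (𝓝[>] 0) atTop := by
    refine tendsto_nat_ceil_atTop.comp ?_
    simp only [div_eq_mul_inv]
    refine Tendsto.const_mul_atTop (by norm_num) (tendsto_inv_nhdsGT_zero.comp ?_)
    refine tendsto_nhdsWithin_iff.2 ⟨?_, ?_⟩
    · have := (Real.continuous_sqrt.tendsto (0 : ℝ)).mono_left
        (nhdsWithin_le_nhds (s := Set.Ioi (0 : ℝ)))
      simpa using this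
    · filter_upwards [self_mem_nhdsWithin] with ε hε
      exact Real.sqrt_pos.2 hε
  have hexp : ∀ᶠ m : ℕ in atTop, (m : ℝ) ^ 4 * Real.exp (-(m : ℝ)) ≤ 4 :=
    ((Real.tendsto_pow_mul_exp_neg_atTop_nhds_zero 4).comp
      tendsto_natCast_atTop_atTop).eventually_le_const (by norm_num)
  have hsmall : ∀ᶠ ε : ℝ in 𝓝[>] 0, ε < 1 / (16 * (C + 1) * 5 ^ 6) :=
    (eventually_lt_nhds (by positivity)).filter_mono nhdsWithin_le_nhds
  filter_upwards [hC, hm.eventually hexp, hm.eventually_ge_atTop 2, hsmall, self_mem_nhdsWithin]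
    with ε h1 h2 h3 h4 hε
  have hε : 0 < ε := hε
  have hh := hpos ε hε
  set m := ⌈4 / √ε⌉₊ with hmdef
  rw [Real.norm_eq_abs, Real.norm_eq_abs, abs_of_pos hh, abs_of_pos (by positivity)] at h1
  rw [lt_div_iff₀ (by positivity)] at h4
  have hCε : 0 ≤ C * ε := by positivity
  have hε1 : ε < 1 / 16 := by linarith
  have hε5 : ε ^ 5 = ε * ε ^ 4 := by ring
  have hε4 : ε ^ 4 ≤ 1 := pow_le_one₀ hε.le (by linarith)
  have hs0 : 0 < √ε := Real.sqrt_pos.2 hε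
  have hss : √ε ^ 2 = ε := Real.sq_sqrt hε.le
  have hs1 : √ε ≤ 1 := by
    rw [Real.sqrt_le_one]; linarith
  have hm1 : 4 / √ε ≤ m := Nat.le_ceil _
  have hm2 : (m : ℝ) * √ε ≤ 5 := by
    have := Nat.ceil_lt_add_one (show 0 ≤ 4 / √ε by positivity)
    rw [← hmdef] at this
    have h5 : (m : ℝ) * √ε ≤ (4 / √ε + 1) * √ε := mul_le_mul_of_nonneg_right this.le hs0.le
    have h6 : (4 / √ε + 1) * √ε = 4 + √ε := by field_simp
    linarith
  have hm0 : (0 : ℝ) < m := by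
    have : 0 < m := by omega
    exact_mod_cast this
  have hmM : 16 / ε ≤ (m : ℝ) ^ 2 := by
    have := pow_le_pow_left₀ (by positivity) hm1 2
    rw [div_pow, hss] at this
    linarith
  refine ⟨?_, m ^ 2, m ^ 3, by push_cast; exact hmM, ?_, ?_⟩
  · have h5 : C * ε ^ 5 ≤ (C * ε) * ε := by
      have : ε ^ 5 ≤ ε ^ 2 := pow_le_pow_of_le_one hε.le (by linarith) (by norm_num)
      nlinarith
    have h6 : C * ε ≤ 1 / 16 := by linarith
    nlinarith
  · calc 2 ≤ 2 ^ 3 := by norm_num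
      _ ≤ m ^ 3 := Nat.pow_le_pow_left h3 3
  · push_cast
    have hNM : (m : ℝ) ^ 3 / (m : ℝ) ^ 2 = m := by field_simp
    rw [hNM]
    have ha : ((m : ℝ) ^ 3) ^ 2 * (2 * h ε) ≤ ε / 4 := by
      have h6 : ((m : ℝ) * √ε) ^ 6 ≤ 5 ^ 6 := pow_le_pow_left₀ (by positivity) hm2 6
      have h7 : ((m : ℝ) * √ε) ^ 6 = ((m : ℝ) ^ 3) ^ 2 * ε ^ 3 := by
        rw [show ε ^ 3 = √ε ^ 6 by rw [show (6 : ℕ) = 2 * 3 from rfl, pow_mul, hss]]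
        ring
      rw [h7] at h6
      have h8 : ((m : ℝ) ^ 3) ^ 2 * (2 * h ε) ≤ ((m : ℝ) ^ 3) ^ 2 * (2 * (C * ε ^ 5)) := by
        gcongr
      have h9 : ((m : ℝ) ^ 3) ^ 2 * (2 * (C * ε ^ 5)) =
          (((m : ℝ) ^ 3) ^ 2 * ε ^ 3) * (2 * C * ε * ε) := by ring
      have h10 : (((m : ℝ) ^ 3) ^ 2 * ε ^ 3) * (2 * C * ε * ε) ≤ 5 ^ 6 * (2 * C * ε * ε) :=
        mul_le_mul_of_nonneg_right h6 (by positivity)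
      nlinarith
    have hb : (m : ℝ) ^ 2 * Real.exp (-(m : ℝ)) ≤ ε / 4 := by
      rw [div_le_iff₀ hε] at hmM
      have h5 : (m : ℝ) ^ 2 * Real.exp (-(m : ℝ)) * (m : ℝ) ^ 2 ≤ 4 := by
        refine le_trans (le_of_eq ?_) h2
        ring
      have h6 : 0 ≤ (m : ℝ) ^ 2 * Real.exp (-(m : ℝ)) := by positivity
      have h7 := mul_le_mul_of_nonneg_left hmM h6
      nlinarith
    linarith

theorem exists_rootProg_bounds :
    ∃ (P : RamProg) (H : ℝ → EmbeddedTree → Finset Pt) (C₁ C₂ : ℝ),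
      ∀ h : ℝ → ℝ, (∀ ε, 0 < ε → 0 < h ε) →
        h =O[𝓝[>] (0 : ℝ)] (fun ε : ℝ => ε ^ 5) →
        ∀ᶠ ε in 𝓝[>] (0 : ℝ), ∀ (n : ℕ) (hn : 0 < n),
          (∀ T : EmbeddedTree, IsNNTree (h ε) n T →
            H ε T ⊆ T.verts ∧
            ((H ε T).card : ℝ) ≤ C₁ * (Real.log (1 / ε) / Real.log (Real.log (1 / ε))) ∧
            ReturnsWithin P ε n T (H ε T) (C₂ * ((n : ℝ) ^ 2 + Real.log (1 / ε) ^ 2))) ∧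
          stripLaw (h ε) n {x | x ⟨0, hn⟩ ∉ H ε (nnTree (h ε) x)} ≤ ENNReal.ofReal ε := by
  -- 81 comes from 16K + 1 with K ≤ 5 s(ε) and s(ε) ≥ 1. In the running time, 3K is absorbed by 300
  -- log²(1/ε).
  refine ⟨rootProg, confidenceSet, 81, 300, fun h hpos hO => ?_⟩
  have hL := tendsto_log_inv.eventually (Real.tendsto_log_atTop.eventually_ge_atTop 1)
  filter_upwards [eventually_exists_scales hpos hO, eventually_le_factorialInv 25,
    eventually_factorialInv_le, hL, tendsto_log_inv.eventually_ge_atTop 1, self_mem_nhdsWithin]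
    with ε ⟨hhε, M, N, hM, hN, hMN⟩ hK25 hKs hL1 hL2 hε n hn
  have hε : 0 < ε := hε
  set L := Real.log (1 / ε)
  have hLL : Real.log L ≤ L := Real.log_le_self (by linarith)
  have hs1 : 1 ≤ L / Real.log L := (one_le_div (by linarith)).2 hLL
  have hs2 : L / Real.log L ≤ L := div_le_self (by linarith) hL1
  refine ⟨fun T hT => ?_, ?_⟩
  · obtain ⟨hsub, hcard⟩ := card_confidenceSet_le hε hn hT
    refine ⟨hsub, ?_, ?_⟩
    · have : ((confidenceSet ε T).card : ℝ) ≤ 16 * factorialInv ε + 1 := by exact_mod_cast hcard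
      linarith
    · intro v e hpres
      obtain ⟨s, t, h1, h2, h3⟩ := returnsWithin_confidenceSet hε hn hT v e hpres
      refine ⟨s, t, h1, h2, h3.trans ?_⟩
      nlinarith
  · obtain ⟨l, hl⟩ := escape_bound hε hK25 (factorialInv_spec hε)
    refine (stripLaw_root_notMem_le (hpos ε hε) hε hn l hM hN hhε).trans ?_
    exact ENNReal.ofReal_le_ofReal (by linarith)

/-! ### Rows and their rotations -/

/-- In a row of `k` positions followed by others, the order of arrival that starts at `i`, goes up
to the end of the row and then down from `i` to the beginning of the row. -/
def rotateRow {n k : ℕ} (hkn : k ≤ n) (i : Fin k) : Equiv.Perm (Fin n) where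
  toFun j := ⟨if j.val < k then (if i.val + j.val < k then i + j else k - 1 - j) else j, by
    split_ifs <;> omega⟩
  invFun j := ⟨if j.val < k then (if i.val ≤ j.val then j - i else k - 1 - j) else j, by
    split_ifs <;> omega⟩
  left_inv j := by
    ext
    simp only
    split_ifs <;> omega
  right_inv j := by
    ext
    simp only
    split_ifs <;> omega

lemma rotateRow_val {n k : ℕ} (hkn : k ≤ n) (i : Fin k) (j : Fin n) : (rotateRow hkn i j).val =
    if j.val < k then (if i.val + j.val < k then i.val + j.val else k - 1 - j.val)
      else j.val := rfl

lemma rotateRow_symm_val {n k : ℕ} (hkn : k ≤ n) (i : Fin k) (j : Fin n) :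
    ((rotateRow hkn i).symm j).val =
      if j.val < k then (if i.val ≤ j.val then j.val - i.val else k - 1 - j.val)
        else j.val := rfl

/-- The configurations whose nearest neighbour tree does not depend on which point of an initial row
of `k` points is the root. -/
structure IsRow (h : ℝ) {n : ℕ} (k : ℕ) (x : Fin n → Pt) : Prop where
  mem : ∀ i, x i ∈ strip h
  injective : Function.Injective x
  noTie : ∀ j i l : Fin n, i < j → l < j → i ≠ l → stripDist h (x j) (x i) ≠ stripDist h (x j) (x l)
  row : ∀ i : Fin n, i.val < k →
    (x i).1 ∈ Set.Ico ((i : ℝ) / (4 * k)) ((i : ℝ) / (4 * k) + 1 / (16 * k))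

namespace IsRow

variable {h : ℝ} {n k : ℕ} {x : Fin n → Pt}

lemma eq_of_isNearest (hx : IsRow h k x) {j a b : Fin n} (ha : IsNearest h x j a)
    (hb : IsNearest h x j b) : a = b := by
  by_contra hne
  exact hx.noTie j a b ha.1 hb.1 hne (le_antisymm (ha.2 b hb.1) (hb.2 a ha.1))

lemma sub_mem (hx : IsRow h k x) {a b : Fin n} (ha : a.val < k) (hb : b.val < k) :
    |(x a).1 - (x b).1 - ((a : ℝ) - b) / (4 * k)| < 1 / (16 * k) := by
  obtain ⟨h1, h2⟩ := hx.row a ha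
  obtain ⟨h3, h4⟩ := hx.row b hb
  rw [sub_div, abs_lt]
  constructor <;> linarith

/-- Neighbours in the row are closer to one another than other points of the row. -/
lemma stripDist_lt (hx : IsRow h k x) (hh : 0 < h) (hhk : h ≤ 1 / (8 * k)) {a b c : Fin n}
    (ha : a.val < k) (hb : b.val < k) (hc : c.val < k) (hab : a.val + 1 = b.val ∨ b.val + 1 = a.val)
    (hac : a.val + 2 ≤ c.val ∨ c.val + 2 ≤ a.val) :
    stripDist h (x a) (x b) < stripDist h (x a) (x c) := by
  have hk : (0 : ℝ) < k := by
    have : 0 < k := by omega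
    exact_mod_cast this
  set u : ℝ := 1 / (16 * k) with hu
  have hu0 : 0 < u := by positivity
  have hu1 : u ≤ 1 / 16 := by
    rw [hu, div_le_div_iff₀ (by positivity) (by norm_num)]
    have : (1 : ℝ) ≤ k := by
      have : 1 ≤ k := by omega
      exact_mod_cast this
    linarith
  have hku : k * u = 1 / 16 := by rw [hu]; field_simp
  have hhu : h ≤ 2 * u := by
    refine hhk.trans (le_of_eq ?_)
    rw [hu]; field_simp; norm_num
  have hdiv : ∀ z : ℝ, z / (4 * k) = z * (4 * u) := fun z => by rw [hu]; field_simp; norm_num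
  have e1 := abs_lt.1 (hx.sub_mem ha hb)
  have e2 := abs_lt.1 (hx.sub_mem ha hc)
  rw [hdiv, ← hu] at e1 e2
  have hca : (c : ℝ) < k := by exact_mod_cast hc
  have haa : (a : ℝ) < k := by exact_mod_cast ha
  have hc0 : (0 : ℝ) ≤ (c : ℕ) := by positivity
  have ha0 : (0 : ℝ) ≤ (a : ℕ) := by positivity
  have hcu : (c : ℝ) * u < 1 / 16 := by rw [← hku]; exact mul_lt_mul_of_pos_right hca hu0
  have hau : (a : ℝ) * u < 1 / 16 := by rw [← hku]; exact mul_lt_mul_of_pos_right haa hu0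
  have hcu0 : 0 ≤ (c : ℝ) * u := by positivity
  have hau0 : 0 ≤ (a : ℝ) * u := by positivity
  have hnear : |(x a).1 - (x b).1| < 5 * u := by
    rw [abs_lt]
    rcases hab with hab | hab
    · have : (b : ℝ) = a + 1 := by exact_mod_cast hab.symm
      rw [this] at e1
      constructor <;> nlinarith
    · have : (a : ℝ) = b + 1 := by exact_mod_cast hab.symm
      rw [this] at e1
      constructor <;> nlinarith
  have hfar : 7 * u ≤ circDist 1 (x a).1 (x c).1 := by
    refine le_min ?_ ?_
    · rcases hac with hac | hac
      · have : (a : ℝ) + 2 ≤ c := by exact_mod_cast hac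
        refine le_trans ?_ (neg_le_abs _)
        nlinarith
      · have : (c : ℝ) + 2 ≤ a := by exact_mod_cast hac
        refine le_trans ?_ (le_abs_self _)
        nlinarith
    · have : |(x a).1 - (x c).1| ≤ 1 / 2 := by
        rw [abs_le]
        constructor <;> nlinarith
      linarith
  refine _root_.stripDist_lt hh (hx.mem _) (hx.mem _) ?_
  have : circDist 1 (x a).1 (x b).1 ≤ |(x a).1 - (x b).1| := min_le_left _ _
  linarith

/-- The rotation index `i` does not occur in the description of the edges, and that is what makes
the root unidentifiable within the row. -/
lemma edges_nnTree (hx : IsRow h k x) (hh : 0 < h) (hhk : h ≤ 1 / (8 * k)) (hkn : k ≤ n)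
    (i : Fin k) (z : Sym2 Pt) :
    z ∈ (nnTree h (x ∘ rotateRow hkn i)).edges ↔
      (∃ a b : Fin n, b.val < k ∧ a.val + 1 = b.val ∧ z = s(x a, x b)) ∨
        ∃ a b : Fin n, k ≤ b.val ∧ IsNearest h x b a ∧ z = s(x a, x b) := by
  set σ := rotateRow hkn i with hσ
  set p := nnParent h (x ∘ σ) with hp
  have hval := rotateRow_val hkn i
  have hsval := rotateRow_symm_val hkn i
  rw [← hσ] at hval hsval
  have hnear : ∀ j : Fin n, 0 < j.val → IsNearest h (x ∘ σ) j (p j) :=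
    fun j hj => isNearest_nnParent _ hj
  have hi := i.isLt
  -- The row points present before `j` form an interval of the row that `σ j` extends at one end.
  -- Only one of its neighbours is present, and every other one is at least two places away.
  have hrow : ∀ j b : Fin n, 0 < j.val → j.val < k → b < j →
      ((σ b).val + 1 = (σ j).val ∨ (σ j).val + 1 = (σ b).val) → p j = b := by
    intro j b hj hjk hb hadj
    by_contra hne
    have hpj := hnear j hj
    refine absurd (hpj.2 b hb) (not_le.2 (hx.stripDist_lt hh hhk ?_ ?_ ?_ ?_ ?_))
    · rw [hval]; split_ifs <;> omega
    · rw [Fin.lt_def] at hb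
      rw [hval]; split_ifs <;> omega
    · have := hpj.1
      rw [Fin.lt_def] at this
      rw [hval]; split_ifs <;> omega
    · omega
    · have h1 := hpj.1
      rw [Fin.lt_def] at h1 hb
      have h2 : (p j).val ≠ b.val := fun h => hne (Fin.ext h)
      have v1 := hval j
      have v2 := hval b
      have v3 := hval (p j)
      split_ifs at v1 v2 v3 <;> omega
  -- After the row is complete, the set of earlier positions no longer depends on the order within
  -- the row.
  have hlate : ∀ j : Fin n, k ≤ j.val → 0 < j.val → IsNearest h x j (σ (p j)) := by
    intro j hjk hj
    have hσj : σ j = j := Fin.ext (by rw [hval]; split_ifs <;> omega)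
    obtain ⟨h1, h2⟩ := hnear j hj
    refine ⟨?_, fun l hl => ?_⟩
    · rw [Fin.lt_def] at h1 ⊢
      rw [hval]; split_ifs <;> omega
    · have := h2 (σ.symm l) (by
        rw [Fin.lt_def] at hl ⊢
        rw [hsval]; split_ifs <;> omega)
      simpa [hσj] using this
  simp only [nnTree, unlabel, Finset.mem_image, Finset.mem_filter, Finset.mem_univ, true_and]
  constructor
  · rintro ⟨j, hj, rfl⟩
    rcases lt_or_ge j.val k with hjk | hjk
    · left
      obtain ⟨b, hb, hadj⟩ : ∃ b : Fin n, b < j ∧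
          ((σ b).val + 1 = (σ j).val ∨ (σ j).val + 1 = (σ b).val) := by
        have v1 := hval j
        by_cases hc : i.val + j.val < k
        · have v2 := hval ⟨j.val - 1, by omega⟩
          refine ⟨⟨j.val - 1, by omega⟩, ?_, ?_⟩
          · rw [Fin.lt_def]; simp only; omega
          · simp only at v2
            split_ifs at v1 v2 <;> omega
        · by_cases hc' : i.val + j.val = k
          · have v2 := hval ⟨0, by omega⟩
            refine ⟨⟨0, by omega⟩, ?_, ?_⟩
            · rw [Fin.lt_def]; simp only; omega
            · simp only at v2
              split_ifs at v1 v2 <;> omega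
          · have v2 := hval ⟨j.val - 1, by omega⟩
            refine ⟨⟨j.val - 1, by omega⟩, ?_, ?_⟩
            · rw [Fin.lt_def]; simp only; omega
            · simp only at v2
              split_ifs at v1 v2 <;> omega
      have hpj : p j = b := hrow j b hj hjk hb hadj
      have k1 : (σ j).val < k := by rw [hval]; split_ifs <;> omega
      have k2 : (σ b).val < k := by
        rw [Fin.lt_def] at hb
        rw [hval]; split_ifs <;> omega
      change (∃ a b : Fin n, b.val < k ∧ a.val + 1 = b.val ∧ s(x (σ j), x (σ (p j))) = s(x a, x b))
      rw [hpj]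
      rcases hadj with h1 | h1
      · exact ⟨σ b, σ j, k1, h1, Sym2.eq_swap⟩
      · exact ⟨σ j, σ b, k2, h1, rfl⟩
    · right
      have hσj : σ j = j := Fin.ext (by rw [hval]; split_ifs <;> omega)
      refine ⟨σ (p j), j, hjk, hlate j hjk hj, ?_⟩
      simp only [Function.comp_apply]
      rw [hσj]
      exact Sym2.eq_swap
  · rintro (⟨a, b, hb, hab, rfl⟩ | ⟨a, b, hb, hn, rfl⟩)
    · rcases le_or_gt i.val a.val with hia | hia
      · have v1 := hsval a
        have v2 := hsval b
        rw [if_pos (by omega), if_pos (by omega)] at v1 v2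
        have := hrow (σ.symm b) (σ.symm a) (by omega) (by omega) (by rw [Fin.lt_def]; omega)
          (by simp only [Equiv.apply_symm_apply]; omega)
        refine ⟨σ.symm b, by omega, ?_⟩
        simp only [Function.comp_apply]
        rw [← hp, this]
        simp only [Equiv.apply_symm_apply]
        exact Sym2.eq_swap
      · have v1 := hsval a
        have v2 := hsval b
        rw [if_pos (by omega), if_neg (by omega)] at v1
        have v3 : (σ.symm b).val < (σ.symm a).val := by
          split_ifs at v2 <;> omega
        have := hrow (σ.symm a) (σ.symm b) (by omega) (by omega) (by rw [Fin.lt_def]; omega)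
          (by simp only [Equiv.apply_symm_apply]; omega)
        refine ⟨σ.symm a, by omega, ?_⟩
        simp only [Function.comp_apply]
        rw [← hp, this]
        simp only [Equiv.apply_symm_apply]
    · have hb0 : 0 < b.val := by omega
      have hσb : σ b = b := Fin.ext (by rw [hval]; split_ifs <;> omega)
      have := hx.eq_of_isNearest hn (hlate b hb hb0)
      refine ⟨b, hb0, ?_⟩
      simp only [Function.comp_apply]
      rw [hσb, ← this]
      exact Sym2.eq_swap

lemma nnTree_comp (hx : IsRow h k x) (hh : 0 < h) (hhk : h ≤ 1 / (8 * k)) (hkn : k ≤ n)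
    (i : Fin k) : nnTree h (x ∘ rotateRow hkn i) = nnTree h x := by
  -- The unrotated order is the rotation that starts at 0, so the same description of the edges
  -- applies to it.
  have h0 : x = x ∘ rotateRow hkn ⟨0, i.pos⟩ := by
    funext j
    simp only [Function.comp_apply]
    congr 1
    apply Fin.ext
    rw [rotateRow_val]
    simp only
    split_ifs <;> omega
  have hedges : (nnTree h (x ∘ rotateRow hkn i)).edges = (nnTree h x).edges := by
    conv_rhs => rw [h0]
    ext z
    rw [hx.edges_nnTree hh hhk hkn, hx.edges_nnTree hh hhk hkn]
  have hverts : (nnTree h (x ∘ rotateRow hkn i)).verts = (nnTree h x).verts := by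
    ext z
    simp only [nnTree, mem_verts_unlabel, Function.comp_apply]
    exact ⟨fun ⟨j, hj⟩ => ⟨_, hj⟩, fun ⟨j, hj⟩ => ⟨(rotateRow hkn i).symm j, by simpa using hj⟩⟩
  cases hT : nnTree h x
  cases hT' : nnTree h (x ∘ rotateRow hkn i)
  rw [hT, hT'] at hedges hverts
  simp only at hedges hverts
  rw [hedges, hverts]

end IsRow

/-! ### Ties have probability zero -/

lemma exists_circDist_sq {a b : ℝ} (ha : a ∈ Set.Ico (0 : ℝ) 1) (hb : b ∈ Set.Ico (0 : ℝ) 1) :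
    ∃ m ∈ Finset.Icc (-1 : ℤ) 1, circDist 1 a b ^ 2 = (a - b - m) ^ 2 := by
  obtain ⟨h1, h2⟩ := ha
  obtain ⟨h3, h4⟩ := hb
  unfold circDist
  rcases min_choice |a - b| (1 - |a - b|) with h | h
  · exact ⟨0, by simp, by rw [h, sq_abs]; simp⟩
  · rw [h]
    rcases abs_cases (a - b) with ⟨e, -⟩ | ⟨e, -⟩
    · exact ⟨1, by simp, by rw [e]; push_cast; ring⟩
    · exact ⟨-1, by simp, by rw [e]; push_cast; ring⟩

lemma volume_graph_eq_zero {g : ℝ → ℝ} (hg : Measurable g) :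
    volume {z : Pt | z.1 = g z.2} = 0 := by
  have hm : MeasurableSet {z : Pt | z.1 = g z.2} :=
    measurableSet_eq_fun measurable_fst (hg.comp measurable_snd)
  rw [Measure.volume_eq_prod, Measure.prod_apply_symm hm]
  simp only [Set.preimage_ofPred_eq]
  simp

lemma measurable_circDist (L : ℝ) {α : Type*} [MeasurableSpace α] {f g : α → ℝ}
    (hf : Measurable f) (hg : Measurable g) : Measurable fun z => circDist L (f z) (g z) := by
  unfold circDist
  have : Measurable fun z => |f z - g z| := (hf.sub hg).norm
  exact this.min (measurable_const.sub this)

lemma measurable_stripDist (h : ℝ) {α : Type*} [MeasurableSpace α] {f g : α → Pt}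
    (hf : Measurable f) (hg : Measurable g) : Measurable fun z => stripDist h (f z) (g z) := by
  unfold stripDist
  exact (((measurable_circDist 1 hf.fst hg.fst).pow_const 2).add
    ((measurable_circDist h hf.snd hg.snd).pow_const 2)).sqrt

/-- The bisector of two points is a null set. -/
lemma strip_bisector {h : ℝ} {a b : Pt} (ha : a ∈ strip h) (hb : b ∈ strip h) (hab : a.1 ≠ b.1) :
    ((volume : Measure Pt)[|strip h]) {z | stripDist h z a = stripDist h z b} = 0 := by
  have hae : ∀ᵐ z ∂((volume : Measure Pt)[|strip h]), z ∈ strip h :=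
    ae_cond_mem (measurableSet_strip h)
  -- For fixed integer translates the squares of `z.1` cancel in the tie equation. It becomes linear
  -- in `z.1`, so for given `z.2` there is a single solution, and the bisector lies in countably
  -- many graphs.
  set g : ℤ → ℤ → ℝ → ℝ := fun m m' y =>
    (circDist h y b.2 ^ 2 - circDist h y a.2 ^ 2 + (b.1 + m') ^ 2 - (a.1 + m) ^ 2) /
      (2 * (b.1 + m' - a.1 - m)) with hg
  have hgm : ∀ m m', Measurable (g m m') := by
    intro m m'
    refine Measurable.div_const ?_ _
    exact (((((measurable_circDist h measurable_id measurable_const).pow_const 2).sub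
      ((measurable_circDist h measurable_id measurable_const).pow_const 2)).add_const _).sub_const _)
  have hnull : ((volume : Measure Pt)[|strip h])
      (⋃ m : ℤ, ⋃ m' : ℤ, {z : Pt | z.1 = g m m' z.2}) = 0 := by
    refine cond_absolutelyContinuous ?_
    rw [measure_iUnion_null_iff]
    intro m
    rw [measure_iUnion_null_iff]
    intro m'
    exact volume_graph_eq_zero (hgm m m')
  rw [measure_eq_zero_iff_ae_notMem]
  filter_upwards [hae, measure_eq_zero_iff_ae_notMem.1 hnull] with z hz hz' htie
  obtain ⟨m, hm, e1⟩ := exists_circDist_sq hz.1 ha.1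
  obtain ⟨m', hm', e2⟩ := exists_circDist_sq hz.1 hb.1
  refine hz' ?_
  simp only [Set.mem_iUnion]
  refine ⟨m, m', ?_⟩
  have htie : stripDist h z a = stripDist h z b := htie
  unfold stripDist at htie
  rw [Real.sqrt_inj (by positivity) (by positivity), e1, e2] at htie
  -- The first coordinates differ by less than one, so the coefficient could vanish only for equal
  -- translates and equal first coordinates.
  have hden : b.1 + m' - a.1 - m ≠ 0 := by
    intro h0
    obtain ⟨⟨a0, a1⟩, -⟩ := ha
    obtain ⟨⟨b0, b1⟩, -⟩ := hb
    have hmm : m = m' := by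
      have h1 : ((m - m' : ℤ) : ℝ) < 1 := by push_cast; linarith
      have h2 : ((-1 : ℤ) : ℝ) < ((m - m' : ℤ) : ℝ) := by push_cast; linarith
      have h1' : m - m' < 1 := by exact_mod_cast h1
      have h2' : -1 < m - m' := by exact_mod_cast h2
      omega
    rw [hmm] at h0
    exact hab (by linarith)
  show z.1 = g m m' z.2
  rw [hg, eq_div_iff (by simpa using hden)]
  linarith

lemma ae_noTie {h : ℝ} (hh : 0 < h) (n : ℕ) : ∀ᵐ x ∂stripLaw h n, ∀ j i l : Fin n, i < j → l < j →
    i ≠ l → stripDist h (x j) (x i) ≠ stripDist h (x j) (x l) := by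
  rw [ae_all_iff]; intro j
  rw [ae_all_iff]; intro i
  rw [ae_all_iff]; intro l
  by_cases hc : i < j ∧ l < j ∧ i ≠ l
  swap
  · exact Filter.Eventually.of_forall fun x h1 h2 h3 => absurd ⟨h1, h2, h3⟩ hc
  obtain ⟨hi, hl, hil⟩ := hc
  set A : Set (Fin n → Pt) := {x | stripDist h (x j) (x i) = stripDist h (x j) (x l)} ∩
    ({x | x i ∈ strip h} ∩ ({x | x l ∈ strip h} ∩ {x | (x i).1 = (x l).1}ᶜ)) with hA
  have hAm : MeasurableSet A := by
    refine MeasurableSet.inter (measurableSet_eq_fun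
      (measurable_stripDist h (measurable_pi_apply j) (measurable_pi_apply i))
      (measurable_stripDist h (measurable_pi_apply j) (measurable_pi_apply l))) ?_
    refine MeasurableSet.inter (measurable_pi_apply i (measurableSet_strip h)) ?_
    refine MeasurableSet.inter (measurable_pi_apply l (measurableSet_strip h)) ?_
    exact (measurableSet_eq_fun (measurable_pi_apply i).fst (measurable_pi_apply l).fst).compl
  have hA0 : stripLaw h n A = 0 := by
    refine le_antisymm (stripLaw_le_of_update hh j hAm fun x => ?_) zero_le
    have hset : {z | Function.update x j z ∈ A} = {z | stripDist h z (x i) = stripDist h z (x l) ∧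
        x i ∈ strip h ∧ x l ∈ strip h ∧ (x i).1 ≠ (x l).1} := by
      ext z
      simp [hA, Function.update_of_ne hi.ne, Function.update_of_ne hl.ne]
    rw [hset]
    by_cases hc : x i ∈ strip h ∧ x l ∈ strip h ∧ (x i).1 ≠ (x l).1
    · refine (measure_mono fun z hz => ?_).trans (strip_bisector hc.1 hc.2.1 hc.2.2).le
      exact hz.1
    · refine (measure_mono (t := ∅) fun z hz => hc hz.2).trans (by simp)
  filter_upwards [measure_eq_zero_iff_ae_notMem.1 hA0, ae_mem_strip hh n, ae_fst_ne hh n]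
    with x h1 h2 h3 _ _ _ htie
  exact h1 ⟨htie, h2 i, h2 l, h3 i l hil⟩

/-! ### The probability of a row and the lower bound -/

/-- Only the horizontal coordinates of the first `k` points are constrained, each to a window of
length 1/(16k); the remaining conditions hold almost surely. -/
lemma le_stripLaw_isRow {h : ℝ} (hh : 0 < h) {n k : ℕ} (hkn : k ≤ n) :
    ENNReal.ofReal ((1 / (16 * k)) ^ k) ≤ stripLaw h n {x | IsRow h k x} := by
  classical
  have := isProbabilityMeasure_strip hh
  set W : Fin n → Set Pt := fun i => if i.val < k then
    Prod.fst ⁻¹' Set.Ico ((i : ℝ) / (4 * k)) ((i : ℝ) / (4 * k) + 1 / (16 * k)) else Set.univ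
    with hW
  have hbox : stripLaw h n (Set.pi Set.univ W) = ENNReal.ofReal ((1 / (16 * k)) ^ k) := by
    rw [stripLaw, Measure.pi_pi]
    have : ∀ i : Fin n, ((volume : Measure Pt)[|strip h]) (W i) =
        if i.val < k then ENNReal.ofReal (1 / (16 * k)) else 1 := by
      intro i
      simp only [hW]
      split_ifs with hi
      · have hk : (0 : ℝ) < k := by
          have : 0 < k := by omega
          exact_mod_cast this
        have hi' : (i : ℝ) + 1 ≤ k := by exact_mod_cast hi
        have hle : (i : ℝ) / (4 * k) + 1 / (16 * k) ≤ 1 := by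
          rw [div_add_div _ _ (by positivity) (by positivity), div_le_one (by positivity)]
          nlinarith
        rw [← Measure.map_apply measurable_fst measurableSet_Ico, map_fst_strip hh,
          Measure.restrict_apply measurableSet_Ico,
          Set.inter_eq_left.2 (Set.Ico_subset_Ico (by positivity) hle), Real.volume_Ico]
        congr 1
        ring
      · exact measure_univ
    simp only [this]
    rw [← Finset.prod_filter, Finset.prod_const, ENNReal.ofReal_pow (by positivity)]
    congr 1
    rw [Fin.card_filter_val_lt]
    omega
  rw [← hbox]
  refine measure_mono_ae ?_
  filter_upwards [ae_mem_strip hh n, ae_injective hh n, ae_noTie hh n] with x h1 h2 h3 hx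
  refine ⟨h1, h2, h3, fun i hi => ?_⟩
  have := hx i (Set.mem_univ i)
  simpa [hW, hi] using this

lemma measurePreserving_comp_perm {h : ℝ} (hh : 0 < h) {n : ℕ} (σ : Equiv.Perm (Fin n)) :
    MeasurePreserving (fun x : Fin n → Pt => x ∘ σ) (stripLaw h n) (stripLaw h n) := by
  have := isProbabilityMeasure_strip hh
  have := measurePreserving_piCongrLeft (fun _ : Fin n => (volume : Measure Pt)[|strip h]) σ.symm
  refine ⟨by fun_prop, ?_⟩
  unfold stripLaw
  convert this.map_eq using 2
  ext x j : 2
  have h1 := MeasurableEquiv.piCongrLeft_apply_apply (β := fun _ : Fin n => Pt) σ.symm x (σ j)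
  rw [Equiv.symm_apply_apply] at h1
  exact h1.symm

/-- A procedure that returns fewer than `k` vertices misses the root for one of the `k` rotations of
every row. -/
lemma le_prob_notMem {h : ℝ} (hh : 0 < h) {n k : ℕ} (hn : 0 < n) (hkn : k ≤ n)
    (hhk : h ≤ 1 / (8 * k)) {Ω : Type*} [MeasurableSpace Ω] (ν : Measure Ω) [IsProbabilityMeasure ν]
    (H : Ω → EmbeddedTree → Finset Pt)
    (hH : ∀ (ω : Ω) (T : EmbeddedTree), IsNNTree h n T → (H ω T).card < k) :
    ENNReal.ofReal ((1 / (16 * k)) ^ k) ≤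
      k * (ν.prod (stripLaw h n)) {q | q.2 ⟨0, hn⟩ ∉ H q.1 (nnTree h q.2)} := by
  classical
  have := isProbabilityMeasure_stripLaw hh n
  set A : Set (Ω × (Fin n → Pt)) := {q | q.2 ⟨0, hn⟩ ∉ H q.1 (nnTree h q.2)} with hA
  set f : Fin k → Ω × (Fin n → Pt) → Ω × (Fin n → Pt) :=
    fun i => Prod.map id fun x => x ∘ rotateRow hkn i with hf
  -- All rotations of a row give one tree, to which `H ω` answers with one set. It has fewer than
  -- `k` elements and so misses a row point, and that point is the root in one of the rotations.
  have hsub : Set.univ ×ˢ {x | IsRow h k x} ⊆ ⋃ i : Fin k, f i ⁻¹' A := by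
    rintro ⟨ω, x⟩ ⟨-, hx⟩
    have hx : IsRow h k x := hx
    have hcard := hH ω (nnTree h x) ⟨x, nnParent h x, hx.injective, hx.mem,
      fun j hj => isNearest_nnParent x hj, rfl⟩
    obtain ⟨i, hi⟩ : ∃ i : Fin k, x ⟨i, by omega⟩ ∉ H ω (nnTree h x) := by
      by_contra! hcon
      have := Finset.card_le_card_of_injOn (s := (Finset.univ : Finset (Fin k)))
        (fun i : Fin k => x ⟨i, by omega⟩) (fun i _ => hcon i)
        (fun i _ j _ hij => Fin.ext (by simpa using hx.injective hij))
      simp only [Finset.card_univ, Fintype.card_fin] at this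
      omega
    refine Set.mem_iUnion.2 ⟨i, ?_⟩
    change (x ∘ rotateRow hkn i) ⟨0, hn⟩ ∉ H ω (nnTree h (x ∘ rotateRow hkn i))
    rw [hx.nnTree_comp hh hhk hkn]
    convert hi using 2
    simp only [Function.comp_apply]
    congr 1
    apply Fin.ext
    rw [rotateRow_val]
    have := i.isLt
    simp only
    split_ifs <;> omega
  have hfm : ∀ i, MeasurePreserving (f i) (ν.prod (stripLaw h n)) (ν.prod (stripLaw h n)) :=
    fun i => (MeasurePreserving.id ν).prod (measurePreserving_comp_perm hh _)
  calc ENNReal.ofReal ((1 / (16 * k)) ^ k) ≤ stripLaw h n {x | IsRow h k x} :=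
        le_stripLaw_isRow hh hkn
    _ = (ν.prod (stripLaw h n)) (Set.univ ×ˢ {x | IsRow h k x}) := by
        rw [Measure.prod_prod, measure_univ, one_mul]
    _ ≤ (ν.prod (stripLaw h n)) (⋃ i : Fin k, f i ⁻¹' A) := measure_mono hsub
    _ ≤ ∑ i : Fin k, (ν.prod (stripLaw h n)) (f i ⁻¹' A) := measure_iUnion_fintype_le _ _
    -- `A` need not be measurable, as `H` is arbitrary; for a measure preserving map this inequality
    -- still holds for the outer measure.
    _ ≤ ∑ _i : Fin k, (ν.prod (stripLaw h n)) A :=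
        Finset.sum_le_sum fun i _ => (hfm i).measure_preimage_le A
    _ = k * (ν.prod (stripLaw h n)) A := by simp

/-- With s = L/log L and k = ⌊s/8⌋ + 1, eventually 16k ≤ L and k + 1 ≤ s/4, so (16k)^(k+1) ≤
exp(L/2) = ε^(-1/2). The other factor ε^(-1/2) absorbs the 2. Since 8k ≤ 2s, a height of order 1/L
is eventually at most 1/(8k). -/
lemma eventually_row_length {h : ℝ → ℝ} (hpos : ∀ ε, 0 < ε → 0 < h ε)
    (hO : h =O[𝓝[>] (0 : ℝ)] (fun ε : ℝ => (Real.log (1 / ε))⁻¹)) :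
    ∀ᶠ ε in 𝓝[>] (0 : ℝ), ∃ k : ℕ, 0 < k ∧
      k = ⌊1 / 8 * (Real.log (1 / ε) / Real.log (Real.log (1 / ε)))⌋₊ + 1 ∧
      h ε ≤ 1 / (8 * k) ∧ 2 * ε * k ≤ (1 / (16 * k)) ^ k := by
  obtain ⟨C, hC0, hC⟩ := hO.exists_pos
  have hC := hC.bound
  have hL : ∀ᶠ L : ℝ in atTop, 4 ≤ Real.log L ∧ 2 * C ≤ Real.log L ∧ Real.log L ≤ L / 16 ∧ 2 ≤ L := by
    have h3 : ∀ᶠ y : ℝ in atTop, ‖Real.log y‖ ≤ (1 / 16) * ‖y‖ :=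
      Real.isLittleO_log_id_atTop.def (by norm_num)
    filter_upwards [Real.tendsto_log_atTop.eventually_ge_atTop 4,
      Real.tendsto_log_atTop.eventually_ge_atTop (2 * C), h3, eventually_ge_atTop 2]
      with L h4 h5 h6 h7
    rw [Real.norm_eq_abs, Real.norm_eq_abs, abs_of_nonneg (by linarith : (0 : ℝ) ≤ L)] at h6
    exact ⟨h4, h5, by linarith [le_abs_self (Real.log L)], h7⟩
  filter_upwards [hC, tendsto_log_inv.eventually hL, self_mem_nhdsWithin]
    with ε h1 ⟨h2, h3, h4, h5⟩ hε
  have hε : 0 < ε := hε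
  have hh := hpos ε hε
  set L := Real.log (1 / ε) with hLdef
  set s := L / Real.log L with hs
  have hlog0 : 0 < Real.log L := by linarith
  have hs16 : 16 ≤ s := by rw [hs, le_div_iff₀ hlog0]; linarith
  have hsL : s * Real.log L = L := by rw [hs]; field_simp
  have hs4 : 4 * s ≤ L := by rw [← hsL]; nlinarith
  refine ⟨⌊1 / 8 * s⌋₊ + 1, Nat.succ_pos _, rfl, ?_⟩
  set k := ⌊1 / 8 * s⌋₊ + 1 with hk
  have hk0 : (0 : ℝ) < k := by rw [hk]; positivity
  have hk1 : (k : ℝ) ≤ s / 8 + 1 := by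
    rw [hk]; push_cast
    linarith [Nat.floor_le (show 0 ≤ 1 / 8 * s by linarith)]
  constructor
  · rw [Real.norm_eq_abs, Real.norm_eq_abs, abs_of_pos hh, abs_of_pos (by positivity)] at h1
    refine h1.trans ?_
    rw [← div_eq_mul_inv, div_le_div_iff₀ (by linarith) (by positivity)]
    have : 8 * (k : ℝ) ≤ 2 * s := by linarith
    nlinarith
  · have hlogk : Real.log (16 * k) ≤ Real.log L :=
      Real.log_le_log (by positivity) (by linarith)
    have hlogk0 : 0 ≤ Real.log (16 * k) := Real.log_nonneg (by
      have : (1 : ℝ) ≤ k := by rw [hk]; push_cast; linarith [(⌊1 / 8 * s⌋₊).cast_nonneg (α := ℝ)]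
      linarith)
    have hmain : (16 * (k : ℝ)) ^ (k + 1) ≤ Real.exp (L / 2) := by
      rw [← Real.log_le_iff_le_exp (by positivity), Real.log_pow]
      push_cast
      have : ((k : ℝ) + 1) * Real.log (16 * k) ≤ s / 4 * Real.log L :=
        mul_le_mul (by linarith) hlogk hlogk0 (by linarith)
      linarith
    have hexp : Real.exp (L / 2) * Real.exp (L / 2) = 1 / ε := by
      rw [← Real.exp_add, add_halves, hLdef, Real.exp_log (by positivity)]
    have h2e : 2 ≤ Real.exp (L / 2) := by
      linarith [Real.add_one_le_exp (L / 2)]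
    have hfin : 2 * (16 * (k : ℝ)) ^ (k + 1) * ε ≤ 1 := by
      have : 2 * (16 * (k : ℝ)) ^ (k + 1) ≤ 1 / ε := by
        rw [← hexp]
        exact mul_le_mul h2e hmain (by positivity) (by positivity)
      rwa [le_div_iff₀ hε] at this
    rw [one_div_pow, le_div_iff₀ (by positivity)]
    refine le_trans ?_ hfin
    rw [pow_succ (16 * (k : ℝ)) k]
    have : 0 ≤ ε * (16 * (k : ℝ)) ^ k * k := by positivity
    nlinarith

theorem exists_root_lower_bound :
    ∃ c : ℝ, 0 < c ∧
      ∀ h : ℝ → ℝ, (∀ ε, 0 < ε → 0 < h ε) →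
        h =O[𝓝[>] (0 : ℝ)] (fun ε : ℝ => (Real.log (1 / ε))⁻¹) →
        ∀ᶠ ε in 𝓝[>] (0 : ℝ), ∃ δ : ℝ, 0 < δ ∧
          ∀ (n : ℕ) (hn : 0 < n),
            c * (Real.log (1 / ε) / Real.log (Real.log (1 / ε))) < (n : ℝ) →
            ∀ (Ω : Type) [MeasurableSpace Ω] (ν : Measure Ω) [IsProbabilityMeasure ν]
              (H : Ω → EmbeddedTree → Finset Pt),
              (∀ (ω : Ω) (T : EmbeddedTree), IsNNTree (h ε) n T →
                ((H ω T).card : ℝ) ≤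
                  c * (Real.log (1 / ε) / Real.log (Real.log (1 / ε)))) →
              ENNReal.ofReal (ε + δ) ≤
                (ν.prod (stripLaw (h ε) n))
                  {q | q.2 ⟨0, hn⟩ ∉ H q.1 (nnTree (h ε) q.2)} := by
  refine ⟨1 / 8, by norm_num, fun h hpos hO => ?_⟩
  filter_upwards [eventually_row_length hpos hO, self_mem_nhdsWithin] with ε ⟨k, hk0, hk, hhk, hεk⟩ hε
  have hε : 0 < ε := hε
  -- The row estimate yields a failure probability of at least 2ε, so δ = ε.
  refine ⟨ε, hε, fun n hn hns Ω _ ν _ H hH => ?_⟩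
  have hkn : k ≤ n := by
    have := Nat.floor_lt' (a := 1 / 8 * (Real.log (1 / ε) / Real.log (Real.log (1 / ε))))
      hn.ne'
    rw [hk]
    exact this.2 hns
  have hcard : ∀ (ω : Ω) (T : EmbeddedTree), IsNNTree (h ε) n T → (H ω T).card < k := by
    intro ω T hT
    rw [hk, Nat.lt_succ_iff]
    exact Nat.le_floor (hH ω T hT)
  have hmain := le_prob_notMem (hpos ε hε) hn hkn hhk ν H hcard
  have hk0' : (k : ENNReal) ≠ 0 := by exact_mod_cast hk0.ne'
  refine (ENNReal.mul_le_mul_iff_right hk0' (ENNReal.natCast_ne_top k)).1 (le_trans ?_ hmain)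
  rw [← ENNReal.ofReal_natCast, ← ENNReal.ofReal_mul (by positivity)]
  exact ENNReal.ofReal_le_ofReal (by linarith)

theorem corollary4p1 :
    (∃ (P : RamProg) (H : ℝ → EmbeddedTree → Finset Pt) (C₁ C₂ : ℝ),
      ∀ h : ℝ → ℝ, (∀ ε, 0 < ε → 0 < h ε) →
        h =O[𝓝[>] (0 : ℝ)] (fun ε : ℝ => ε ^ 5) →
        ∀ᶠ ε in 𝓝[>] (0 : ℝ), ∀ (n : ℕ) (hn : 0 < n),
          (∀ T : EmbeddedTree, IsNNTree (h ε) n T →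
            H ε T ⊆ T.verts ∧
            ((H ε T).card : ℝ) ≤ C₁ * (Real.log (1 / ε) / Real.log (Real.log (1 / ε))) ∧
            ReturnsWithin P ε n T (H ε T) (C₂ * ((n : ℝ) ^ 2 + Real.log (1 / ε) ^ 2))) ∧
          stripLaw (h ε) n {x | x ⟨0, hn⟩ ∉ H ε (nnTree (h ε) x)} ≤ ENNReal.ofReal ε) ∧
    (∃ c : ℝ, 0 < c ∧
      ∀ h : ℝ → ℝ, (∀ ε, 0 < ε → 0 < h ε) →
        h =O[𝓝[>] (0 : ℝ)] (fun ε : ℝ => (Real.log (1 / ε))⁻¹) →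
        ∀ᶠ ε in 𝓝[>] (0 : ℝ), ∃ δ : ℝ, 0 < δ ∧
          ∀ (n : ℕ) (hn : 0 < n),
            c * (Real.log (1 / ε) / Real.log (Real.log (1 / ε))) < (n : ℝ) →
            ∀ (Ω : Type) [MeasurableSpace Ω] (ν : Measure Ω) [IsProbabilityMeasure ν]
              (H : Ω → EmbeddedTree → Finset Pt),
              (∀ (ω : Ω) (T : EmbeddedTree), IsNNTree (h ε) n T →
                ((H ω T).card : ℝ) ≤
                  c * (Real.log (1 / ε) / Real.log (Real.log (1 / ε)))) →
              ENNReal.ofReal (ε + δ) ≤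
                (ν.prod (stripLaw (h ε) n))
                  {q | q.2 ⟨0, hn⟩ ∉ H q.1 (nnTree (h ε) q.2)}) :=
  ⟨exists_rootProg_bounds, exists_root_lower_bound⟩
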